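/- Let $C$ be a Lie 2-category: a small strict 2-category whose sets $C_0, C_1, C_2$ of objects, arrows and 2-cells are (finite-dimensional, Hausdorff, second countable) smooth manifolds, such that the source and target maps $s,t:C_1\to C_0$ and $s,t:C_2\to C_1$ are surjective submersions and the units, the composition $\circ$ of arrows, and the vertical composition $\bullet$ and horizontal composition $\circ$ of 2-cells are smooth. Assume that every 2-cell is invertible with respect to $\bullet$ and that the inversion $C_2\to C_2$ is smooth. Let $NC$ be the nerve of $C$: the simplicial set with $N_nC$ the set of normal lax functors $u:[n]\dashrightarrow C$ (with objects $u_i$, arrows $u_{j,i}:u_i\to u_j$ for $i\le j$, and 2-cells $u_{k,j,i}:u_{k,i}\Rightarrow u_{k,j}\circ u_{j,i}$ for $i\le j\le k$), and with simplicial operators given by precomposition. Let $AC$ be the simplicial manifold $A_nC=\prod_{a:[2]\to[n]}C_2$, $(b^*u)_a=u_{b\circ a}$, and let $\phi:NC\to AC$ be the canonical inclusion, $\phi(u)_a=(u\circ a)_{2,1,0}$. Then there are smooth manifold structures on all the sets $N_nC$, $n\ge 0$, such that: 1. All simplicial operators of $NC$ are smooth, that is, $NC$ is a simplicial manifold. 2.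 For every $n$ the map $\phi:N_nC\to A_nC$ is a closed embedding, and the smooth structure of $N_nC$ is the only one with this property. 3. The identifications $N_0C=C_0$ and $N_1C=C_1$ are diffeomorphisms. 4. $N_{n+1}C$ is obtained from $N_nC$ by iterated fibre products of manifolds. For $0\le k\le n$ let $F_k\Delta^{n+1}\subset\Delta^{n+1}$ be the union of the face $\Delta^n$ opposite to the vertex $n+1$ and the face with vertices $k,\dots,n+1$, and let $N^k_{n+1}C$ be the set of simplicial maps $F_k\Delta^{n+1}\to NC$. Then, for every $n\ge0$, there are manifold structures on the sets $N^k_{n+1}C$ such that $$N^{n}_{n+1}C\cong N_nC\times_{C_0}C_1$$ (along $u\mapsto u_n$ and $s$, by restriction to $\Delta^n$ and the arrow $u_{n+1,n}$), such that for $0\le k<n$ $$N^{k}_{n+1}C\cong N^{k+1}_{n+1}C\times_{C_1}C_2$$ (along $u\mapsto u_{n+1,k+1}\circ u_{k+1,k}$ and $t$, by restriction to $F_{k+1}\Delta^{n+1}$ and the 2-cell $u_{n+1,k+1,k}$), and such that the restriction $N_{n+1}C\to N^0_{n+1}C$ is a diffeomorphism. Here a fibre product of manifolds $X\times_ZY$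 along smooth maps is an embedded submanifold of $X\times Y$. -/

import Mathlib

open CategoryTheory Opposite
open scoped Manifold ContDiff

universe u v w u' v' w'

namespace LieTwo

/-! ### Smooth manifolds -/

/-- A finite-dimensional smooth manifold: Hausdorff, second countable, without boundary, with all
charts in one `ℝ^dim`. -/
class SmoothManifold (X : Type u) extends TopologicalSpace X where
  dim : ℕ
  chartedSpace : ChartedSpace (EuclideanSpace ℝ (Fin dim)) X
  isManifold : IsManifold (𝓡 dim) ∞ X
  t2Space : T2Space X
  secondCountable : SecondCountableTopology X

attribute [reducible, instance] SmoothManifold.chartedSpace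

attribute [instance] SmoothManifold.isManifold
  SmoothManifold.t2Space SmoothManifold.secondCountable

/-- The model (with corners, but without boundary) of a smooth manifold. -/
noncomputable abbrev model (X : Type u) [SmoothManifold X] :
    ModelWithCorners ℝ (EuclideanSpace ℝ (Fin (SmoothManifold.dim X)))
      (EuclideanSpace ℝ (Fin (SmoothManifold.dim X))) :=
  𝓡 (SmoothManifold.dim X)

/-- Smooth maps between manifolds. -/
def Smooth {X Y : Type u} [SmoothManifold X] [SmoothManifold Y] (f : X → Y) : Prop :=
  ContMDiff (model X) (model Y) ∞ f

/-- `f` is a diffeomorphism. -/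
def IsDiffeo {X Y : Type u} [SmoothManifold X] [SmoothManifold Y] (f : X → Y) : Prop :=
  ∃ Φ : Diffeomorph (model X) (model Y) X Y ∞, ⇑Φ = f

/-- `f` is a surjective submersion. -/
def IsSurjSubmersion {X Y : Type u} [SmoothManifold X] [SmoothManifold Y] (f : X → Y) : Prop :=
  Function.Surjective f ∧ Manifold.IsSubmersion (model X) (model Y) ∞ f

/-- A map `f : S → Z` on a subset `S` of the manifold `X × Y` is smooth if it extends locally, around
every point of `S`, to a smooth map on an open subset of `X × Y`. When `S` is an embedded
submanifold this is smoothness for the submanifold structure. -/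
def SmoothOnSubset {X Y Z : Type u} [SmoothManifold X] [SmoothManifold Y] [SmoothManifold Z]
    {S : Set (X × Y)} (f : S → Z) : Prop :=
  ∀ p : S, ∃ U : Set (X × Y), IsOpen U ∧ (p : X × Y) ∈ U ∧ ∃ F : X × Y → Z,
    ContMDiffOn ((model X).prod (model Y)) (model Z) ∞ F U ∧
      ∀ q : S, (q : X × Y) ∈ U → F q = f q

/-- The square with sides `p : P → X`, `q : P → Y`, `f : X → Z`, `g : Y → Z` exhibits the manifold
`P` as the fibre product `X ×_Z Y` of manifolds: all maps are smooth, and `(p, q)` is a smooth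
embedding of `P` in `X × Y` with image the set of all `(x, y)` with `f x = g y`. -/
structure IsFibreProduct {P X Y Z : Type u} [SmoothManifold P] [SmoothManifold X]
    [SmoothManifold Y] [SmoothManifold Z] (p : P → X) (q : P → Y) (f : X → Z) (g : Y → Z) :
    Prop where
  smooth_left : Smooth f
  smooth_right : Smooth g
  embedding : Manifold.IsSmoothEmbedding (model P) ((model X).prod (model Y)) ∞
    (fun w => (p w, q w))
  range_eq : Set.range (fun w => (p w, q w)) = {z : X × Y | f z.1 = g z.2}

/-! ### 2-categories and lax functors -/

/-- A small (strict) 2-category with sets `C₀`, `C₁`, `C₂` of objects, arrows and 2-cells. The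
composition of arrows is `comp g f = g ∘ f`, the vertical composition of 2-cells is
`vcomp β α = β • α`, and the horizontal one is `hcomp β α = β ∘ α`. Wherever an axiom
needs that some pair is composable although this follows from other axioms, the corresponding
(automatic) equation is a further argument. -/
structure TwoCategory (C₀ : Type u) (C₁ : Type v) (C₂ : Type w) where
  src : C₁ → C₀
  tgt : C₁ → C₀
  one : C₀ → C₁
  comp (g f : C₁) (h : src g = tgt f) : C₁
  src₂ : C₂ → C₁
  tgt₂ : C₂ → C₁
  one₂ : C₁ → C₂
  src_src₂ (α : C₂) : src (src₂ α) = src (tgt₂ α)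
  tgt_src₂ (α : C₂) : tgt (src₂ α) = tgt (tgt₂ α)
  vcomp (β α : C₂) (h : src₂ β = tgt₂ α) : C₂
  hcomp (β α : C₂) (h : src (src₂ β) = tgt (src₂ α)) : C₂
  -- objects and arrows form a category
  src_one (x : C₀) : src (one x) = x
  tgt_one (x : C₀) : tgt (one x) = x
  src_comp (g f : C₁) (h) : src (comp g f h) = src f
  tgt_comp (g f : C₁) (h) : tgt (comp g f h) = tgt g
  one_comp (f : C₁) (h) : comp (one (tgt f)) f h = f
  comp_one (f : C₁) (h) : comp f (one (src f)) h = f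
  comp_assoc (k g f : C₁) (hkg hgf hk hf) :
    comp k (comp g f hgf) hk = comp (comp k g hkg) f hf
  -- arrows and 2-cells form a category under vertical composition
  src₂_one₂ (f : C₁) : src₂ (one₂ f) = f
  tgt₂_one₂ (f : C₁) : tgt₂ (one₂ f) = f
  src₂_vcomp (β α : C₂) (h) : src₂ (vcomp β α h) = src₂ α
  tgt₂_vcomp (β α : C₂) (h) : tgt₂ (vcomp β α h) = tgt₂ β
  one₂_vcomp (α : C₂) (h) : vcomp (one₂ (tgt₂ α)) α h = α
  vcomp_one₂ (α : C₂) (h) : vcomp α (one₂ (src₂ α)) h = α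
  vcomp_assoc (γ β α : C₂) (hγβ hβα hγ hα) :
    vcomp γ (vcomp β α hβα) hγ = vcomp (vcomp γ β hγβ) α hα
  -- horizontal composition is functorial
  src₂_hcomp (β α : C₂) (h) : src₂ (hcomp β α h) = comp (src₂ β) (src₂ α) h
  tgt₂_hcomp (β α : C₂) (h) (h') : tgt₂ (hcomp β α h) = comp (tgt₂ β) (tgt₂ α) h'
  hcomp_one₂ (g f : C₁) (h) (h') : hcomp (one₂ g) (one₂ f) h' = one₂ (comp g f h)
  interchange (β' β α' α : C₂) (hβ hα h h' h'' h''') :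
    hcomp (vcomp β' β hβ) (vcomp α' α hα) h = vcomp (hcomp β' α' h') (hcomp β α h'') h'''
  -- horizontal composition is unital and associative
  one_hcomp (α : C₂) (h) : hcomp (one₂ (one (tgt (src₂ α)))) α h = α
  hcomp_one (α : C₂) (h) : hcomp α (one₂ (one (src (src₂ α)))) h = α
  hcomp_assoc (γ β α : C₂) (hγβ hβα hγ hα) :
    hcomp γ (hcomp β α hβα) hγ = hcomp (hcomp γ β hγβ) α hα

/-- A normal lax functor `C ⇢ D`, with structure 2-cells
`mapComp g f : map₁ (g ∘ f) ⇒ map₁ g ∘ map₁ f`. -/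
@[ext]
structure LaxFunctor {C₀ : Type u} {C₁ : Type v} {C₂ : Type w} {D₀ : Type u'} {D₁ : Type v'}
    {D₂ : Type w'} (C : TwoCategory C₀ C₁ C₂)
    (D : TwoCategory D₀ D₁ D₂) where
  map₀ : C₀ → D₀
  map₁ : C₁ → D₁
  map₂ : C₂ → D₂
  mapComp (g f : C₁) (h : C.src g = C.tgt f) : D₂
  src_map₁ (f : C₁) : D.src (map₁ f) = map₀ (C.src f)
  tgt_map₁ (f : C₁) : D.tgt (map₁ f) = map₀ (C.tgt f)
  src₂_map₂ (α : C₂) : D.src₂ (map₂ α) = map₁ (C.src₂ α)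
  tgt₂_map₂ (α : C₂) : D.tgt₂ (map₂ α) = map₁ (C.tgt₂ α)
  map₁_one (x : C₀) : map₁ (C.one x) = D.one (map₀ x)
  map₂_one₂ (f : C₁) : map₂ (C.one₂ f) = D.one₂ (map₁ f)
  map₂_vcomp (β α : C₂) (h) (h') : map₂ (C.vcomp β α h) = D.vcomp (map₂ β) (map₂ α) h'
  src₂_mapComp (g f : C₁) (h) : D.src₂ (mapComp g f h) = map₁ (C.comp g f h)
  tgt₂_mapComp (g f : C₁) (h) (h') : D.tgt₂ (mapComp g f h) = D.comp (map₁ g) (map₁ f) h'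
  -- normality
  mapComp_one_left (f : C₁) (h) : mapComp (C.one (C.tgt f)) f h = D.one₂ (map₁ f)
  mapComp_one_right (f : C₁) (h) : mapComp f (C.one (C.src f)) h = D.one₂ (map₁ f)
  -- naturality
  mapComp_natural (β α : C₂) (h h₁ h₂ h₃ h₄ h₅) :
    D.vcomp (D.hcomp (map₂ β) (map₂ α) h₁) (mapComp (C.src₂ β) (C.src₂ α) h₂) h₃ =
      D.vcomp (mapComp (C.tgt₂ β) (C.tgt₂ α) h₄) (map₂ (C.hcomp β α h)) h₅
  -- coherence
  mapComp_assoc (k g f : C₁) (hkg hgf h₁ h₂ h₃ h₄ h₅ h₆) :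
    D.vcomp (D.hcomp (mapComp k g hkg) (D.one₂ (map₁ f)) h₁)
        (mapComp (C.comp k g hkg) f h₂) h₃ =
      D.vcomp (D.hcomp (D.one₂ (map₁ k)) (mapComp g f hgf) h₄)
        (mapComp k (C.comp g f hgf) h₅) h₆

/-- The ordinal `[n]` as a 2-category with only identity 2-cells: one arrow `i → j` for `i ≤ j`,
written as the pair `(i, j)`. -/
def ordinal (n : ℕ) : TwoCategory (Fin (n + 1)) {p : Fin (n + 1) × Fin (n + 1) // p.1 ≤ p.2}
    {p : Fin (n + 1) × Fin (n + 1) // p.1 ≤ p.2} where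
  src p := p.1.1
  tgt p := p.1.2
  one i := ⟨(i, i), le_rfl⟩
  comp g f h := ⟨(f.1.1, g.1.2), f.2.trans (h.symm.le.trans g.2)⟩
  src₂ p := p
  tgt₂ p := p
  one₂ p := p
  src_src₂ _ := rfl
  tgt_src₂ _ := rfl
  vcomp _ α _ := α
  hcomp g f h := ⟨(f.1.1, g.1.2), f.2.trans (h.symm.le.trans g.2)⟩
  src_one _ := rfl
  tgt_one _ := rfl
  src_comp _ _ _ := rfl
  tgt_comp _ _ _ := rfl
  one_comp _ _ := rfl
  comp_one _ _ := rfl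
  comp_assoc _ _ _ _ _ _ _ := rfl
  src₂_one₂ _ := rfl
  tgt₂_one₂ _ := rfl
  src₂_vcomp _ _ _ := rfl
  tgt₂_vcomp _ _ h := h.symm
  one₂_vcomp _ _ := rfl
  vcomp_one₂ _ _ := rfl
  vcomp_assoc _ _ _ _ _ _ _ := rfl
  src₂_hcomp _ _ _ := rfl
  tgt₂_hcomp _ _ _ _ := rfl
  hcomp_one₂ _ _ _ _ := rfl
  interchange _ _ _ _ _ _ _ _ _ _ := rfl
  one_hcomp _ _ := rfl
  hcomp_one _ _ := rfl
  hcomp_assoc _ _ _ _ _ _ _ := rfl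

section

variable {C₀ C₁ C₂ : Type u} (C : TwoCategory C₀ C₁ C₂)

/-! ### Lie 2-categories -/

/-- `C` is a Lie 2-category: sources and targets are surjective submersions, units and compositions
are smooth. -/
structure TwoCategory.IsLie [SmoothManifold C₀] [SmoothManifold C₁] [SmoothManifold C₂] : Prop where
  src : IsSurjSubmersion C.src
  tgt : IsSurjSubmersion C.tgt
  src₂ : IsSurjSubmersion C.src₂
  tgt₂ : IsSurjSubmersion C.tgt₂
  one : Smooth C.one
  one₂ : Smooth C.one₂
  comp : SmoothOnSubset
    (fun p : {p : C₁ × C₁ | C.src p.1 = C.tgt p.2} => C.comp p.1.1 p.1.2 p.2)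
  vcomp : SmoothOnSubset
    (fun p : {p : C₂ × C₂ | C.src₂ p.1 = C.tgt₂ p.2} => C.vcomp p.1.1 p.1.2 p.2)
  hcomp : SmoothOnSubset
    (fun p : {p : C₂ × C₂ | C.src (C.src₂ p.1) = C.tgt (C.src₂ p.2)} =>
      C.hcomp p.1.1 p.1.2 p.2)

/-- The 2-cells of `C` are smoothly invertible (for vertical composition). -/
def TwoCategory.SmoothlyInvertible [SmoothManifold C₂] : Prop :=
  ∃ inv : C₂ → C₂, Smooth inv ∧ ∀ α : C₂,
    ∃ (h : C.src₂ (inv α) = C.tgt₂ α) (h' : C.src₂ α = C.tgt₂ (inv α)),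
      C.vcomp (inv α) α h = C.one₂ (C.src₂ α) ∧ C.vcomp α (inv α) h' = C.one₂ (C.tgt₂ α)

variable {C} in
/-- Precomposition of a lax functor `[n] ⇢ C` with a monotone map `b : [m] → [n]`, regarded as a
(strict) functor of 2-categories. -/
def LaxFunctor.precomp {m n : ℕ} (u : LaxFunctor (ordinal n) C)
    (b : Fin (m + 1) →o Fin (n + 1)) : LaxFunctor (ordinal m) C where
  map₀ i := u.map₀ (b i)
  map₁ p := u.map₁ ⟨(b p.1.1, b p.1.2), b.monotone p.2⟩
  map₂ p := u.map₂ ⟨(b p.1.1, b p.1.2), b.monotone p.2⟩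
  mapComp q p h := u.mapComp ⟨(b q.1.1, b q.1.2), b.monotone q.2⟩
    ⟨(b p.1.1, b p.1.2), b.monotone p.2⟩ (congrArg b h)
  src_map₁ _ := u.src_map₁ _
  tgt_map₁ _ := u.tgt_map₁ _
  src₂_map₂ _ := u.src₂_map₂ _
  tgt₂_map₂ _ := u.tgt₂_map₂ _
  map₁_one _ := u.map₁_one _
  map₂_one₂ _ := u.map₂_one₂ _
  map₂_vcomp β α h h' := by
    obtain rfl : β = α := h
    exact u.map₂_vcomp _ _ rfl h'
  src₂_mapComp _ _ _ := u.src₂_mapComp _ _ _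
  tgt₂_mapComp _ _ _ _ := u.tgt₂_mapComp _ _ _ _
  mapComp_one_left p _ := u.mapComp_one_left ⟨(b p.1.1, b p.1.2), b.monotone p.2⟩ rfl
  mapComp_one_right p _ := u.mapComp_one_right ⟨(b p.1.1, b p.1.2), b.monotone p.2⟩ rfl
  mapComp_natural β α h _ _ _ _ _ :=
    u.mapComp_natural ⟨(b β.1.1, b β.1.2), b.monotone β.2⟩
      ⟨(b α.1.1, b α.1.2), b.monotone α.2⟩ (congrArg b h) _ _ _ _ _
  mapComp_assoc k g f hkg hgf _ _ _ _ _ _ :=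
    u.mapComp_assoc ⟨(b k.1.1, b k.1.2), b.monotone k.2⟩
      ⟨(b g.1.1, b g.1.2), b.monotone g.2⟩ ⟨(b f.1.1, b f.1.2), b.monotone f.2⟩
      (congrArg b hkg) (congrArg b hgf) _ _ _ _ _ _

open Simplicial

/-! ### The nerve and its ambient simplicial set -/

/-- The nerve `NC`: its `n`-simplices are the lax functors `[n] ⇢ C`, and its simplicial operators
are given by precomposition. -/
def nerve : SSet.{u} where
  obj n := LaxFunctor (ordinal n.unop.len) C
  map b := ↾(fun u => LaxFunctor.precomp u b.unop.toOrderHom)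
  map_id _ := rfl
  map_comp _ _ := rfl

/-- The set of maps `[2] → [n]` is finite. -/
noncomputable instance (n : SimplexCategory) : Fintype (⦋2⦌ ⟶ n) :=
  haveI : Finite (⦋2⦌ ⟶ n) :=
    Finite.of_injective (fun a => (a.toOrderHom : Fin 3 → Fin (n.len + 1)))
      (fun _ _ h => SimplexCategory.Hom.ext _ _ (OrderHom.ext _ _ h))
  Fintype.ofFinite _

/-- The ambient simplicial object `AC`: `A_n C` is the product of copies of `C₂` indexed by the maps
`a : [2] → [n]`, and `(b^* u)_a = u_{b ∘ a}`. -/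
def ambient (_ : TwoCategory C₀ C₁ C₂) : SSet.{u} where
  obj n := (⦋2⦌ ⟶ n.unop) → C₂
  map b := ↾(fun u a => u (a ≫ b.unop))
  map_id _ := by
    ext u a
    exact congrArg u (Category.comp_id a)
  map_comp _ _ := by
    ext u a
    exact congrArg u (Category.assoc _ _ _).symm

variable {C} in
/-- The object `u_i`. -/
def LaxFunctor.vertex {n : ℕ} (u : LaxFunctor (ordinal n) C) (i : Fin (n + 1)) : C₀ :=
  u.map₀ i

variable {C} in
/-- The arrow `u_{j,i} : u_i → u_j`, for `i ≤ j`. -/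
def LaxFunctor.edge {n : ℕ} (u : LaxFunctor (ordinal n) C) (i j : Fin (n + 1)) (h : i ≤ j) : C₁ :=
  u.map₁ ⟨(i, j), h⟩

variable {C} in
/-- The 2-cell `u_{k,j,i} : u_{k,i} ⇒ u_{k,j} ∘ u_{j,i}`, for `i ≤ j ≤ k`. -/
def LaxFunctor.triangle {n : ℕ} (u : LaxFunctor (ordinal n) C) (i j k : Fin (n + 1))
    (hij : i ≤ j) (hjk : j ≤ k) : C₂ :=
  u.mapComp ⟨(j, k), hjk⟩ ⟨(i, j), hij⟩ rfl

/-- The canonical inclusion `φ : N_n C → A_n C`, `φ(u)_a = (u ∘ a)_{2,1,0}`, in one degree. -/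
def inclusionApp (n : SimplexCategoryᵒᵖ) (u : (nerve C).obj n) : (⦋2⦌ ⟶ n.unop) → C₂ :=
  fun a => LaxFunctor.triangle ((nerve C).map a.op u) 0 1 2 (by decide) (by decide)

/-- The canonical inclusion `φ : NC → AC`, `φ(u)_a = (u ∘ a)_{2,1,0}`. -/
def canonicalInclusion : nerve C ⟶ ambient C where
  app n := ↾(fun u a => inclusionApp C n u a)
  naturality _ _ _ := rfl

/-! ### The filtration of the last face and the partial nerves -/

/-- The condition `a(m) < n + 1` or `a(0) ≥ k` on a simplex `a : [m] → [n + 1]` of `Δ^{n+1}`. -/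
def InFiltration {n : ℕ} (k : Fin (n + 1)) {m : SimplexCategory} (a : m ⟶ ⦋n + 1⦌) : Prop :=
  a.toOrderHom (Fin.last m.len) < Fin.last (n + 1) ∨ k.castSucc ≤ a.toOrderHom 0

/-- The subcomplex `F_k Δ^{n+1}`, `0 ≤ k ≤ n`: the union of the face `Δ^n` opposite to the last
vertex and the face spanned by the vertices `k, …, n + 1`. -/
def filtration (n : ℕ) (k : Fin (n + 1)) : (Δ[n + 1] : SSet.{u}).Subcomplex where
  obj _ := {a | InFiltration k (SSet.stdSimplex.objEquiv a)}
  map {m m'} b a ha := by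
    rcases ha with ha | ha
    · exact Or.inl (lt_of_le_of_lt
        ((SSet.stdSimplex.objEquiv a).toOrderHom.monotone (Fin.le_last _)) ha)
    · exact Or.inr (le_trans ha
        ((SSet.stdSimplex.objEquiv a).toOrderHom.monotone (Fin.zero_le _)))

theorem filtration_succ_le (n : ℕ) (k : Fin n) :
    filtration.{u} n k.succ ≤ filtration.{u} n k.castSucc := by
  intro m a ha
  rcases ha with ha | ha
  · exact Or.inl ha
  · exact Or.inr (le_trans (Fin.castSucc_le_castSucc_iff.2 (Fin.castSucc_lt_succ (i := k)).le) ha)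

/-- The partial nerve `N^k_{n+1} C`: the set of simplicial maps `F_k Δ^{n+1} → NC`. -/
def PartialNerve (n : ℕ) (k : Fin (n + 1)) : Type u :=
  (filtration.{u} n k : SSet.{u}) ⟶ nerve C

namespace PartialNerve

variable {C} {n : ℕ}

/-- The value of `u : F_k Δ^{n+1} → NC` on a simplex of `F_k Δ^{n+1}`. -/
def eval {k : Fin (n + 1)} (u : PartialNerve C n k) {m : SimplexCategory} (a : m ⟶ ⦋n + 1⦌)
    (ha : InFiltration k a) : LaxFunctor (ordinal m.len) C :=
  u.app (op m) ⟨SSet.stdSimplex.objEquiv.symm a, ha⟩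

theorem eval_comp {k : Fin (n + 1)} (u : PartialNerve C n k) {m m' : SimplexCategory}
    (a : m ⟶ ⦋n + 1⦌) (ha : InFiltration k a) (b : m' ⟶ m) (hb : InFiltration k (b ≫ a)) :
    u.eval (b ≫ a) hb = (u.eval a ha).precomp b.toOrderHom :=
  ConcreteCategory.congr_hom (u.naturality b.op) ⟨SSet.stdSimplex.objEquiv.symm a, ha⟩

/-- The restriction of a simplex `Δ^{n+1} → NC` to `F_k Δ^{n+1}`. -/
def ofSimplex (k : Fin (n + 1)) (u : (nerve C).obj (op ⦋n + 1⦌)) : PartialNerve C n k :=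
  (filtration.{u} n k).ι ≫ SSet.yonedaEquiv.symm u

/-- The restriction of `u : F_k Δ^{n+1} → NC` to `F_{k+1} Δ^{n+1}`. -/
def restrict (k : Fin n) (u : PartialNerve C n k.castSucc) : PartialNerve C n k.succ :=
  SSet.Subcomplex.homOfLE (filtration_succ_le n k) ≫ u

/-- The restriction of `u : F_k Δ^{n+1} → NC` to the face `Δ^n` opposite to the last vertex. -/
def toFace {k : Fin (n + 1)} (u : PartialNerve C n k) : (nerve C).obj (op ⦋n⦌) :=
  u.eval (SimplexCategory.δ (Fin.last (n + 1))) (Or.inl (by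
    change (Fin.last (n + 1)).succAbove (Fin.last n) < Fin.last (n + 1)
    simp [Fin.succAbove_last, Fin.castSucc_lt_last]))

/-- The arrow `u_{j,i}` of `u : F_k Δ^{n+1} → NC`, for an edge `(j,i)` of `F_k Δ^{n+1}`. -/
def edge {k : Fin (n + 1)} (u : PartialNerve C n k) (i j : Fin (n + 2)) (hij : i ≤ j)
    (h : j < Fin.last (n + 1) ∨ k.castSucc ≤ i) : C₁ :=
  (u.eval (SimplexCategory.mkOfLe i j hij) h).edge 0 1 (by decide)

/-- The 2-cell `u_{l,j,i}` of `u : F_k Δ^{n+1} → NC`, for a triangle `(l,j,i)` of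
`F_k Δ^{n+1}`. -/
def triangle {k : Fin (n + 1)} (u : PartialNerve C n k) (i j l : Fin (n + 2)) (hij : i ≤ j)
    (hjl : j ≤ l) (h : l < Fin.last (n + 1) ∨ k.castSucc ≤ i) : C₂ :=
  (u.eval (SimplexCategory.mkOfLeComp i j l hij hjl) h).triangle 0 1 2 (by decide) (by decide)

theorem src_edge_eq_tgt_edge {k : Fin (n + 1)} (u : PartialNerve C n k) (i j l : Fin (n + 2))
    (hij hjl h h') : C.src (u.edge j l hjl h') = C.tgt (u.edge i j hij h) := by
  have e : SimplexCategory.const ⦋0⦌ ⦋1⦌ 0 ≫ SimplexCategory.mkOfLe j l hjl =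
      SimplexCategory.const ⦋0⦌ ⦋1⦌ 1 ≫ SimplexCategory.mkOfLe i j hij := by
    ext x
    rfl
  have hv : InFiltration k (SimplexCategory.const ⦋0⦌ ⦋1⦌ 1 ≫ SimplexCategory.mkOfLe i j hij) := by
    rcases h with h | h
    · exact Or.inl h
    · exact Or.inr (h.trans hij)
  have h₁ := u.eval_comp (SimplexCategory.mkOfLe i j hij) h (SimplexCategory.const ⦋0⦌ ⦋1⦌ 1) hv
  have h₂ := u.eval_comp (SimplexCategory.mkOfLe j l hjl) h' (SimplexCategory.const ⦋0⦌ ⦋1⦌ 0) (e.symm ▸ hv)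
  have h₃ : u.eval _ (e.symm ▸ hv) = u.eval _ hv := by simp only [e]
  have h₄ := congrArg (fun v : LaxFunctor (ordinal 0) C => v.map₀ 0) (h₂.symm.trans (h₃.trans h₁))
  refine (LaxFunctor.src_map₁ _ _).trans (Eq.trans ?_ (LaxFunctor.tgt_map₁ _ _).symm)
  exact h₄

/-- The arrow `u_{n+1,n}` of `u : F_n Δ^{n+1} → NC`. -/
def lastEdge (u : PartialNerve C n (Fin.last n)) : C₁ :=
  u.edge (Fin.last n).castSucc (Fin.last (n + 1)) (Fin.le_last _) (Or.inr le_rfl)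

/-- The 2-cell `u_{n+1,k+1,k}` of `u : F_k Δ^{n+1} → NC`. -/
def newTriangle (k : Fin n) (u : PartialNerve C n k.castSucc) : C₂ :=
  u.triangle k.castSucc.castSucc k.succ.castSucc (Fin.last (n + 1))
    (Fin.castSucc_le_castSucc_iff.2 (Fin.castSucc_lt_succ (i := k)).le) (Fin.le_last _)
    (Or.inr le_rfl)

/-- The arrow `u_{n+1,k+1} ∘ u_{k+1,k}` of `u : F_{k+1} Δ^{n+1} → NC`. -/
def newComposite (k : Fin n) (u : PartialNerve C n k.succ) : C₁ :=
  C.comp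
    (u.edge k.succ.castSucc (Fin.last (n + 1)) (Fin.le_last _) (Or.inr le_rfl))
    (u.edge k.castSucc.castSucc k.succ.castSucc
      (Fin.castSucc_le_castSucc_iff.2 (Fin.castSucc_lt_succ (i := k)).le)
      (Or.inl (Fin.castSucc_lt_last _)))
    (u.src_edge_eq_tgt_edge _ _ _ _ _ _ _)

end PartialNerve

end

open Simplicial

/-- Manifold structures on the sets of simplices of `X` make `X` a simplicial manifold: all
simplicial operators are smooth. -/
def IsSimplicialManifold (X : SSet.{u}) [∀ n, SmoothManifold (X.obj n)] : Prop :=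
  ∀ {m n : SimplexCategoryᵒᵖ} (b : m ⟶ n), Smooth (fun x : X.obj m => X.map b x)

/-- `φ : N_n C → A_n C` is a closed embedding for a given manifold structure on `N_n C`,
where `A_n C` has the structure of a product of manifolds. -/
def IsClosedEmbeddingInAmbient {C₀ C₁ C₂ : Type u} [SmoothManifold C₂]
    (C : TwoCategory C₀ C₁ C₂) (n : SimplexCategoryᵒᵖ) [SmoothManifold ((nerve C).obj n)] :
    Prop :=
  Manifold.IsSmoothEmbedding (model ((nerve C).obj n))
      (ModelWithCorners.pi (fun _ : (⦋2⦌ ⟶ n.unop) => model C₂)) ∞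
      (inclusionApp C n) ∧
    IsClosed (Set.range (inclusionApp C n))

end LieTwo

open Simplicial

/-!
The nerve is studied through the triangles of its simplices. A lax functor `[n] ⇢ C` amounts to
vertices, edges and triangles subject to a coherence equation for every tetrahedron (`IsLaxData`),
and so does a map `F_k Δ^{n+1} → NC`, where only the simplices of `F_k Δ^{n+1}` count. In both cases
the triangles determine everything, because the edges are sources of degenerate triangles.

Going from `F_{k+1} Δ^{n+1}` to `F_k Δ^{n+1}` adds the single edge `(k, n+1)` and the triangles
`(k, j, n+1)` with `k < j ≤ n`. One of them, `(k, k+1, n+1)`, may be prescribed arbitrarily subject to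
its target, and its source is the new edge. The others are then forced by coherence at
`(k, k+1, j, n+1)`, because `1 ∘ u_{j,k+1,k}` is invertible (`IsLaxData.fillTri`). All remaining
coherence equations follow from those of a 4-simplex four of whose faces are coherent
(`TwoCategory.IsInverse.coherent_of_coherent`, `IsLaxData.fill`). So the set `N^k_{n+1} C` is the
fibre product of `N^{k+1}_{n+1} C` and `C₂` over `C₁`. Similarly `N^n_{n+1} C` is the fibre product of
`N_n C` and `C₁` over `C₀`, and `N_{n+1} C = N^0_{n+1} C` because every triangle of `Δ^{n+1}` lies in
`F_0 Δ^{n+1}` and simplices are determined by triangles.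

Fibre products along submersions are embedded submanifolds (`exists_smoothManifold_fibreProduct`), so
these bijections construct the manifolds by induction. The formula for the forced triangles is built
from the smooth operations of `C`, hence all triangles are smooth functions on `N^k_{n+1} C`.
Conversely the pair of maps that define the fibre product is a smooth function of the triangles, and
it is a closed embedding; therefore the family of all triangles is a closed embedding as well. With
this the smoothness of all maps in question can be tested on triangles, and uniqueness of the
structures follows from the universal property of embeddings.

Embeddings are handled by local smooth retractions (`IsRetractEmbedding`), for which composition and
cancellation are immediate. That such maps are immersions is the inverse function theorem
(`IsRetractEmbedding.isSmoothEmbedding`).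
-/

namespace LieTwo

open Set Topology

/-! ### Finite products of manifolds -/

section Pi

variable {ι : Type*} [Fintype ι] {E H N : ι → Type*}
  [∀ i, NormedAddCommGroup (E i)] [∀ i, NormedSpace ℝ (E i)] [∀ i, TopologicalSpace (H i)]
  [∀ i, TopologicalSpace (N i)] [∀ i, ChartedSpace (H i) (N i)]
  {I : ∀ i, ModelWithCorners ℝ (E i) (H i)} {n : ℕ∞ω}

instance boundaryless_pi [∀ i, (I i).Boundaryless] : (ModelWithCorners.pi I).Boundaryless where
  range_eq_univ := by
    change range (fun (x : ∀ i, H i) i => I i (x i)) = univ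
    refine range_eq_univ.2 fun y => ?_
    choose x hx using fun i => (range_eq_univ.1 (I i).range_eq_univ) (y i)
    exact ⟨x, funext hx⟩

instance isManifold_pi [∀ i, IsManifold (I i) n (N i)] :
    IsManifold (ModelWithCorners.pi I) n (∀ i, N i) := by
  apply isManifold_of_contDiffOn
  rintro _ _ ⟨f, hf, rfl⟩ ⟨g, hg, rfl⟩
  rw [contDiffOn_pi]
  intro i
  have h := ((contDiffGroupoid n (I i)).compatible (hf i (mem_univ i)) (hg i (mem_univ i)))
  rw [contDiffGroupoid, mem_groupoid_of_pregroupoid] at h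
  refine h.1.comp (ContinuousLinearMap.proj (R := ℝ) (φ := E) i).contDiff.contDiffOn ?_
  rintro x ⟨hx, y, rfl⟩
  simp only [mem_preimage, ModelWithCorners.left_inv] at hx
  refine ⟨?_, y i, rfl⟩
  rw [mem_preimage]
  erw [(I i).left_inv (y i)]
  exact ⟨hx.1 i (mem_univ i), hx.2 i (mem_univ i)⟩

theorem contMDiff_pi_apply [∀ i, IsManifold (I i) n (N i)] (i : ι) :
    ContMDiff (ModelWithCorners.pi I) (I i) n (fun x : ∀ i, N i => x i) := by
  intro x
  rw [contMDiffAt_iff]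
  refine ⟨(continuous_apply i).continuousAt, ?_⟩
  have key : ∀ y ∈ (extChartAt (ModelWithCorners.pi I) x).target,
      (extChartAt (I i) (x i) ∘ (fun z : ∀ i, N i => z i) ∘
        (extChartAt (ModelWithCorners.pi I) x).symm) y =
      ContinuousLinearMap.proj (R := ℝ) (φ := E) i y := by
    intro y hy
    refine (extChartAt (I i) (x i)).right_inv ?_
    rw [extChartAt_target] at hy ⊢
    obtain ⟨hy, z, rfl⟩ := hy
    exact ⟨hy i (mem_univ i), z i, rfl⟩
  refine (ContinuousLinearMap.proj (R := ℝ) (φ := E) i).contDiff.contDiffWithinAt.congr_of_eventuallyEq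
    ?_ (key _ (mem_extChartAt_target x))
  filter_upwards [extChartAt_target_mem_nhdsWithin (I := ModelWithCorners.pi I) x] with y hy
    using key y hy

variable {E' H' M : Type*} [NormedAddCommGroup E'] [NormedSpace ℝ E'] [TopologicalSpace H']
  {I' : ModelWithCorners ℝ E' H'} [TopologicalSpace M] [ChartedSpace H' M]

theorem contMDiff_pi {f : M → ∀ i, N i} (hf : ∀ i, ContMDiff I' (I i) n (fun x => f x i)) :
    ContMDiff I' (ModelWithCorners.pi I) n f := by
  intro x
  rw [contMDiffAt_iff_target]
  refine ⟨continuousAt_pi.2 fun i => (hf i).continuous.continuousAt, ?_⟩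
  rw [contMDiffAt_pi_space]
  intro i
  exact (contMDiffAt_iff_target.1 (hf i x)).2

end Pi

/-! ### Straightening an immersion -/

section Straighten

variable {E E'' F : Type*} [NormedAddCommGroup E] [NormedSpace ℝ E] [FiniteDimensional ℝ E]
  [NormedAddCommGroup E''] [NormedSpace ℝ E''] [FiniteDimensional ℝ E'']
  [NormedAddCommGroup F] [NormedSpace ℝ F] [FiniteDimensional ℝ F]

/-- An injective linear map is the restriction of a linear isomorphism, if the complementary
dimensions fit. -/
theorem exists_equiv_extending (D : E →L[ℝ] E'') (hD : Function.Injective D)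
    (hF : Module.finrank ℝ E + Module.finrank ℝ F = Module.finrank ℝ E'') :
    ∃ L : (E × F) ≃L[ℝ] E'', ∀ x, L (x, 0) = D x := by
  obtain ⟨W, hW⟩ := Submodule.exists_isCompl (LinearMap.range (D : E →ₗ[ℝ] E''))
  have hr : Module.finrank ℝ (LinearMap.range (D : E →ₗ[ℝ] E'')) = Module.finrank ℝ E :=
    LinearMap.finrank_range_of_inj hD
  have hW' : Module.finrank ℝ F = Module.finrank ℝ W := by
    have := Submodule.finrank_add_eq_of_isCompl hW
    omega
  let w : F ≃ₗ[ℝ] W := LinearEquiv.ofFinrankEq F W hW'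
  let T : (E × F) →ₗ[ℝ] E'' := (D : E →ₗ[ℝ] E'').coprod (W.subtype ∘ₗ w.toLinearMap)
  have hT : Function.Injective T := by
    rw [← LinearMap.ker_eq_bot, LinearMap.ker_eq_bot']
    rintro ⟨x, y⟩ hxy
    have hxy' : D x + (w y : E'') = 0 := hxy
    have h0 : D x = 0 := by
      refine (Submodule.disjoint_def.1 hW.disjoint) _ ⟨x, rfl⟩ ?_
      rw [eq_neg_of_add_eq_zero_left hxy']
      exact W.neg_mem (w y).2
    rw [h0, zero_add] at hxy'
    have h1 : y = 0 := by simpa using hxy'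
    have h2 : x = 0 := hD (by simpa using h0)
    rw [h1, h2]; rfl
  refine ⟨(LinearEquiv.ofInjectiveOfFinrankEq T hT
    (by rw [Module.finrank_prod, hF])).toContinuousLinearEquiv, fun x => ?_⟩
  change T (x, 0) = D x
  simp [T]

/-- The local immersion theorem: a smooth map `g` with injective derivative at `a` becomes a linear
inclusion after a smooth change of coordinates `Θ` in the target. This is the inverse function
theorem for `(x, y) ↦ g x + L (0, y)`, where `L` extends the derivative of `g`. -/
theorem exists_straightening {g : E → E''} {U : Set E} (hU : IsOpen U) {a : E} (ha : a ∈ U)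
    (hg : ContDiffOn ℝ ∞ g U) (hD : Function.Injective (fderiv ℝ g a))
    (hF : Module.finrank ℝ E + Module.finrank ℝ F = Module.finrank ℝ E'') :
    ∃ (L : (E × F) ≃L[ℝ] E'') (Θ : OpenPartialHomeomorph E'' E''), g a ∈ Θ.source ∧
      ContDiffOn ℝ ∞ Θ Θ.source ∧ ContDiffOn ℝ ∞ Θ.symm Θ.target ∧
      ∀ᶠ x in 𝓝 a, Θ (g x) = L (x, 0) := by
  obtain ⟨L, hL⟩ := exists_equiv_extending (F := F) (fderiv ℝ g a) hD hF
  let G : E × F → E'' := fun p => g p.1 + L (0, p.2)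
  have hlin : ContDiff ℝ ∞ (fun p : E × F => L (0, p.2)) :=
    L.contDiff.comp (contDiff_const.prodMk contDiff_snd)
  have hV : IsOpen (U ×ˢ (univ : Set F)) := hU.prod isOpen_univ
  have hG : ContDiffOn ℝ ∞ G (U ×ˢ univ) :=
    (hg.comp contDiff_fst.contDiffOn fun p hp => hp.1).add hlin.contDiffOn
  have hGa : ContDiffAt ℝ ∞ G (a, 0) := hG.contDiffAt (hV.mem_nhds ⟨ha, mem_univ _⟩)
  have hGd : HasFDerivAt G (L : (E × F) →L[ℝ] E'') (a, 0) := by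
    have h1 : HasFDerivAt g (fderiv ℝ g a) (a, (0 : F)).1 :=
      ((hg.contDiffAt (hU.mem_nhds ha)).differentiableAt (by simp)).hasFDerivAt
    have h2 : HasFDerivAt (fun p : E × F => L (0, p.2))
        ((L : (E × F) →L[ℝ] E'').comp
          ((ContinuousLinearMap.inr ℝ E F).comp (ContinuousLinearMap.snd ℝ E F))) (a, 0) :=
      ((L : (E × F) →L[ℝ] E'').comp
          ((ContinuousLinearMap.inr ℝ E F).comp (ContinuousLinearMap.snd ℝ E F))).hasFDerivAt
    have hLD : (L : (E × F) →L[ℝ] E'') =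
        (fderiv ℝ g a).comp (ContinuousLinearMap.fst ℝ E F) +
          (L : (E × F) →L[ℝ] E'').comp
            ((ContinuousLinearMap.inr ℝ E F).comp (ContinuousLinearMap.snd ℝ E F)) := by
      ext x
      · simp [hL]
      · simp
    rw [hLD]
    exact (h1.comp (a, (0 : F)) hasFDerivAt_fst).add h2
  -- on `V` the derivative of `G` is invertible, so that the local inverse is smooth everywhere
  let V : Set (E × F) := (U ×ˢ univ) ∩
    fderiv ℝ G ⁻¹' range ((↑) : ((E × F) ≃L[ℝ] E'') → ((E × F) →L[ℝ] E''))
  have hVo : IsOpen V :=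
    (hG.continuousOn_fderiv_of_isOpen hV (by simp)).isOpen_inter_preimage hV
      ContinuousLinearEquiv.isOpen
  have haV : (a, (0 : F)) ∈ V := ⟨⟨ha, mem_univ _⟩, L, hGd.fderiv.symm⟩
  let e₀ := hGa.toOpenPartialHomeomorph G hGd (by simp)
  have he₀ : (e₀ : E × F → E'') = G := rfl
  let e := e₀.restrOpen V hVo
  have hes : e.source = e₀.source ∩ V := e₀.restrOpen_source V hVo
  have hae : (a, (0 : F)) ∈ e.source := by
    rw [hes]
    exact ⟨hGa.mem_toOpenPartialHomeomorph_source hGd (by simp), haV⟩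
  have he : (e : E × F → E'') = G := rfl
  have hGa0 : G (a, 0) = g a := by simp [G]
  refine ⟨L, e.symm.transHomeomorph L.toHomeomorph, ?_, ?_, ?_, ?_⟩
  · change g a ∈ e.target
    rw [← hGa0, ← he]
    exact e.map_source hae
  · refine L.contDiff.comp_contDiffOn fun y hy => ContDiffAt.contDiffWithinAt ?_
    have hy' : y ∈ e.target := hy
    have hm : e.symm y ∈ V := by
      have := e.map_target hy'
      rw [hes] at this
      exact this.2
    obtain ⟨L', hL'⟩ := hm.2
    have hc : ContDiffAt ℝ ∞ G (e.symm y) := hG.contDiffAt (hV.mem_nhds hm.1)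
    refine e.contDiffAt_symm hy' (f₀' := L') ?_ hc
    rw [hL']
    exact (hc.differentiableAt (by simp)).hasFDerivAt
  · have ht : ∀ z ∈ (e.symm.transHomeomorph L.toHomeomorph).target, L.symm z ∈ e.source :=
      fun z hz => hz
    refine ContDiffOn.comp (g := G) (t := U ×ˢ univ) hG L.symm.contDiff.contDiffOn ?_
    intro z hz
    have := ht z hz
    rw [hes] at this
    exact this.2.1
  · have hc : ContinuousAt (fun x : E => (x, (0 : F))) a := by fun_prop
    filter_upwards [hc.preimage_mem_nhds (e.open_source.mem_nhds hae)] with x hx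
    change L (e.symm (g x)) = L (x, 0)
    have : g x = e (x, 0) := by simp [he, G]
    rw [this, e.left_inv hx]

end Straighten

/-! ### Embeddings with local smooth retractions -/

section Retract

variable {E H M E' H' M' E'' H'' M'' F G N : Type*}
  [NormedAddCommGroup E] [NormedSpace ℝ E] [TopologicalSpace H] [TopologicalSpace M]
  [ChartedSpace H M] {I : ModelWithCorners ℝ E H}
  [NormedAddCommGroup E'] [NormedSpace ℝ E'] [TopologicalSpace H'] [TopologicalSpace M']
  [ChartedSpace H' M'] {I' : ModelWithCorners ℝ E' H'}
  [NormedAddCommGroup E''] [NormedSpace ℝ E''] [TopologicalSpace H''] [TopologicalSpace M'']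
  [ChartedSpace H'' M''] {I'' : ModelWithCorners ℝ E'' H''}
  [NormedAddCommGroup F] [NormedSpace ℝ F] [TopologicalSpace G] [TopologicalSpace N]
  [ChartedSpace G N] {J : ModelWithCorners ℝ F G}

/-- A smooth map `f : M → N` such that every point of the image of `f` has a neighbourhood on which
a smooth map to `M` is defined that inverts `f`. For maps of manifolds without boundary this is the
same as a smooth embedding, and stability under composition and cancellation is immediate. -/
structure IsRetractEmbedding (I : ModelWithCorners ℝ E H) (J : ModelWithCorners ℝ F G)
    (f : M → N) : Prop where
  contMDiff : ContMDiff I J ∞ f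
  exists_retraction (x : M) : ∃ U : Set N, IsOpen U ∧ f x ∈ U ∧ ∃ r : N → M,
    ContMDiffOn J I ∞ r U ∧ ∀ y, f y ∈ U → r (f y) = y

namespace IsRetractEmbedding

theorem of_leftInverse {f : M → N} {r : N → M} (hf : ContMDiff I J ∞ f) (hr : ContMDiff J I ∞ r)
    (h : Function.LeftInverse r f) : IsRetractEmbedding I J f :=
  ⟨hf, fun _ => ⟨univ, isOpen_univ, mem_univ _, r, hr.contMDiffOn, fun y _ => h y⟩⟩

protected theorem id : IsRetractEmbedding I I (id : M → M) :=
  of_leftInverse contMDiff_id contMDiff_id fun _ => rfl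

theorem comp {g : M' → M''} {f : M → M'} (hg : IsRetractEmbedding I' I'' g)
    (hf : IsRetractEmbedding I I' f) : IsRetractEmbedding I I'' (g ∘ f) := by
  refine ⟨hg.contMDiff.comp hf.contMDiff, fun x => ?_⟩
  obtain ⟨U, hU, hxU, r, hr, hrf⟩ := hf.exists_retraction x
  obtain ⟨V, hV, hxV, s, hs, hsg⟩ := hg.exists_retraction (f x)
  refine ⟨V ∩ s ⁻¹' U, hs.continuousOn.isOpen_inter_preimage hV hU, ⟨hxV, ?_⟩, r ∘ s,
    hr.comp (hs.mono inter_subset_left) inter_subset_right, fun y hy => ?_⟩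
  · rw [mem_preimage, Function.comp_apply, hsg _ hxV]
    exact hxU
  · have h := hsg _ hy.1
    have hy2 := hy.2
    simp only [mem_preimage, Function.comp_apply] at hy2 ⊢
    rw [h] at hy2 ⊢
    exact hrf _ hy2

/-- If `r` locally inverts `g ∘ f`, then `r ∘ g` locally inverts `f`. -/
theorem of_comp {g : M' → M''} {f : M → M'} (hg : ContMDiff I' I'' ∞ g) (hf : ContMDiff I I' ∞ f)
    (hgf : IsRetractEmbedding I I'' (g ∘ f)) : IsRetractEmbedding I I' f := by
  refine ⟨hf, fun x => ?_⟩
  obtain ⟨U, hU, hxU, r, hr, hrf⟩ := hgf.exists_retraction x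
  exact ⟨g ⁻¹' U, hU.preimage hg.continuous, hxU, r ∘ g,
    hr.comp hg.contMDiffOn fun _ h => h, fun y hy => hrf y hy⟩

theorem prodMap {f : M → N} {f' : M' → M''} (hf : IsRetractEmbedding I J f)
    (hf' : IsRetractEmbedding I' I'' f') :
    IsRetractEmbedding (I.prod I') (J.prod I'') (Prod.map f f') := by
  refine ⟨hf.contMDiff.prodMap hf'.contMDiff, fun x => ?_⟩
  obtain ⟨U, hU, hxU, r, hr, hrf⟩ := hf.exists_retraction x.1
  obtain ⟨V, hV, hxV, s, hs, hsf⟩ := hf'.exists_retraction x.2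
  exact ⟨U ×ˢ V, hU.prod hV, ⟨hxU, hxV⟩, Prod.map r s, hr.prodMap hs,
    fun y hy => Prod.ext (hrf _ hy.1) (hsf _ hy.2)⟩

/-- The universal property of an embedding, which allows to test smoothness in the target. -/
theorem contMDiff_of_comp {f : M' → M''} (hf : IsRetractEmbedding I' I'' f) {h : M → M'}
    (hfh : ContMDiff I I'' ∞ (f ∘ h)) : ContMDiff I I' ∞ h := by
  intro x
  obtain ⟨U, hU, hxU, r, hr, hrf⟩ := hf.exists_retraction (h x)
  refine ((hr.contMDiffAt (hU.mem_nhds hxU)).comp x (hfh x)).congr_of_eventuallyEq ?_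
  filter_upwards [hfh.continuous.continuousAt.preimage_mem_nhds (hU.mem_nhds hxU)] with y hy
  exact (hrf _ hy).symm

theorem isEmbedding {f : M → N} (hf : IsRetractEmbedding I J f) : IsEmbedding f := by
  have hi : Function.Injective f := fun x y hxy => by
    obtain ⟨U, -, hxU, r, -, hrf⟩ := hf.exists_retraction x
    rw [← hrf x hxU, hxy, hrf y (hxy ▸ hxU)]
  refine ⟨⟨le_antisymm hf.contMDiff.continuous.le_induced ?_⟩, hi⟩
  refine le_of_nhds_le_nhds fun x => ?_
  obtain ⟨U, hU, hxU, r, hr, hrf⟩ := hf.exists_retraction x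
  rw [nhds_induced]
  intro W hW
  have hc : ContinuousAt r (f x) := hr.continuousOn.continuousAt (hU.mem_nhds hxU)
  rw [← hrf x hxU] at hW
  refine ⟨U ∩ r ⁻¹' W, Filter.inter_mem (hU.mem_nhds hxU) (hc hW), fun y hy => ?_⟩
  have := hy.2
  rwa [mem_preimage, hrf y hy.1] at this

variable [FiniteDimensional ℝ E] [FiniteDimensional ℝ F] [I.Boundaryless] [J.Boundaryless]
  [IsManifold I ∞ M] [IsManifold J ∞ N]

omit [FiniteDimensional ℝ E] [FiniteDimensional ℝ F] in
/-- In charts, `f` has an injective derivative: the derivative of a local retraction is a left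
inverse. -/
theorem exists_local_expression {f : M → N} (hf : IsRetractEmbedding I J f) (x : M) :
    ∃ U ⊆ (extChartAt I x).target, IsOpen U ∧ extChartAt I x x ∈ U ∧
      ContDiffOn ℝ ∞ (extChartAt J (f x) ∘ f ∘ (extChartAt I x).symm) U ∧
      Function.Injective (fderiv ℝ (extChartAt J (f x) ∘ f ∘ (extChartAt I x).symm)
        (extChartAt I x x)) := by
  have hs : ContMDiffOn 𝓘(ℝ, E) J ∞ (f ∘ (extChartAt I x).symm) (extChartAt I x).target :=
    hf.contMDiff.comp_contMDiffOn (contMDiffOn_extChartAt_symm x)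
  have hT : IsOpen (extChartAt I x).target := isOpen_extChartAt_target x
  set a := extChartAt I x x with ha
  have hax : (extChartAt I x).symm a = x := extChartAt_to_inv x
  have haT : a ∈ (extChartAt I x).target := mem_extChartAt_target x
  obtain ⟨V, hV, hxV, r, hr, hrf⟩ := hf.exists_retraction x
  let U := (extChartAt I x).target ∩
    (f ∘ (extChartAt I x).symm) ⁻¹' ((extChartAt J (f x)).source ∩ V)
  have hU : IsOpen U := hs.continuousOn.isOpen_inter_preimage hT
    ((isOpen_extChartAt_source (f x)).inter hV)
  have haU : a ∈ U := by
    refine ⟨haT, ?_⟩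
    rw [mem_preimage, Function.comp_apply, hax]
    exact ⟨mem_extChartAt_source (f x), hxV⟩
  have hg : ContDiffOn ℝ ∞ (extChartAt J (f x) ∘ f ∘ (extChartAt I x).symm) U := by
    rw [← contMDiffOn_iff_contDiffOn]
    exact (contMDiffOn_extChartAt (x := f x)).comp (hs.mono inter_subset_left)
      fun y hy => by
        have := hy.2.1
        rwa [extChartAt_source] at this
  refine ⟨U, inter_subset_left, hU, haU, hg, ?_⟩
  set b := extChartAt J (f x) (f x) with hb
  have hbx : (extChartAt J (f x)).symm b = f x := extChartAt_to_inv (f x)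
  have hr' : ContDiffAt ℝ ∞ (extChartAt I x ∘ r ∘ (extChartAt J (f x)).symm) b := by
    rw [← contMDiffAt_iff_contDiffAt]
    have h1 : ContMDiffAt 𝓘(ℝ, F) J ∞ (extChartAt J (f x)).symm b :=
      (contMDiffOn_extChartAt_symm (f x)).contMDiffAt
        ((isOpen_extChartAt_target (f x)).mem_nhds (mem_extChartAt_target (f x)))
    have h2 : ContMDiffAt J I ∞ r ((extChartAt J (f x)).symm b) := by
      rw [hbx]
      exact hr.contMDiffAt (hV.mem_nhds hxV)
    refine ContMDiffAt.comp b ?_ (h2.comp b h1)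
    simp only [Function.comp_apply]
    rw [hbx, hrf x hxV]
    exact contMDiffAt_extChartAt
  have hga : (extChartAt J (f x) ∘ f ∘ (extChartAt I x).symm) a = b := by
    simp only [Function.comp_apply]
    rw [hax]
  have hcomp : HasFDerivAt ((extChartAt I x ∘ r ∘ (extChartAt J (f x)).symm) ∘
      (extChartAt J (f x) ∘ f ∘ (extChartAt I x).symm))
      ((fderiv ℝ (extChartAt I x ∘ r ∘ (extChartAt J (f x)).symm) b).comp
        (fderiv ℝ (extChartAt J (f x) ∘ f ∘ (extChartAt I x).symm) a)) a := by
    refine HasFDerivAt.comp a ?_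
      ((hg.contDiffAt (hU.mem_nhds haU)).differentiableAt (by simp)).hasFDerivAt
    rw [hga]
    exact (hr'.differentiableAt (by simp)).hasFDerivAt
  have hid : HasFDerivAt ((extChartAt I x ∘ r ∘ (extChartAt J (f x)).symm) ∘
      (extChartAt J (f x) ∘ f ∘ (extChartAt I x).symm)) (ContinuousLinearMap.id ℝ E) a := by
    refine (hasFDerivAt_id a).congr_of_eventuallyEq ?_
    filter_upwards [hU.mem_nhds haU] with y hy
    simp only [Function.comp_apply, id]
    have h1 := hy.2.1
    have h2 := hy.2.2
    simp only [Function.comp_apply] at h1 h2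
    rw [(extChartAt J (f x)).left_inv h1, hrf _ h2, (extChartAt I x).right_inv hy.1]
  intro v w hvw
  have h := hcomp.unique hid
  have := congrArg (fderiv ℝ (extChartAt I x ∘ r ∘ (extChartAt J (f x)).symm) b) hvw
  rw [← ContinuousLinearMap.comp_apply, ← ContinuousLinearMap.comp_apply, h] at this
  exact this

/-- The inverse function theorem, applied in charts, produces charts in which `f` is a linear
inclusion. -/
theorem isImmersionAtOfComplement {f : M → N} (hf : IsRetractEmbedding I J f)
    {K : Type*} [NormedAddCommGroup K] [NormedSpace ℝ K] [FiniteDimensional ℝ K]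
    (hK : Module.finrank ℝ E + Module.finrank ℝ K = Module.finrank ℝ F) (x : M) :
    Manifold.IsImmersionAtOfComplement K I J ∞ f x := by
  obtain ⟨U, hUT, hU, haU, hg, hD⟩ := hf.exists_local_expression x
  obtain ⟨L, Θ, hΘ, hΘ1, hΘ2, hev⟩ := exists_straightening hU haU hg hD hK
  set a := extChartAt I x x with ha
  have hax : (extChartAt I x).symm a = x := extChartAt_to_inv x
  simp only [Function.comp_apply, hax] at hΘ
  obtain ⟨O, hO, hOo, haO⟩ := mem_nhds_iff.1 hev
  let s : Set M := (extChartAt I x).source ∩ extChartAt I x ⁻¹' O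
  have hs : IsOpen s := (continuousOn_extChartAt x).isOpen_inter_preimage
    (isOpen_extChartAt_source x) hOo
  let j : OpenPartialHomeomorph G F := J.toHomeomorph.toOpenPartialHomeomorph
  let c : OpenPartialHomeomorph N G := (chartAt G (f x)).trans (j.trans (Θ.trans j.symm))
  have hcs : ∀ y ∈ c.source, y ∈ (extChartAt J (f x)).source ∧
      extChartAt J (f x) y ∈ Θ.source := by
    intro y hy
    rw [extChartAt_source]
    exact ⟨hy.1, hy.2.2.1⟩
  have hct : ∀ y ∈ c.target, J y ∈ Θ.target ∧ Θ.symm (J y) ∈ (extChartAt J (f x)).target := by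
    intro y hy
    obtain ⟨⟨⟨-, h1⟩, h2⟩, h3⟩ := hy
    refine ⟨h1, ?_⟩
    rw [extChartAt_target]
    exact ⟨h3, by rw [J.range_eq_univ]; exact mem_univ _⟩
  have hc : c ∈ IsManifold.maximalAtlas J ∞ N := by
    apply OpenPartialHomeomorph.mem_maximalAtlas_of_contMDiffOn
    · have h1 : ContMDiffOn J 𝓘(ℝ, F) ∞ (Θ ∘ extChartAt J (f x)) c.source :=
        hΘ1.contMDiffOn.comp ((contMDiffOn_extChartAt (x := f x)).mono fun y hy => hy.1)
          fun y hy => (hcs y hy).2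
      exact (J.contMDiffOn_symm (n := ∞)).comp h1 fun y hy => by
        rw [J.range_eq_univ]; exact mem_univ _
    · have h1 : ContMDiffOn J 𝓘(ℝ, F) ∞ (Θ.symm ∘ J) c.target :=
        hΘ2.contMDiffOn.comp J.contMDiff.contMDiffOn fun y hy => (hct y hy).1
      exact (contMDiffOn_extChartAt_symm (f x)).comp h1 fun y hy => (hct y hy).2
  refine Manifold.IsImmersionAtOfComplement.mk_of_continuousAt
    hf.contMDiff.continuous.continuousAt L ((chartAt H x).restr s) c ?_ ?_
    (restr_mem_maximalAtlas _ (IsManifold.chart_mem_maximalAtlas x) hs) hc ?_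
  · rw [OpenPartialHomeomorph.restr_source, hs.interior_eq]
    exact ⟨mem_chart_source H x, mem_extChartAt_source x, haO⟩
  · exact ⟨mem_chart_source G (f x), mem_univ _, hΘ, mem_univ _⟩
  · intro y hy
    have hy' : y ∈ (extChartAt I x).target ∧ (extChartAt I x).symm y ∈ s := by
      rw [OpenPartialHomeomorph.extend_target, OpenPartialHomeomorph.restr_target,
        hs.interior_eq] at hy
      rw [extChartAt_target]
      exact ⟨⟨hy.1.1, hy.2⟩, hy.1.2⟩
    have hyO : y ∈ O := by
      have := hy'.2.2
      rwa [mem_preimage, (extChartAt I x).right_inv hy'.1] at this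
    have h := hO hyO
    simp only [mem_ofPred_eq, Function.comp_apply] at h ⊢
    rw [← h]
    exact J.right_inv (by rw [J.range_eq_univ]; exact mem_univ _)

/-- The complement in the definition of an immersion has to be a single space for all points, so it
is chosen as the standard space of the right dimension. -/
theorem isSmoothEmbedding {f : M → N} (hf : IsRetractEmbedding I J f) :
    Manifold.IsSmoothEmbedding I J ∞ f := by
  refine ⟨?_, hf.isEmbedding⟩
  rcases isEmpty_or_nonempty M with hM | ⟨⟨x⟩⟩
  · exact ⟨F, inferInstance, inferInstance, fun x => (hM.false x).elim⟩
  -- `finrank E ≤ finrank F`, so the subtraction of dimensions below does not truncate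
  obtain ⟨U, -, -, -, -, hD⟩ := hf.exists_local_expression x
  have hle := LinearMap.finrank_le_finrank_of_injective
    (f := (fderiv ℝ (extChartAt J (f x) ∘ f ∘ (extChartAt I x).symm)
        (extChartAt I x x) : E →ₗ[ℝ] F)) hD
  have h : Manifold.IsImmersionOfComplement
      (EuclideanSpace ℝ (Fin (Module.finrank ℝ F - Module.finrank ℝ E))) I J ∞ f :=
    fun x => hf.isImmersionAtOfComplement (by
      rw [finrank_euclideanSpace_fin]; omega) x
  exact h.isImmersion

end IsRetractEmbedding
end Retract

/-! ### Embedded submanifolds from local parametrizations -/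

section Submanifold

variable {P : Type u} {F G N : Type*} [NormedAddCommGroup F] [NormedSpace ℝ F]
  [TopologicalSpace G] [TopologicalSpace N] [ChartedSpace G N]

/-- A chart of `P` that is compatible with the map `j : P → N`: its inverse, followed by `j`, is
smooth, and the chart is the restriction along `j` of a smooth map on an open subset of `N`. -/
def IsSliceChart [TopologicalSpace P] (J : ModelWithCorners ℝ F G) (j : P → N) {d : ℕ}
    (e : OpenPartialHomeomorph P (EuclideanSpace ℝ (Fin d))) : Prop :=
  ContMDiffOn (𝓡 d) J ∞ (j ∘ e.symm) e.target ∧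
    ∃ U : Set N, IsOpen U ∧ ∃ R : N → EuclideanSpace ℝ (Fin d), ContMDiffOn J (𝓡 d) ∞ R U ∧
      e.source = j ⁻¹' U ∧ ∀ q, j q ∈ U → R (j q) = e q

/-- The image of `j` is parametrized by an open subset of `ℝ^d` near `j p`, and the inverse of the
parametrization extends smoothly to a neighbourhood in the ambient manifold. -/
def HasSliceAt (J : ModelWithCorners ℝ F G) (j : P → N) (d : ℕ) (p : P) : Prop :=
  ∃ (U : Set N) (R : N → EuclideanSpace ℝ (Fin d)) (W : Set (EuclideanSpace ℝ (Fin d)))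
    (s : EuclideanSpace ℝ (Fin d) → N), IsOpen U ∧ j p ∈ U ∧ ContMDiffOn J (𝓡 d) ∞ R U ∧
      IsOpen W ∧ ContMDiffOn (𝓡 d) J ∞ s W ∧
      (∀ w ∈ W, s w ∈ U ∧ s w ∈ range j ∧ R (s w) = w) ∧
      ∀ q, j q ∈ U → R (j q) ∈ W ∧ s (R (j q)) = j q

theorem HasSliceAt.exists_isSliceChart [TopologicalSpace P] {J : ModelWithCorners ℝ F G} {j : P → N}
    {d : ℕ} {p : P} (hj : IsEmbedding j) (h : HasSliceAt J j d p) :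
    ∃ e : OpenPartialHomeomorph P (EuclideanSpace ℝ (Fin d)), p ∈ e.source ∧ IsSliceChart J j e := by
  obtain ⟨U, R, W, s, hU, hpU, hR, hW, hs, h1, h2⟩ := h
  have : Nonempty P := ⟨p⟩
  have hinv : ∀ w ∈ W, j (Function.invFun j (s w)) = s w := fun w hw =>
    Function.invFun_eq (h1 w hw).2.1
  let e : OpenPartialHomeomorph P (EuclideanSpace ℝ (Fin d)) :=
    { toFun := fun q => R (j q)
      invFun := fun w => Function.invFun j (s w)
      source := j ⁻¹' U
      target := W
      map_source' := fun q hq => (h2 q hq).1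
      map_target' := fun w hw => by
        rw [mem_preimage, hinv w hw]
        exact (h1 w hw).1
      left_inv' := fun q hq => by
        rw [(h2 q hq).2]
        exact Function.leftInverse_invFun hj.injective q
      right_inv' := fun w hw => by
        rw [hinv w hw, (h1 w hw).2.2]
      open_source := hU.preimage hj.continuous
      open_target := hW
      continuousOn_toFun := hR.continuousOn.comp hj.continuous.continuousOn fun _ h => h
      continuousOn_invFun := by
        rw [hj.isInducing.continuousOn_iff]
        exact hs.continuousOn.congr hinv }
  exact ⟨e, hpU, hs.congr hinv, U, hU, R, hR, rfl, fun q hq => rfl⟩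

/-- A subset of a manifold that has slices of a fixed dimension is an embedded submanifold. The atlas
consists of all charts that are compatible with the inclusion. -/
theorem exists_smoothManifold_of_hasSliceAt {J : ModelWithCorners ℝ F G} [T2Space N]
    [SecondCountableTopology N] {j : P → N} (hj : Function.Injective j) {d : ℕ}
    (h : ∀ p, HasSliceAt J j d p) :
    ∃ _ : SmoothManifold P, IsRetractEmbedding (model P) J j := by
  let t : TopologicalSpace P := TopologicalSpace.induced j inferInstance
  have hje : IsEmbedding j := ⟨⟨rfl⟩, hj⟩
  choose c hpc hc using fun p => (h p).exists_isSliceChart hje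
  let cs : ChartedSpace (EuclideanSpace ℝ (Fin d)) P :=
    { atlas := {e | IsSliceChart J j e}
      chartAt := c
      mem_chart_source := hpc
      chart_mem_atlas := hc }
  have hm : IsManifold (𝓡 d) ∞ P := by
    refine isManifold_of_contDiffOn _ _ _ fun e e' he he' => ?_
    obtain ⟨U, hU, R, hR, hs, hRe⟩ := he'.2
    rw [← contMDiffOn_iff_contDiffOn]
    have h1 : ContMDiffOn (𝓡 d) (𝓡 d) ∞ (R ∘ j ∘ e.symm) (e.symm ≫ₕ e').source :=
      hR.comp (he.1.mono fun w hw => hw.1) fun w hw => by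
        have := hw.2
        rw [mem_preimage, hs] at this
        exact this
    simp only [mfld_simps] at h1 ⊢
    refine h1.congr fun w hw => ?_
    have := hw.2
    rw [mem_preimage, hs] at this
    exact (hRe _ this).symm
  let S : SmoothManifold P :=
    { t with
      dim := d
      chartedSpace := cs
      isManifold := hm
      t2Space := hje.t2Space
      secondCountable := hje.secondCountableTopology }
  refine ⟨S, ?_, fun p => ?_⟩
  · intro p
    change ContMDiffAt (𝓡 d) J ∞ j p
    have h1 : ContMDiffAt (𝓡 d) (𝓡 d) ∞ (c p) p :=
      (contMDiffOn_chart (x := p)).contMDiffAt ((c p).open_source.mem_nhds (hpc p))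
    have h2 : ContMDiffAt (𝓡 d) J ∞ (j ∘ (c p).symm) (c p p) :=
      (hc p).1.contMDiffAt ((c p).open_target.mem_nhds ((c p).map_source (hpc p)))
    refine (h2.comp p h1).congr_of_eventuallyEq ?_
    filter_upwards [(c p).open_source.mem_nhds (hpc p)] with q hq
    simp only [Function.comp_apply]
    rw [(c p).left_inv hq]
  · obtain ⟨U, hU, R, hR, hs, hRe⟩ := (hc p).2
    have hpU : j p ∈ U := by
      have := hpc p
      rwa [hs] at this
    have hRp : R (j p) ∈ (c p).target := by
      rw [hRe p hpU]
      exact (c p).map_source (hpc p)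
    refine ⟨U ∩ R ⁻¹' (c p).target, hR.continuousOn.isOpen_inter_preimage hU (c p).open_target,
      ⟨hpU, hRp⟩, (c p).symm ∘ R, ?_, fun q hq => ?_⟩
    · exact (contMDiffOn_chart_symm (x := p) : ContMDiffOn (𝓡 d) (𝓡 d) ∞ (c p).symm (c p).target).comp
        (hR.mono inter_subset_left) fun z hz => hz.2
    · rw [Function.comp_apply, hRe q hq.1]
      refine (c p).left_inv ?_
      rw [hs]
      exact hq.1

end Submanifold

/-! ### Fibre products along submersions -/

section FibreProduct

variable {P X Y Z : Type u} [SmoothManifold X] [SmoothManifold Y] [SmoothManifold Z]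

/-- A set `P` that is the fibre product of the sets `X` and `Y` over `Z` is an embedded submanifold of
`X × Y`, if one of the two maps to `Z` is a submersion. -/
theorem exists_smoothManifold_fibreProduct {p : P → X} {q : P → Y} {f : X → Z} {g : Y → Z}
    (hf : Smooth f) (hg : Manifold.IsSubmersion (model Y) (model Z) ∞ g)
    (hpq : Function.Injective fun w => (p w, q w))
    (hr : range (fun w => (p w, q w)) = {z | f z.1 = g z.2}) :
    ∃ _ : SmoothManifold P,
      IsRetractEmbedding (model P) ((model X).prod (model Y)) fun w => (p w, q w) := by
  obtain ⟨F, _, _, hF⟩ := hg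
  -- the dimension of `P` is read off from a submersion chart of `g`, which requires a point
  rcases isEmpty_or_nonempty P with hP | ⟨⟨p₀⟩⟩
  · exact exists_smoothManifold_of_hasSliceAt (d := 0) hpq fun w => (hP.false w).elim
  have : FiniteDimensional ℝ F :=
    Module.Finite.of_surjective
      ((LinearMap.snd ℝ _ F).comp (hF (q p₀)).equiv.toLinearEquiv.toLinearMap)
      (Prod.snd_surjective.comp (hF (q p₀)).equiv.surjective)
  have K : EuclideanSpace ℝ (Fin (SmoothManifold.dim X + Module.finrank ℝ F)) ≃L[ℝ]
      EuclideanSpace ℝ (Fin (SmoothManifold.dim X)) × F :=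
    ContinuousLinearEquiv.ofFinrankEq (by
      rw [Module.finrank_prod, finrank_euclideanSpace_fin, finrank_euclideanSpace_fin])
  refine exists_smoothManifold_of_hasSliceAt
    (d := SmoothManifold.dim X + Module.finrank ℝ F) hpq fun w₀ => ?_
  have hfg : ∀ w, f (p w) = g (q w) := fun w => by
    have : (p w, q w) ∈ range (fun w => (p w, q w)) := mem_range_self w
    rwa [hr] at this
  have h := hF (q w₀)
  let φ := h.domChart
  let ψ := h.codChart
  let L := h.equiv
  let χ := chartAt (EuclideanSpace ℝ (Fin (SmoothManifold.dim X))) (p w₀)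
  have hφs := contMDiffOn_symm_of_mem_maximalAtlas h.domChart_mem_maximalAtlas
  have hφ := contMDiffOn_of_mem_maximalAtlas h.domChart_mem_maximalAtlas
  have hψ := contMDiffOn_of_mem_maximalAtlas h.codChart_mem_maximalAtlas
  have hχ : ContMDiffOn (model X) (model X) ∞ χ χ.source := contMDiffOn_chart
  have hχs : ContMDiffOn (model X) (model X) ∞ χ.symm χ.target := contMDiffOn_chart_symm
  have hg1 : ∀ y ∈ φ.source, g y ∈ ψ.source := fun y hy => h.source_subset_preimage_source hy
  have hg2 : ∀ z ∈ φ.target, ψ (g (φ.symm z)) = (L z).1 := fun z hz => by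
    have hz' : z ∈ (h.domChart.extend (model Y)).target := by
      simpa only [mfld_simps] using hz
    have := h.writtenInCharts hz'
    simpa only [mfld_simps] using this
  have hfo : IsOpen (f ⁻¹' ψ.source) := ψ.open_source.preimage hf.continuous
  -- the slice is parametrized by `(a, v) ↦ (x, y)`, where `x` has the coordinate `a` and `y` has
  -- the coordinates `(f x, v)`
  let x : EuclideanSpace ℝ (Fin (SmoothManifold.dim X + Module.finrank ℝ F)) → X :=
    fun w => χ.symm (K w).1
  let z : EuclideanSpace ℝ (Fin (SmoothManifold.dim X + Module.finrank ℝ F)) →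
      EuclideanSpace ℝ (Fin (SmoothManifold.dim Y)) := fun w => L.symm (ψ (f (x w)), (K w).2)
  let W₀ := {w | (K w).1 ∈ χ.target}
  let W₁ := W₀ ∩ x ⁻¹' (f ⁻¹' ψ.source)
  have hW₀ : IsOpen W₀ := χ.open_target.preimage (continuous_fst.comp K.continuous)
  have hK1 : ContMDiff (𝓡 (SmoothManifold.dim X + Module.finrank ℝ F)) (model X) ∞
      fun w => (K w).1 := (contDiff_fst.comp K.contDiff).contMDiff
  have hx : ContMDiffOn (𝓡 (SmoothManifold.dim X + Module.finrank ℝ F)) (model X) ∞ x W₀ :=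
    hχs.comp hK1.contMDiffOn fun w hw => hw
  have hW₁ : IsOpen W₁ := hx.continuousOn.isOpen_inter_preimage hW₀ hfo
  have hz : ContMDiffOn (𝓡 (SmoothManifold.dim X + Module.finrank ℝ F)) (model Y) ∞ z W₁ := by
    have h1 : ContMDiffOn (𝓡 (SmoothManifold.dim X + Module.finrank ℝ F)) (model Z) ∞
        (ψ ∘ f ∘ x) W₁ :=
      hψ.comp (hf.comp_contMDiffOn (hx.mono inter_subset_left)) fun w hw => hw.2
    rw [contMDiffOn_iff_contDiffOn] at h1 ⊢
    exact L.symm.contDiff.comp_contDiffOn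
      (h1.prodMk (contDiff_snd.comp K.contDiff).contDiffOn)
  let W := W₁ ∩ z ⁻¹' φ.target
  have hW : IsOpen W := hz.continuousOn.isOpen_inter_preimage hW₁ φ.open_target
  have hs : ContMDiffOn (𝓡 (SmoothManifold.dim X + Module.finrank ℝ F))
      ((model X).prod (model Y)) ∞ (fun w => (x w, φ.symm (z w))) W :=
    (hx.mono fun w hw => hw.1.1).prodMk
      (hφs.comp (hz.mono inter_subset_left) fun w hw => hw.2)
  refine ⟨(χ.source ∩ f ⁻¹' ψ.source) ×ˢ φ.source, fun m => K.symm (χ m.1, (L (φ m.2)).2), W,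
    fun w => (x w, φ.symm (z w)), (χ.open_source.inter hfo).prod φ.open_source,
    ⟨⟨mem_chart_source _ _, ?_⟩, h.mem_domChart_source⟩, ?_, hW, hs, ?_, ?_⟩
  · rw [mem_preimage, hfg]
    exact h.mem_codChart_source
  · have h1 : ContMDiffOn ((model X).prod (model Y)) (model X) ∞ (fun m : X × Y => χ m.1)
        ((χ.source ∩ f ⁻¹' ψ.source) ×ˢ φ.source) :=
      hχ.comp contMDiff_fst.contMDiffOn fun m hm => hm.1.1
    have h2 : ContMDiffOn ((model X).prod (model Y)) (model Y) ∞ (fun m : X × Y => φ m.2)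
        ((χ.source ∩ f ⁻¹' ψ.source) ×ˢ φ.source) :=
      hφ.comp contMDiff_snd.contMDiffOn fun m hm => hm.2
    have h3 : ContMDiffOn ((model X).prod (model Y)) 𝓘(ℝ, F) ∞ (fun m : X × Y => (L (φ m.2)).2)
        ((χ.source ∩ f ⁻¹' ψ.source) ×ˢ φ.source) :=
      (contDiff_snd.comp L.contDiff).contMDiff.comp_contMDiffOn h2
    exact K.symm.contDiff.contMDiff.comp_contMDiffOn (h1.prodMk_space h3)
  · rintro w ⟨⟨hw1, hw2⟩, hw3⟩
    have hy : φ.symm (z w) ∈ φ.source := φ.map_target hw3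
    have hLz : L (z w) = (ψ (f (x w)), (K w).2) := L.apply_symm_apply _
    refine ⟨⟨⟨χ.map_target hw1, hw2⟩, hy⟩, ?_, ?_⟩
    · rw [hr]
      refine ψ.injOn hw2 (hg1 _ hy) ?_
      change ψ (f (x w)) = ψ (g (φ.symm (z w)))
      rw [hg2 _ hw3, hLz]
    · change K.symm (χ (χ.symm (K w).1), (L (φ (φ.symm (z w)))).2) = w
      rw [χ.right_inv hw1, φ.right_inv hw3, hLz]
      exact K.symm_apply_apply w
  · rintro w ⟨⟨hw1, hw2⟩, hw3⟩
    have hxw : x (K.symm (χ (p w), (L (φ (q w))).2)) = p w := by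
      change χ.symm (K (K.symm _)).1 = _
      rw [K.apply_symm_apply]
      exact χ.left_inv hw1
    have hzw : z (K.symm (χ (p w), (L (φ (q w))).2)) = φ (q w) := by
      change L.symm (ψ (f (x _)), (K (K.symm _)).2) = _
      rw [hxw, K.apply_symm_apply, hfg w, L.symm_apply_eq]
      refine Prod.ext ?_ rfl
      have := hg2 _ (φ.map_source hw3)
      rwa [φ.left_inv hw3] at this
    refine ⟨⟨⟨?_, ?_⟩, ?_⟩, ?_⟩
    · change (K (K.symm _)).1 ∈ χ.target
      rw [K.apply_symm_apply]
      exact χ.map_source hw1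
    · rw [mem_preimage, hxw]
      exact hw2
    · rw [mem_preimage, hzw]
      exact φ.map_source hw3
    · refine Prod.ext hxw ?_
      simp only
      rw [hzw]
      exact φ.left_inv hw3

end FibreProduct

/-! ### Calculus of 2-cells -/

namespace TwoCategory

variable {C₀ : Type u} {C₁ : Type v} {C₂ : Type w} (C : TwoCategory C₀ C₁ C₂)

open Classical in
/-- The composition `g ∘ f` of arrows, with the junk value `g` if it is not defined. -/
noncomputable def cc (g f : C₁) : C₁ :=
  if h : C.src g = C.tgt f then C.comp g f h else g

open Classical in
/-- The vertical composition `β • α`, with the junk value `β` if it is not defined. -/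
noncomputable def vc (β α : C₂) : C₂ :=
  if h : C.src₂ β = C.tgt₂ α then C.vcomp β α h else β

open Classical in
/-- The horizontal composition `β ∘ α`, with the junk value `β` if it is not defined. -/
noncomputable def hc (β α : C₂) : C₂ :=
  if h : C.src (C.src₂ β) = C.tgt (C.src₂ α) then C.hcomp β α h else β

theorem comp_eq_cc (g f : C₁) (h) : C.comp g f h = C.cc g f := by rw [cc, dif_pos h]

theorem vcomp_eq_vc (β α : C₂) (h) : C.vcomp β α h = C.vc β α := by rw [vc, dif_pos h]

theorem hcomp_eq_hc (β α : C₂) (h) : C.hcomp β α h = C.hc β α := by rw [hc, dif_pos h]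

/-- `f` is an arrow `x → y`. -/
structure Arrow (f : C₁) (x y : C₀) : Prop where
  src : C.src f = x
  tgt : C.tgt f = y

/-- `α` is a 2-cell `f ⇒ g`. -/
structure Cell (α : C₂) (f g : C₁) : Prop where
  src₂ : C.src₂ α = f
  tgt₂ : C.tgt₂ α = g

variable {C}

theorem Arrow.one (x : C₀) : C.Arrow (C.one x) x x := ⟨C.src_one x, C.tgt_one x⟩

theorem Arrow.cc {g f : C₁} {x y z : C₀} (hg : C.Arrow g y z) (hf : C.Arrow f x y) :
    C.Arrow (C.cc g f) x z := by
  have h : C.src g = C.tgt f := hg.src.trans hf.tgt.symm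
  rw [← comp_eq_cc _ _ _ h]
  exact ⟨(C.src_comp _ _ _).trans hf.src, (C.tgt_comp _ _ _).trans hg.tgt⟩

theorem one_cc {f : C₁} {x y : C₀} (hf : C.Arrow f x y) : C.cc (C.one y) f = f := by
  obtain ⟨rfl, rfl⟩ := hf
  rw [← comp_eq_cc _ _ _ (C.src_one _), C.one_comp]

theorem cc_one {f : C₁} {x y : C₀} (hf : C.Arrow f x y) : C.cc f (C.one x) = f := by
  obtain ⟨rfl, rfl⟩ := hf
  rw [← comp_eq_cc _ _ _ (C.tgt_one _).symm, C.comp_one]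

theorem cc_assoc {k g f : C₁} {x y z w : C₀} (hk : C.Arrow k z w) (hg : C.Arrow g y z)
    (hf : C.Arrow f x y) : C.cc k (C.cc g f) = C.cc (C.cc k g) f := by
  have h1 := hk.src.trans hg.tgt.symm
  have h2 := hg.src.trans hf.tgt.symm
  have h3 := hk.src.trans (hg.cc hf).tgt.symm
  have h4 := (hk.cc hg).src.trans hf.tgt.symm
  simp only [← comp_eq_cc _ _ _ h1, ← comp_eq_cc _ _ _ h2] at h3 h4 ⊢
  rw [← comp_eq_cc _ _ _ h3, ← comp_eq_cc _ _ _ h4]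
  exact C.comp_assoc _ _ _ _ _ _ _

theorem Cell.one (f : C₁) : C.Cell (C.one₂ f) f f := ⟨C.src₂_one₂ f, C.tgt₂_one₂ f⟩

theorem Cell.of_arrow_left {α : C₂} {f g : C₁} {x y : C₀} (h : C.Cell α f g) (hf : C.Arrow f x y) :
    C.Arrow g x y := by
  obtain ⟨rfl, rfl⟩ := h
  exact ⟨(C.src_src₂ α).symm.trans hf.src, (C.tgt_src₂ α).symm.trans hf.tgt⟩

theorem Cell.of_arrow_right {α : C₂} {f g : C₁} {x y : C₀} (h : C.Cell α f g)
    (hg : C.Arrow g x y) : C.Arrow f x y := by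
  obtain ⟨rfl, rfl⟩ := h
  exact ⟨(C.src_src₂ α).trans hg.src, (C.tgt_src₂ α).trans hg.tgt⟩

theorem Cell.vc {β α : C₂} {f g h : C₁} (hβ : C.Cell β g h) (hα : C.Cell α f g) :
    C.Cell (C.vc β α) f h := by
  have e := hβ.src₂.trans hα.tgt₂.symm
  rw [← vcomp_eq_vc _ _ _ e]
  exact ⟨(C.src₂_vcomp _ _ _).trans hα.src₂, (C.tgt₂_vcomp _ _ _).trans hβ.tgt₂⟩

theorem Cell.hc {β α : C₂} {g g' f f' : C₁} {x y z : C₀} (hβ : C.Cell β g g')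
    (hα : C.Cell α f f') (hg : C.Arrow g y z) (hf : C.Arrow f x y) :
    C.Cell (C.hc β α) (C.cc g f) (C.cc g' f') := by
  have hg' := hβ.of_arrow_left hg
  have hf' := hα.of_arrow_left hf
  obtain ⟨rfl, rfl⟩ := hβ
  obtain ⟨rfl, rfl⟩ := hα
  have e := hg.src.trans hf.tgt.symm
  have e' := hg'.src.trans hf'.tgt.symm
  rw [← hcomp_eq_hc _ _ _ e, ← comp_eq_cc _ _ _ e, ← comp_eq_cc _ _ _ e']
  exact ⟨C.src₂_hcomp _ _ _, C.tgt₂_hcomp _ _ _ _⟩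

theorem one_vc {α : C₂} {f g : C₁} (h : C.Cell α f g) : C.vc (C.one₂ g) α = α := by
  obtain ⟨rfl, rfl⟩ := h
  rw [← vcomp_eq_vc _ _ _ (C.src₂_one₂ _), C.one₂_vcomp]

theorem vc_one {α : C₂} {f g : C₁} (h : C.Cell α f g) : C.vc α (C.one₂ f) = α := by
  obtain ⟨rfl, rfl⟩ := h
  rw [← vcomp_eq_vc _ _ _ (C.tgt₂_one₂ _).symm, C.vcomp_one₂]

theorem vc_assoc {γ β α : C₂} {f g h k : C₁} (hγ : C.Cell γ h k) (hβ : C.Cell β g h)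
    (hα : C.Cell α f g) : C.vc γ (C.vc β α) = C.vc (C.vc γ β) α := by
  have h1 := hγ.src₂.trans hβ.tgt₂.symm
  have h2 := hβ.src₂.trans hα.tgt₂.symm
  have h3 := hγ.src₂.trans (hβ.vc hα).tgt₂.symm
  have h4 := (hγ.vc hβ).src₂.trans hα.tgt₂.symm
  simp only [← vcomp_eq_vc _ _ _ h1, ← vcomp_eq_vc _ _ _ h2] at h3 h4 ⊢
  rw [← vcomp_eq_vc _ _ _ h3, ← vcomp_eq_vc _ _ _ h4]
  exact C.vcomp_assoc _ _ _ _ _ _ _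

theorem one_hc {α : C₂} {f g : C₁} {x y : C₀} (h : C.Cell α f g) (hf : C.Arrow f x y) :
    C.hc (C.one₂ (C.one y)) α = α := by
  obtain ⟨rfl, rfl⟩ := h
  obtain ⟨rfl, rfl⟩ := hf
  rw [← hcomp_eq_hc _ _ _ (by rw [C.src₂_one₂, C.src_one]), C.one_hcomp]

theorem hc_one {α : C₂} {f g : C₁} {x y : C₀} (h : C.Cell α f g) (hf : C.Arrow f x y) :
    C.hc α (C.one₂ (C.one x)) = α := by
  obtain ⟨rfl, rfl⟩ := h
  obtain ⟨rfl, rfl⟩ := hf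
  rw [← hcomp_eq_hc _ _ _ (by rw [C.src₂_one₂, C.tgt_one]), C.hcomp_one]

theorem one₂_hc_one₂ {g f : C₁} {x y z : C₀} (hg : C.Arrow g y z) (hf : C.Arrow f x y) :
    C.hc (C.one₂ g) (C.one₂ f) = C.one₂ (C.cc g f) := by
  have e := hg.src.trans hf.tgt.symm
  rw [← hcomp_eq_hc _ _ _ (by rwa [C.src₂_one₂, C.src₂_one₂]), ← comp_eq_cc _ _ _ e,
    C.hcomp_one₂ g f e]

theorem hc_vc_hc {β' β α' α : C₂} {g g' g'' f f' f'' : C₁} {x y z : C₀} (hβ' : C.Cell β' g' g'')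
    (hβ : C.Cell β g g') (hα' : C.Cell α' f' f'') (hα : C.Cell α f f') (hg : C.Arrow g y z)
    (hf : C.Arrow f x y) :
    C.hc (C.vc β' β) (C.vc α' α) = C.vc (C.hc β' α') (C.hc β α) := by
  have hg' := hβ.of_arrow_left hg
  have hf' := hα.of_arrow_left hf
  have h1 := hβ'.src₂.trans hβ.tgt₂.symm
  have h2 := hα'.src₂.trans hα.tgt₂.symm
  have h3 : C.src (C.src₂ β') = C.tgt (C.src₂ α') := by
    rw [hβ'.src₂, hα'.src₂, hg'.src, hf'.tgt]
  have h4 : C.src (C.src₂ β) = C.tgt (C.src₂ α) := by rw [hβ.src₂, hα.src₂, hg.src, hf.tgt]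
  have h5 : C.src (C.src₂ (C.vc β' β)) = C.tgt (C.src₂ (C.vc α' α)) := by
    rw [(hβ'.vc hβ).src₂, (hα'.vc hα).src₂, hg.src, hf.tgt]
  have h6 := (hβ'.hc hα' hg' hf').src₂.trans (hβ.hc hα hg hf).tgt₂.symm
  simp only [← vcomp_eq_vc _ _ _ h1, ← vcomp_eq_vc _ _ _ h2, ← hcomp_eq_hc _ _ _ h3,
    ← hcomp_eq_hc _ _ _ h4] at h5 h6 ⊢
  rw [← hcomp_eq_hc _ _ _ h5, ← vcomp_eq_vc _ _ _ h6]
  exact C.interchange _ _ _ _ _ _ _ _ _ _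

theorem hc_assoc {γ β α : C₂} {k k' g g' f f' : C₁} {x y z w : C₀} (hγ : C.Cell γ k k')
    (hβ : C.Cell β g g') (hα : C.Cell α f f') (hk : C.Arrow k z w) (hg : C.Arrow g y z)
    (hf : C.Arrow f x y) : C.hc γ (C.hc β α) = C.hc (C.hc γ β) α := by
  have h1 : C.src (C.src₂ γ) = C.tgt (C.src₂ β) := by rw [hγ.src₂, hβ.src₂, hk.src, hg.tgt]
  have h2 : C.src (C.src₂ β) = C.tgt (C.src₂ α) := by rw [hβ.src₂, hα.src₂, hg.src, hf.tgt]
  have h3 : C.src (C.src₂ γ) = C.tgt (C.src₂ (C.hc β α)) := by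
    rw [hγ.src₂, (hβ.hc hα hg hf).src₂, hk.src, (hg.cc hf).tgt]
  have h4 : C.src (C.src₂ (C.hc γ β)) = C.tgt (C.src₂ α) := by
    rw [(hγ.hc hβ hk hg).src₂, hα.src₂, (hk.cc hg).src, hf.tgt]
  simp only [← hcomp_eq_hc _ _ _ h1, ← hcomp_eq_hc _ _ _ h2] at h3 h4 ⊢
  rw [← hcomp_eq_hc _ _ _ h3, ← hcomp_eq_hc _ _ _ h4]
  exact C.hcomp_assoc _ _ _ _ _ _ _

theorem one₂_hc_vc {β α : C₂} {k f g h : C₁} {x y z : C₀} (hk : C.Arrow k y z)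
    (hβ : C.Cell β g h) (hα : C.Cell α f g) (hf : C.Arrow f x y) :
    C.hc (C.one₂ k) (C.vc β α) = C.vc (C.hc (C.one₂ k) β) (C.hc (C.one₂ k) α) := by
  rw [← hc_vc_hc (Cell.one k) (Cell.one k) hβ hα hk hf, vc_one (Cell.one k)]

theorem vc_hc_one₂ {β α : C₂} {k f g h : C₁} {x y z : C₀} (hβ : C.Cell β g h) (hα : C.Cell α f g)
    (hf : C.Arrow f y z) (hk : C.Arrow k x y) :
    C.hc (C.vc β α) (C.one₂ k) = C.vc (C.hc β (C.one₂ k)) (C.hc α (C.one₂ k)) := by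
  rw [← hc_vc_hc hβ hα (Cell.one k) (Cell.one k) hf hk, vc_one (Cell.one k)]

/-- The two ways to write `s ∘ τ` as a vertical composition agree. -/
theorem whisker_exchange {s τ : C₂} {g g' f f' : C₁} {x y z : C₀} (hs : C.Cell s g g')
    (hτ : C.Cell τ f f') (hg : C.Arrow g y z) (hf : C.Arrow f x y) :
    C.vc (C.hc (C.one₂ g') τ) (C.hc s (C.one₂ f)) =
      C.vc (C.hc s (C.one₂ f')) (C.hc (C.one₂ g) τ) := by
  rw [← hc_vc_hc (Cell.one g') hs hτ (Cell.one f) hg hf,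
    ← hc_vc_hc hs (Cell.one g) (Cell.one f') hτ hg hf, one_vc hs, vc_one hs, one_vc hτ, vc_one hτ]

/-- Coherence of a degenerate tetrahedron whose first two vertices agree. -/
theorem coherent_left {τ : C₂} {ei eq eN : C₁} {xi xq xN : C₀} (hi : C.Arrow ei xi xq)
    (hq : C.Arrow eq xq xN) (hN : C.Arrow eN xi xN) (hτ : C.Cell τ eN (C.cc eq ei)) :
    C.vc (C.hc τ (C.one₂ (C.one xi))) (C.one₂ eN) =
      C.vc (C.hc (C.one₂ eq) (C.one₂ ei)) τ := by
  rw [hc_one hτ hN, vc_one hτ, one₂_hc_one₂ hq hi, one_vc hτ]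

/-- Coherence of a degenerate tetrahedron whose last two vertices agree. -/
theorem coherent_right {τ : C₂} {ei eq eN : C₁} {xi xq xN : C₀} (hi : C.Arrow ei xi xq)
    (hq : C.Arrow eq xq xN) (hN : C.Arrow eN xi xN) (hτ : C.Cell τ eN (C.cc eq ei)) :
    C.vc (C.hc (C.one₂ eq) (C.one₂ ei)) τ =
      C.vc (C.hc (C.one₂ (C.one xN)) τ) (C.one₂ eN) := by
  rw [one_hc hτ hN, vc_one hτ, one₂_hc_one₂ hq hi, one_vc hτ]

/-- The map `inv` assigns to every 2-cell an inverse for the vertical composition. -/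
def IsInverse (C : TwoCategory C₀ C₁ C₂) (inv : C₂ → C₂) : Prop :=
  ∀ α f g, C.Cell α f g →
    C.Cell (inv α) g f ∧ C.vc (inv α) α = C.one₂ f ∧ C.vc α (inv α) = C.one₂ g

/-- Whiskered invertible 2-cells `1_k ∘ τ` can be cancelled. -/
theorem IsInverse.hc_cancel {inv : C₂ → C₂} (hi : C.IsInverse inv) {τ A B : C₂} {k f g h : C₁}
    {x y z : C₀} (hτ : C.Cell τ f g) (hk : C.Arrow k y z) (hf : C.Arrow f x y)
    (hA : C.Cell A h (C.cc k f)) (hB : C.Cell B h (C.cc k f))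
    (hAB : C.vc (C.hc (C.one₂ k) τ) A = C.vc (C.hc (C.one₂ k) τ) B) : A = B := by
  obtain ⟨h1, h2, -⟩ := hi τ f g hτ
  have hg := hτ.of_arrow_left hf
  have key : ∀ X, C.Cell X h (C.cc k f) →
      C.vc (C.hc (C.one₂ k) (inv τ)) (C.vc (C.hc (C.one₂ k) τ) X) = X := fun X hX => by
    rw [vc_assoc ((Cell.one k).hc h1 hk hg) ((Cell.one k).hc hτ hk hf) hX,
      ← one₂_hc_vc hk h1 hτ hf, h2, one₂_hc_one₂ hk hf, one_vc hX]
  rw [← key A hA, hAB, key B hB]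

theorem IsInverse.hc_eq_iff {inv : C₂ → C₂} (hi : C.IsInverse inv) {τ A B : C₂} {k f g h : C₁}
    {x y z : C₀} (hτ : C.Cell τ f g) (hk : C.Arrow k y z) (hf : C.Arrow f x y)
    (hA : C.Cell A h (C.cc k f)) (hB : C.Cell B h (C.cc k g)) :
    C.vc (C.hc (C.one₂ k) τ) A = B ↔ A = C.vc (C.hc (C.one₂ k) (inv τ)) B := by
  obtain ⟨h1, h2, h3⟩ := hi τ f g hτ
  have hg := hτ.of_arrow_left hf
  constructor
  · rintro rfl
    rw [vc_assoc ((Cell.one k).hc h1 hk hg) ((Cell.one k).hc hτ hk hf) hA,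
      ← one₂_hc_vc hk h1 hτ hf, h2, one₂_hc_one₂ hk hf, one_vc hA]
  · rintro rfl
    rw [vc_assoc ((Cell.one k).hc hτ hk hf) ((Cell.one k).hc h1 hk hg) hB,
      ← one₂_hc_vc hk hτ h1 hg, h3, one₂_hc_one₂ hk hg, one_vc hB]

/-- Let `0, 1, i, j, N` be the vertices of a 4-simplex whose faces `(1, i, j, N)`, `(0, 1, i, j)`,
`(0, 1, i, N)` and `(0, 1, j, N)` are coherent. Then the face `(0, i, j, N)` is coherent: the two
sides of the equation agree after composition with the invertible 2-cell `1 ∘ t01i`. The names of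
the arrows and 2-cells are those of their vertices. -/
theorem IsInverse.coherent_of_coherent {inv : C₂ → C₂} (hi : C.IsInverse inv)
    {x₀ x₁ xi xj xN : C₀} {e01 e0i e0j e0N e1i e1j e1N eij eiN ejN : C₁}
    {t01i t01j t01N t0ij t0iN t0jN t1ij t1iN t1jN tijN : C₂}
    (h01 : C.Arrow e01 x₀ x₁) (h0i : C.Arrow e0i x₀ xi) (h0j : C.Arrow e0j x₀ xj)
    (h1i : C.Arrow e1i x₁ xi) (h1j : C.Arrow e1j x₁ xj) (h1N : C.Arrow e1N x₁ xN)
    (hij : C.Arrow eij xi xj) (hiN : C.Arrow eiN xi xN) (hjN : C.Arrow ejN xj xN)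
    (h01i : C.Cell t01i e0i (C.cc e1i e01)) (h01j : C.Cell t01j e0j (C.cc e1j e01))
    (h01N : C.Cell t01N e0N (C.cc e1N e01)) (h0ij : C.Cell t0ij e0j (C.cc eij e0i))
    (h0iN : C.Cell t0iN e0N (C.cc eiN e0i)) (h0jN : C.Cell t0jN e0N (C.cc ejN e0j))
    (h1ij : C.Cell t1ij e1j (C.cc eij e1i)) (h1iN : C.Cell t1iN e1N (C.cc eiN e1i))
    (h1jN : C.Cell t1jN e1N (C.cc ejN e1j)) (hijN : C.Cell tijN eiN (C.cc ejN eij))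
    (c01iN : C.vc (C.hc t1iN (C.one₂ e01)) t01N = C.vc (C.hc (C.one₂ eiN) t01i) t0iN)
    (c01jN : C.vc (C.hc t1jN (C.one₂ e01)) t01N = C.vc (C.hc (C.one₂ ejN) t01j) t0jN)
    (c1ijN : C.vc (C.hc tijN (C.one₂ e1i)) t1iN = C.vc (C.hc (C.one₂ ejN) t1ij) t1jN)
    (c01ij : C.vc (C.hc t1ij (C.one₂ e01)) t01j = C.vc (C.hc (C.one₂ eij) t01i) t0ij) :
    C.vc (C.hc tijN (C.one₂ e0i)) t0iN = C.vc (C.hc (C.one₂ ejN) t0ij) t0jN := by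
  have a1 := (hijN.hc (Cell.one e0i) hiN h0i)
  have a2 := ((Cell.one ejN).hc h0ij hjN h0j)
  have a3 := (Cell.one (C.cc ejN eij)).hc h01i (hjN.cc hij) h0i
  have a4 := (Cell.one eiN).hc h01i hiN h0i
  have a5 := hijN.hc (Cell.one (C.cc e1i e01)) hiN (h1i.cc h01)
  have a6 := h1iN.hc (Cell.one e01) h1N h01
  have a7 := (Cell.one ejN).hc h1ij hjN h1j
  have a8 := h1jN.hc (Cell.one e01) h1N h01
  have a9 := (hijN.hc (Cell.one e1i) hiN h1i)
  have b1 := h1ij.hc (Cell.one e01) h1j h01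
  have b2 := (Cell.one eij).hc h01i hij h0i
  have e1 := hjN.cc hij
  rw [← cc_assoc hjN hij h0i] at a1
  -- compose both sides with `1 ∘ t01i`
  refine hi.hc_cancel h01i e1 h0i (h := e0N) ?_ ?_ ?_
  · rw [← cc_assoc hjN hij h0i]
    exact a1.vc h0iN
  · rw [← cc_assoc hjN hij h0i]
    exact a2.vc h0jN
  rw [← cc_assoc hjN hij h0i] at a3
  rw [vc_assoc a3 a1 h0iN, whisker_exchange hijN h01i hiN h0i, ← vc_assoc a5 a4 h0iN, ← c01iN,
    ← one₂_hc_one₂ h1i h01, hc_assoc hijN (Cell.one e1i) (Cell.one e01) hiN h1i h01]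
  have r1 := h1j.cc h01
  have c1 := a9.hc (Cell.one e01) (hiN.cc h1i) h01
  have c2 := a7.hc (Cell.one e01) (hjN.cc h1j) h01
  have c3 := (Cell.one ejN).hc b1 hjN r1
  have c4 := (Cell.one ejN).hc h01j hjN h0j
  have c5 := (Cell.one ejN).hc b2 hjN (hij.cc h0i)
  -- replace the face `(1, i, j, N)` on the left hand side
  have k1 : C.vc (C.hc (C.hc tijN (C.one₂ e1i)) (C.one₂ e01)) (C.vc (C.hc t1iN (C.one₂ e01)) t01N) =
      C.vc (C.hc (C.hc (C.one₂ ejN) t1ij) (C.one₂ e01)) (C.vc (C.hc t1jN (C.one₂ e01)) t01N) := by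
    rw [vc_assoc c1 a6 h01N, vc_assoc c2 a8 h01N, ← vc_hc_one₂ a9 h1iN h1N h01, c1ijN,
      vc_hc_one₂ a7 h1jN h1N h01]
  rw [cc_assoc hij h1i h01] at b2 c5
  -- replace the face `(0, 1, i, j)` on the right hand side
  have k2 : C.vc (C.hc (C.one₂ ejN) (C.hc t1ij (C.one₂ e01))) (C.hc (C.one₂ ejN) t01j) =
      C.vc (C.hc (C.one₂ ejN) (C.hc (C.one₂ eij) t01i)) (C.hc (C.one₂ ejN) t0ij) := by
    rw [← one₂_hc_vc hjN b1 h01j h0j, c01ij, one₂_hc_vc hjN b2 h0ij h0j]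
  rw [k1, c01jN, ← hc_assoc (Cell.one ejN) h1ij (Cell.one e01) hjN h1j h01,
    vc_assoc c3 c4 h0jN, k2, ← vc_assoc c5 a2 h0jN,
    hc_assoc (Cell.one ejN) (Cell.one eij) h01i hjN hij h0i, one₂_hc_one₂ hjN hij]

end TwoCategory

/-! ### Lax functors on ordinals in terms of vertices, edges and triangles -/

namespace LaxFunctor

variable {C₀ C₁ C₂ : Type u} {C : TwoCategory C₀ C₁ C₂} {n : ℕ} (u : LaxFunctor (ordinal n) C)

theorem arrow_edge (i j : Fin (n + 1)) (h : i ≤ j) :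
    C.Arrow (u.edge i j h) (u.vertex i) (u.vertex j) :=
  ⟨u.src_map₁ _, u.tgt_map₁ _⟩

theorem edge_self (i : Fin (n + 1)) : u.edge i i le_rfl = C.one (u.vertex i) :=
  u.map₁_one i

theorem cell_triangle (i j k : Fin (n + 1)) (hij : i ≤ j) (hjk : j ≤ k) :
    C.Cell (u.triangle i j k hij hjk) (u.edge i k (hij.trans hjk))
      (C.cc (u.edge j k hjk) (u.edge i j hij)) := by
  have h : C.src (u.edge j k hjk) = C.tgt (u.edge i j hij) :=
    (u.arrow_edge j k hjk).src.trans (u.arrow_edge i j hij).tgt.symm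
  rw [← C.comp_eq_cc _ _ h]
  exact ⟨u.src₂_mapComp _ _ _, u.tgt₂_mapComp _ _ _ _⟩

theorem triangle_left (i k : Fin (n + 1)) (h : i ≤ k) :
    u.triangle i i k le_rfl h = C.one₂ (u.edge i k h) :=
  u.mapComp_one_right ⟨(i, k), h⟩ rfl

theorem triangle_right (i k : Fin (n + 1)) (h : i ≤ k) :
    u.triangle i k k h le_rfl = C.one₂ (u.edge i k h) :=
  u.mapComp_one_left ⟨(i, k), h⟩ rfl

theorem coherent (i j k l : Fin (n + 1)) (hij : i ≤ j) (hjk : j ≤ k) (hkl : k ≤ l) :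
    C.vc (C.hc (u.triangle j k l hjk hkl) (C.one₂ (u.edge i j hij)))
        (u.triangle i j l hij (hjk.trans hkl)) =
      C.vc (C.hc (C.one₂ (u.edge k l hkl)) (u.triangle i j k hij hjk))
        (u.triangle i k l (hij.trans hjk) hkl) := by
  have aij := u.arrow_edge i j hij
  have ajl := u.arrow_edge j l (hjk.trans hkl)
  have ajk := u.arrow_edge j k hjk
  have aik := u.arrow_edge i k (hij.trans hjk)
  have akl := u.arrow_edge k l hkl
  have cjkl := u.cell_triangle j k l hjk hkl
  have cijk := u.cell_triangle i j k hij hjk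
  have cijl := u.cell_triangle i j l hij (hjk.trans hkl)
  have cikl := u.cell_triangle i k l (hij.trans hjk) hkl
  have h1 : C.src (C.src₂ (u.triangle j k l hjk hkl)) = C.tgt (C.src₂ (C.one₂ (u.edge i j hij))) := by
    rw [cjkl.src₂, C.src₂_one₂, ajl.src, aij.tgt]
  have h2 : C.src (C.src₂ (C.one₂ (u.edge k l hkl))) = C.tgt (C.src₂ (u.triangle i j k hij hjk)) := by
    rw [cijk.src₂, C.src₂_one₂, akl.src, aik.tgt]
  have h3 := (cjkl.hc (TwoCategory.Cell.one (u.edge i j hij)) ajl aij).src₂.trans cijl.tgt₂.symm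
  have h4 := ((TwoCategory.Cell.one (u.edge k l hkl)).hc cijk akl aik).src₂.trans cikl.tgt₂.symm
  rw [← C.hcomp_eq_hc _ _ h1] at h3 ⊢
  rw [← C.hcomp_eq_hc _ _ h2] at h4 ⊢
  rw [← C.vcomp_eq_vc _ _ h3, ← C.vcomp_eq_vc _ _ h4]
  exact u.mapComp_assoc ⟨(k, l), hkl⟩ ⟨(j, k), hjk⟩ ⟨(i, j), hij⟩ rfl rfl _ _ _ _ _ _

variable {u}

/-- A lax functor on an ordinal is determined by its triangles. -/
theorem ext_triangle {u' : LaxFunctor (ordinal n) C}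
    (h : ∀ i j k hij hjk, u.triangle i j k hij hjk = u'.triangle i j k hij hjk) : u = u' := by
  have he : ∀ i k h, u.edge i k h = u'.edge i k h := fun i k hik => by
    rw [← (u.cell_triangle i i k le_rfl hik).src₂, h, (u'.cell_triangle i i k le_rfl hik).src₂]
  have h1 : u.map₁ = u'.map₁ := funext fun p => he _ _ p.2
  apply LaxFunctor.ext
  · funext i
    have := congrArg C.src (he i i le_rfl)
    rwa [(u.arrow_edge i i le_rfl).src, (u'.arrow_edge i i le_rfl).src] at this
  · exact h1
  · funext p
    exact (u.map₂_one₂ p).trans ((congrArg C.one₂ (congrFun h1 p)).trans (u'.map₂_one₂ p).symm)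
  · funext ⟨⟨j', k⟩, hjk⟩ ⟨⟨i, j⟩, hij⟩ e
    obtain rfl : j' = j := e
    exact h i j' k hij hjk

end LaxFunctor

/-- The data of a lax functor on the full subcomplex of a simplex whose edges are the pairs `(i, j)`
with `R i j`: vertices `x i`, edges `e i j : x i → x j` and triangles
`t i j k : e i k ⇒ e j k ∘ e i j`. The values at other indices are irrelevant. -/
structure IsLaxData {C₀ C₁ C₂ : Type u} (C : TwoCategory C₀ C₁ C₂) {ι : Type*} [LinearOrder ι]
    (R : ι → ι → Prop) (x : ι → C₀) (e : ι → ι → C₁) (t : ι → ι → ι → C₂) : Prop where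
  le {i j} : R i j → i ≤ j
  mono {i i' j' j} : R i j → i ≤ i' → i' ≤ j' → j' ≤ j → R i' j'
  arrow {i j} : R i j → C.Arrow (e i j) (x i) (x j)
  edge_self {i} : R i i → e i i = C.one (x i)
  cell {i j k} : i ≤ j → j ≤ k → R i k → C.Cell (t i j k) (e i k) (C.cc (e j k) (e i j))
  triangle_left {i k} : R i k → t i i k = C.one₂ (e i k)
  triangle_right {i k} : R i k → t i k k = C.one₂ (e i k)
  coherent {i j k l} : i ≤ j → j ≤ k → k ≤ l → R i l →
    C.vc (C.hc (t j k l) (C.one₂ (e i j))) (t i j l) =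
      C.vc (C.hc (C.one₂ (e k l)) (t i j k)) (t i k l)

namespace IsLaxData

variable {C₀ C₁ C₂ : Type u} {C : TwoCategory C₀ C₁ C₂} {ι : Type*} [LinearOrder ι]
  {R : ι → ι → Prop} {x : ι → C₀} {e : ι → ι → C₁} {t : ι → ι → ι → C₂}

/-- The restriction of lax data to a simplex `a`, which lies in the subcomplex if its first and its
last vertex are joined by an edge. -/
def toLaxFunctor (h : IsLaxData C R x e t) {m : ℕ} (a : Fin (m + 1) →o ι)
    (ha : R (a 0) (a (Fin.last m))) : LaxFunctor (ordinal m) C :=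
  have hR : ∀ {i j : Fin (m + 1)}, i ≤ j → R (a i) (a j) := fun hij =>
    h.mono ha (a.monotone (Fin.zero_le _)) (a.monotone hij) (a.monotone (Fin.le_last _))
  have hcell : ∀ {i j k : Fin (m + 1)}, i ≤ j → j ≤ k →
      C.Cell (t (a i) (a j) (a k)) (e (a i) (a k)) (C.cc (e (a j) (a k)) (e (a i) (a j))) :=
    fun hij hjk => h.cell (a.monotone hij) (a.monotone hjk) (hR (hij.trans hjk))
  { map₀ := fun i => x (a i)
    map₁ := fun p => e (a p.1.1) (a p.1.2)
    map₂ := fun p => C.one₂ (e (a p.1.1) (a p.1.2))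
    mapComp := fun q p _ => t (a p.1.1) (a p.1.2) (a q.1.2)
    src_map₁ := fun p => (h.arrow (hR p.2)).src
    tgt_map₁ := fun p => (h.arrow (hR p.2)).tgt
    src₂_map₂ := fun _ => C.src₂_one₂ _
    tgt₂_map₂ := fun _ => C.tgt₂_one₂ _
    map₁_one := fun _ => h.edge_self (hR le_rfl)
    map₂_one₂ := fun _ => rfl
    map₂_vcomp := fun β α hβα _ => by
      obtain rfl : β = α := hβα
      rw [C.vcomp_eq_vc]
      exact (TwoCategory.one_vc (TwoCategory.Cell.one _)).symm
    src₂_mapComp := fun ⟨⟨j', k⟩, hjk⟩ ⟨⟨i, j⟩, hij⟩ hj => by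
      obtain rfl : j' = j := hj
      exact (hcell hij hjk).src₂
    tgt₂_mapComp := fun ⟨⟨j', k⟩, hjk⟩ ⟨⟨i, j⟩, hij⟩ hj _ => by
      obtain rfl : j' = j := hj
      rw [C.comp_eq_cc]
      exact (hcell hij hjk).tgt₂
    mapComp_one_left := fun p _ => h.triangle_right (hR p.2)
    mapComp_one_right := fun p _ => h.triangle_left (hR p.2)
    mapComp_natural := fun ⟨⟨j', k⟩, hjk⟩ ⟨⟨i, j⟩, hij⟩ hj _ _ _ _ _ => by
      obtain rfl : j' = j := hj
      simp only [C.vcomp_eq_vc, C.hcomp_eq_hc]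
      rw [TwoCategory.one₂_hc_one₂ (h.arrow (hR hjk)) (h.arrow (hR hij))]
      exact (TwoCategory.one_vc (hcell hij hjk)).trans (TwoCategory.vc_one (hcell hij hjk)).symm
    mapComp_assoc := fun ⟨⟨k', l⟩, hkl⟩ ⟨⟨j', k⟩, hjk⟩ ⟨⟨i, j⟩, hij⟩ hk hj _ _ _ _ _ _ => by
      obtain rfl : k' = k := hk
      obtain rfl : j' = j := hj
      simp only [C.vcomp_eq_vc, C.hcomp_eq_hc]
      exact h.coherent (a.monotone hij) (a.monotone hjk) (a.monotone hkl)
        (hR (hij.trans (hjk.trans hkl))) }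

end IsLaxData

/-! ### Partial nerves in terms of vertices, edges and triangles -/

namespace PartialNerve

variable {C₀ C₁ C₂ : Type u} {C : TwoCategory C₀ C₁ C₂} {n : ℕ} {k : Fin (n + 1)}

/-- `(i, j)` is an edge of `F_k Δ^{n+1}`. -/
def IsEdge (k : Fin (n + 1)) (i j : Fin (n + 2)) : Prop :=
  i ≤ j ∧ (j < Fin.last (n + 1) ∨ k.castSucc ≤ i)

theorem IsEdge.mono {i i' j' j : Fin (n + 2)} (h : IsEdge k i j) (hi : i ≤ i') (hij : i' ≤ j')
    (hj : j' ≤ j) : IsEdge k i' j' :=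
  ⟨hij, h.2.imp (fun h => hj.trans_lt h) (fun h => h.trans hi)⟩

theorem isEdge_self (i : Fin (n + 2)) : IsEdge k i i :=
  ⟨le_rfl, (Fin.le_last i).lt_or_eq.imp id fun h => by rw [h]; exact Fin.le_last _⟩

theorem eval_congr (u : PartialNerve C n k) {m : SimplexCategory} {a a' : m ⟶ ⦋n + 1⦌} (h : a = a')
    (ha : InFiltration k a) (ha' : InFiltration k a') : u.eval a ha = u.eval a' ha' := by
  subst h; rfl

theorem eval_triangle (u : PartialNerve C n k) {m : SimplexCategory} (a : m ⟶ ⦋n + 1⦌)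
    (ha : InFiltration k a) (i j l : Fin (m.len + 1)) (hij : i ≤ j) (hjl : j ≤ l) (h) :
    (u.eval a ha).triangle i j l hij hjl =
      u.triangle (a.toOrderHom i) (a.toOrderHom j) (a.toOrderHom l)
        (a.toOrderHom.monotone hij) (a.toOrderHom.monotone hjl) h := by
  have e : SimplexCategory.mkOfLeComp i j l hij hjl ≫ a =
      SimplexCategory.mkOfLeComp (a.toOrderHom i) (a.toOrderHom j) (a.toOrderHom l)
        (a.toOrderHom.monotone hij) (a.toOrderHom.monotone hjl) := by
    ext x
    fin_cases x <;> rfl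
  rw [triangle, ← u.eval_congr e (e ▸ h) h, u.eval_comp a ha]
  rfl

theorem eval_edge (u : PartialNerve C n k) {m : SimplexCategory} (a : m ⟶ ⦋n + 1⦌)
    (ha : InFiltration k a) (i j : Fin (m.len + 1)) (hij : i ≤ j) (h) :
    (u.eval a ha).edge i j hij =
      u.edge (a.toOrderHom i) (a.toOrderHom j) (a.toOrderHom.monotone hij) h := by
  have e : SimplexCategory.mkOfLe i j hij ≫ a =
      SimplexCategory.mkOfLe (a.toOrderHom i) (a.toOrderHom j) (a.toOrderHom.monotone hij) := by
    ext x
    fin_cases x <;> rfl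
  rw [edge, ← u.eval_congr e (e ▸ h) h, u.eval_comp a ha]
  rfl

/-- A map `F_k Δ^{n+1} → NC` is determined by its triangles. -/
theorem ext_triangle {u u' : PartialNerve C n k}
    (h : ∀ i j l hij hjl hil, u.triangle i j l hij hjl hil = u'.triangle i j l hij hjl hil) :
    u = u' := by
  have key : ∀ (m : SimplexCategory) (a : m ⟶ ⦋n + 1⦌) (ha : InFiltration k a),
      u.eval a ha = u'.eval a ha := by
    intro m a ha
    apply LaxFunctor.ext_triangle
    intro i j l hij hjl
    have hil : a.toOrderHom l < Fin.last (n + 1) ∨ k.castSucc ≤ a.toOrderHom i :=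
      ha.imp (fun h => (a.toOrderHom.monotone (Fin.le_last _)).trans_lt h)
        (fun h => h.trans (a.toOrderHom.monotone (Fin.zero_le _)))
    rw [u.eval_triangle a ha i j l hij hjl hil, u'.eval_triangle a ha i j l hij hjl hil, h]
  apply NatTrans.ext
  funext m
  ext ⟨a, ha⟩
  have := key m.unop (SSet.stdSimplex.objEquiv a) ha
  simp only [eval, Equiv.symm_apply_apply] at this
  exact this

/-- The vertex `u_i` of `u : F_k Δ^{n+1} → NC`. -/
def vtx (u : PartialNerve C n k) (i : Fin (n + 2)) : C₀ :=
  C.src (u.edge i i le_rfl (isEdge_self i).2)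

open Classical in
/-- The edges of `u : F_k Δ^{n+1} → NC`, with junk values at other indices. -/
noncomputable def edg (u : PartialNerve C n k) (i j : Fin (n + 2)) : C₁ :=
  if h : IsEdge k i j then u.edge i j h.1 h.2 else C.one (u.vtx i)

open Classical in
/-- The triangles of `u : F_k Δ^{n+1} → NC`, with junk values at other indices. -/
noncomputable def tri (u : PartialNerve C n k) (i j l : Fin (n + 2)) : C₂ :=
  if h : i ≤ j ∧ j ≤ l ∧ IsEdge k i l then u.triangle i j l h.1 h.2.1 h.2.2.2
  else C.one₂ (C.one (u.vtx i))

theorem edg_eq (u : PartialNerve C n k) {i j : Fin (n + 2)} (h : IsEdge k i j) :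
    u.edg i j = u.edge i j h.1 h.2 := dif_pos h

theorem tri_eq (u : PartialNerve C n k) {i j l : Fin (n + 2)} (hij : i ≤ j) (hjl : j ≤ l)
    (h : IsEdge k i l) : u.tri i j l = u.triangle i j l hij hjl h.2 := dif_pos ⟨hij, hjl, h⟩

theorem isLaxData (u : PartialNerve C n k) : IsLaxData C (IsEdge k) u.vtx u.edg u.tri := by
  have harrow : ∀ i j, IsEdge k i j → C.Arrow (u.edg i j) (u.vtx i) (u.vtx j) := by
    intro i j h
    rw [edg_eq u h]
    refine ⟨?_, ?_⟩
    · rw [vtx, u.src_edge_eq_tgt_edge i i j le_rfl h.1 (isEdge_self i).2 h.2,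
        ← u.src_edge_eq_tgt_edge i i i le_rfl le_rfl (isEdge_self i).2 (isEdge_self i).2]
    · rw [vtx, u.src_edge_eq_tgt_edge i j j h.1 le_rfl h.2 (isEdge_self j).2]
  refine ⟨fun h => h.1, IsEdge.mono, fun h => harrow _ _ h, ?_, ?_, ?_, ?_, ?_⟩
  · intro i h
    have h1 := (u.eval (SimplexCategory.mkOfLe i i le_rfl) h.2).edge_self 0
    have h2 : u.edge i i le_rfl h.2 = _ := (u.eval_edge (SimplexCategory.mkOfLe i i le_rfl) h.2
      0 0 le_rfl h.2).symm.trans h1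
    rw [edg_eq u h, vtx, h2, C.src_one]
  · intro i j l hij hjl h
    have hjl' := h.mono hij hjl le_rfl
    have hij' := h.mono le_rfl hij hjl
    rw [tri_eq u hij hjl h, edg_eq u h, edg_eq u hij', edg_eq u hjl']
    let a := SimplexCategory.mkOfLeComp i j l hij hjl
    have h1 := (u.eval a h.2).cell_triangle 0 1 2 (by decide) (by decide)
    rw [u.eval_edge a h.2 0 2 _ h.2, u.eval_edge a h.2 0 1 _ hij'.2,
      u.eval_edge a h.2 1 2 _ hjl'.2] at h1
    exact h1
  · intro i l h
    rw [tri_eq u le_rfl h.1 h, edg_eq u h]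
    let a := SimplexCategory.mkOfLe i l h.1
    have h1 := (u.eval a h.2).triangle_left 0 1 (by decide)
    rw [u.eval_triangle a h.2 0 0 1 _ _ h.2] at h1
    exact h1
  · intro i l h
    rw [tri_eq u h.1 le_rfl h, edg_eq u h]
    let a := SimplexCategory.mkOfLe i l h.1
    have h1 := (u.eval a h.2).triangle_right 0 1 (by decide)
    rw [u.eval_triangle a h.2 0 1 1 _ _ h.2] at h1
    exact h1
  · intro i j l m hij hjl hlm h
    let a : ⦋3⦌ ⟶ ⦋n + 1⦌ := SimplexCategory.Hom.mk ⟨![i, j, l, m], by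
      intro p q hpq
      fin_cases p <;> fin_cases q <;>
        first
        | exact le_rfl
        | exact hij
        | exact hjl
        | exact hlm
        | exact hij.trans hjl
        | exact hjl.trans hlm
        | exact hij.trans (hjl.trans hlm)
        | exact absurd hpq (by decide)⟩
    have hjm := h.mono hij (hjl.trans hlm) le_rfl
    have hil := h.mono le_rfl (hij.trans hjl) hlm
    have hij' := h.mono le_rfl hij (hjl.trans hlm)
    have hlm' := h.mono (hij.trans hjl) hlm le_rfl
    rw [tri_eq u hjl hlm hjm, tri_eq u hij (hjl.trans hlm) h, tri_eq u hij hjl hil,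
      tri_eq u (hij.trans hjl) hlm h, edg_eq u hij', edg_eq u hlm']
    have h1 := (u.eval a h.2).coherent 0 1 2 3 (by decide) (by decide) (by decide)
    rw [u.eval_triangle a h.2 1 2 3 _ _ hjm.2, u.eval_triangle a h.2 0 1 3 _ _ h.2,
      u.eval_triangle a h.2 0 1 2 _ _ hil.2, u.eval_triangle a h.2 0 2 3 _ _ h.2,
      u.eval_edge a h.2 0 1 _ hij'.2, u.eval_edge a h.2 2 3 _ hlm'.2] at h1
    exact h1

/-- Lax data on `F_k Δ^{n+1}` define a map `F_k Δ^{n+1} → NC`. -/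
def ofLaxData {x : Fin (n + 2) → C₀} {e : Fin (n + 2) → Fin (n + 2) → C₁}
    {t : Fin (n + 2) → Fin (n + 2) → Fin (n + 2) → C₂} (h : IsLaxData C (IsEdge k) x e t) :
    PartialNerve C n k where
  app _ := ↾(fun a => h.toLaxFunctor (SSet.stdSimplex.objEquiv a.1).toOrderHom
    ⟨(SSet.stdSimplex.objEquiv a.1).toOrderHom.monotone (Fin.zero_le _), a.2⟩)
  naturality _ _ _ := rfl

theorem ofLaxData_triangle {x : Fin (n + 2) → C₀} {e : Fin (n + 2) → Fin (n + 2) → C₁}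
    {t : Fin (n + 2) → Fin (n + 2) → Fin (n + 2) → C₂} (h : IsLaxData C (IsEdge k) x e t)
    (i j l hij hjl hil) : (ofLaxData h).triangle i j l hij hjl hil = t i j l := rfl

end PartialNerve

/-! ### Filling a horn of 2-cells -/

namespace IsLaxData

open TwoCategory

variable {C₀ C₁ C₂ : Type u} {C : TwoCategory C₀ C₁ C₂} {ι : Type*} [LinearOrder ι]
  {R R' : ι → ι → Prop} {x : ι → C₀} {e : ι → ι → C₁} {t : ι → ι → ι → C₂}

variable (C) in
/-- Edges after adding an edge `(k, N)` which is the source of the 2-cell `α`. -/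
def fillEdge (e : ι → ι → C₁) (α : C₂) (k N : ι) (i j : ι) : C₁ :=
  if i = k ∧ j = N then C.src₂ α else e i j

variable (C) in
/-- Triangles after adding an edge `(k, N)` and a triangle `(k, k', N)` with value `α`. The value
at `(k, j, N)` is forced by coherence at `(k, k', j, N)`. -/
noncomputable def fillTri (inv : C₂ → C₂) (e : ι → ι → C₁) (t : ι → ι → ι → C₂) (α : C₂)
    (k k' N : ι) (i j l : ι) : C₂ :=
  if i = k ∧ l = N then
    if j = k ∨ j = N then C.one₂ (C.src₂ α)
    else C.vc (C.hc (C.one₂ (e j N)) (inv (t k k' j))) (C.vc (C.hc (t k' j N) (C.one₂ (e k k'))) α)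
  else t i j l

/-- The relation `R'` has one more edge than `R`, from `k` to the maximum `N`, and `k'` is the
successor of `k`. -/
structure IsStep (R R' : ι → ι → Prop) (k k' N : ι) : Prop where
  lt : k < k'
  lt_max : k' < N
  le_max (i) : i ≤ N
  succ_le {j} : k < j → k' ≤ j
  iff {i j} : R' i j ↔ R i j ∨ (i = k ∧ j = N)
  edge_left {j} : k ≤ j → j < N → R k j
  edge_right : R k' N
  not_edge : ¬ R k N

variable {inv : C₂ → C₂} {k k' N : ι}

/-- Coherence at `(k, k', j, N)` determines the triangle `(k, j, N)`. -/
theorem triangle_eq_fillTri (h : IsLaxData C R' x e t) (hi : C.IsInverse inv)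
    (s : IsStep R R' k k' N) {i j l : ι} (hij : i ≤ j) (hjl : j ≤ l) (hil : R' i l) :
    t i j l = fillTri C inv e t (t k k' N) k k' N i j l := by
  have hkN : R' k N := s.iff.2 (Or.inr ⟨rfl, rfl⟩)
  have hle : ∀ {i}, i ≤ N := fun {i} => s.le_max i
  rw [fillTri]
  split_ifs with h1 h2
  · obtain ⟨rfl, rfl⟩ := h1
    rw [(h.cell s.lt.le s.lt_max.le hkN).src₂]
    rcases h2 with rfl | rfl
    · exact h.triangle_left hil
    · exact h.triangle_right hil
  · obtain ⟨rfl, rfl⟩ := h1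
    have hj : i < j := lt_of_le_of_ne hij fun e => h2 (Or.inl e.symm)
    have hk'j := s.succ_le hj
    have e01 := h.mono hkN le_rfl s.lt.le s.lt_max.le
    have e1N := h.mono hkN s.lt.le s.lt_max.le le_rfl
    have e0i := h.mono hkN le_rfl hij hjl
    have eiN := h.mono hkN hij hjl le_rfl
    exact (hi.hc_eq_iff (h.cell s.lt.le hk'j e0i) (h.arrow eiN) (h.arrow e0i)
      (h.cell hij hjl hkN) (by
        have c1 := (h.cell hk'j hjl e1N).hc (Cell.one (e i k')) (h.arrow e1N) (h.arrow e01)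
        rw [cc_assoc (h.arrow eiN) (h.arrow (h.mono hkN s.lt.le hk'j hjl)) (h.arrow e01)]
        exact c1.vc (h.cell s.lt.le s.lt_max.le hkN))).1
      (h.coherent s.lt.le hk'j hjl hkN).symm
  · rfl

/-- For `j = k'` the triangle forced by coherence is the prescribed one. -/
theorem fillTri_new (h : IsLaxData C R x e t) (hi : C.IsInverse inv) (s : IsStep R R' k k' N)
    {α : C₂} (hα : C.tgt₂ α = C.cc (e k' N) (e k k')) :
    fillTri C inv e t α k k' N k k' N = α := by
  have a01 := h.arrow (s.edge_left s.lt.le s.lt_max)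
  have a1N := h.arrow s.edge_right
  have e1 := h.mono s.edge_right le_rfl le_rfl s.lt_max.le
  have cα : C.Cell α (C.src₂ α) (C.cc (e k' N) (e k k')) := ⟨rfl, hα⟩
  rw [fillTri, if_pos ⟨rfl, rfl⟩, if_neg (not_or.2 ⟨s.lt.ne', s.lt_max.ne⟩),
    h.triangle_right (s.edge_left s.lt.le s.lt_max), h.triangle_left s.edge_right,
    one₂_hc_one₂ a1N a01, one_vc cα]
  refine ((hi.hc_eq_iff (Cell.one (e k k')) a1N a01 cα cα).1 ?_).symm
  rw [one₂_hc_one₂ a1N a01, one_vc cα]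

/-- Lax data can be extended to one more edge by prescribing a 2-cell. The new tetrahedra
`(k, k', j, N)` are coherent by construction, and the others `(k, p, q, N)` because they are faces
of the 4-simplex `(k, k', p, q, N)` all of whose other relevant faces are coherent. -/
theorem fill (h : IsLaxData C R x e t) (hi : C.IsInverse inv) (s : IsStep R R' k k' N)
    (hmono : ∀ {i i' j' j}, R' i j → i ≤ i' → i' ≤ j' → j' ≤ j → R' i' j')
    {α : C₂} (hα : C.tgt₂ α = C.cc (e k' N) (e k k')) :
    IsLaxData C R' x (fillEdge C e α k N) (fillTri C inv e t α k k' N) := by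
  have cα : C.Cell α (C.src₂ α) (C.cc (e k' N) (e k k')) := ⟨rfl, hα⟩
  have hkN : k < N := s.lt.trans s.lt_max
  have r01 : R k k' := s.edge_left s.lt.le s.lt_max
  have r1N := s.edge_right
  have rNN : R N N := h.mono r1N s.lt_max.le le_rfl le_rfl
  have rkk : R k k := s.edge_left le_rfl hkN
  have hE : ∀ {i j}, R i j → fillEdge C e α k N i j = e i j := fun {i j} hij =>
    if_neg fun hh => s.not_edge (by rw [hh.1, hh.2] at hij; exact hij)
  have hT : ∀ {i j l}, R i l → fillTri C inv e t α k k' N i j l = t i j l := fun {i j l} hil =>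
    if_neg fun hh => s.not_edge (by rw [hh.1, hh.2] at hil; exact hil)
  have hEn : fillEdge C e α k N k N = C.src₂ α := if_pos ⟨rfl, rfl⟩
  have hTm : ∀ {j}, k < j → j < N → fillTri C inv e t α k k' N k j N =
      C.vc (C.hc (C.one₂ (e j N)) (inv (t k k' j)))
        (C.vc (C.hc (t k' j N) (C.one₂ (e k k'))) α) := fun {j} h1 h2 => by
    rw [fillTri, if_pos ⟨rfl, rfl⟩, if_neg (not_or.2 ⟨h1.ne', h2.ne⟩)]
  have hTl : fillTri C inv e t α k k' N k k N = C.one₂ (C.src₂ α) := by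
    rw [fillTri, if_pos ⟨rfl, rfl⟩, if_pos (Or.inl rfl)]
  have hTr : fillTri C inv e t α k k' N k N N = C.one₂ (C.src₂ α) := by
    rw [fillTri, if_pos ⟨rfl, rfl⟩, if_pos (Or.inr rfl)]
  have aα : C.Arrow (C.src₂ α) (x k) (x N) := cα.of_arrow_right ((h.arrow r1N).cc (h.arrow r01))
  have rj : ∀ {j}, k < j → R j N := fun {j} hj =>
    h.mono r1N (s.succ_le hj) (s.le_max j) le_rfl
  -- the composite which has to be cancelled to obtain the triangle `(k, j, N)`
  have cB : ∀ {j}, k < j → j < N → C.Cell (C.vc (C.hc (t k' j N) (C.one₂ (e k k'))) α)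
      (C.src₂ α) (C.cc (e j N) (C.cc (e k' j) (e k k'))) := fun {j} h1 h2 => by
    have c1 := (h.cell (s.succ_le h1) h2.le r1N).hc (Cell.one (e k k')) (h.arrow r1N) (h.arrow r01)
    rw [cc_assoc (h.arrow (rj h1)) (h.arrow (h.mono r1N le_rfl (s.succ_le h1) h2.le))
      (h.arrow r01)]
    exact c1.vc cα
  have cm : ∀ {j}, k < j → j < N → C.Cell (t k k' j) (e k j) (C.cc (e k' j) (e k k')) :=
    fun {j} h1 h2 => h.cell s.lt.le (s.succ_le h1) (s.edge_left h1.le h2)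
  have cM : ∀ {j}, k < j → j < N → C.Cell (fillTri C inv e t α k k' N k j N) (C.src₂ α)
      (C.cc (e j N) (e k j)) := fun {j} h1 h2 => by
    rw [hTm h1 h2]
    have r0j := s.edge_left h1.le h2
    exact ((Cell.one _).hc (hi _ _ _ (cm h1 h2)).1 (h.arrow (rj h1))
      ((cm h1 h2).of_arrow_left (h.arrow r0j))).vc (cB h1 h2)
  have hM : ∀ {j}, k < j → j < N → C.vc (C.hc (t k' j N) (C.one₂ (e k k'))) α =
      C.vc (C.hc (C.one₂ (e j N)) (t k k' j)) (fillTri C inv e t α k k' N k j N) :=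
    fun {j} h1 h2 => ((hi.hc_eq_iff (cm h1 h2) (h.arrow (rj h1))
      (h.arrow (s.edge_left h1.le h2)) (cM h1 h2) (cB h1 h2)).2 (hTm h1 h2)).symm
  have arrow' : ∀ {i j}, R' i j → C.Arrow (fillEdge C e α k N i j) (x i) (x j) := fun {i j} hij => by
    rcases s.iff.1 hij with hij | ⟨rfl, rfl⟩
    · rw [hE hij]
      exact h.arrow hij
    · rw [hEn]
      exact aα
  have self' : ∀ {i}, R' i i → fillEdge C e α k N i i = C.one (x i) := fun {i} hii => by
    rcases s.iff.1 hii with hii | ⟨rfl, h2⟩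
    · rw [hE hii, h.edge_self hii]
    · exact absurd h2 hkN.ne
  have left' : ∀ {i l}, R' i l →
      fillTri C inv e t α k k' N i i l = C.one₂ (fillEdge C e α k N i l) := fun {i l} hil => by
    rcases s.iff.1 hil with hil | ⟨rfl, rfl⟩
    · rw [hE hil, hT hil, h.triangle_left hil]
    · rw [hEn, hTl]
  have right' : ∀ {i l}, R' i l →
      fillTri C inv e t α k k' N i l l = C.one₂ (fillEdge C e α k N i l) := fun {i l} hil => by
    rcases s.iff.1 hil with hil | ⟨rfl, rfl⟩
    · rw [hE hil, hT hil, h.triangle_right hil]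
    · rw [hEn, hTr]
  have cell' : ∀ {i j l}, i ≤ j → j ≤ l → R' i l →
      C.Cell (fillTri C inv e t α k k' N i j l) (fillEdge C e α k N i l)
        (C.cc (fillEdge C e α k N j l) (fillEdge C e α k N i j)) := fun {i j l} hij hjl hil => by
    rcases hij.eq_or_lt with rfl | hij'
    · rw [left' hil, self' (hmono hil le_rfl le_rfl hjl), cc_one (arrow' hil)]
      exact Cell.one _
    rcases hjl.eq_or_lt with rfl | hjl'
    · rw [right' hil, self' (hmono hil hij le_rfl le_rfl), one_cc (arrow' hil)]
      exact Cell.one _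
    rcases s.iff.1 hil with hil | ⟨rfl, rfl⟩
    · rw [hT hil, hE hil, hE (h.mono hil hij hjl le_rfl), hE (h.mono hil le_rfl hij hjl)]
      exact h.cell hij hjl hil
    · rw [hEn, hE (rj hij'), hE (s.edge_left hij hjl')]
      exact cM hij' hjl'
  refine ⟨fun hij => ?_, hmono, arrow', self', cell', left', right', ?_⟩
  · rcases s.iff.1 hij with hij | ⟨rfl, rfl⟩
    · exact h.le hij
    · exact hkN.le
  · intro i p q l hip hpq hql hil
    rcases hip.eq_or_lt with rfl | hip'
    · rw [left' hil, left' (hmono hil le_rfl hpq hql), self' (hmono hil le_rfl le_rfl (hpq.trans hql))]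
      exact coherent_left (arrow' (hmono hil le_rfl hpq hql)) (arrow' (hmono hil hpq hql le_rfl))
        (arrow' hil) (cell' hpq hql hil)
    rcases hql.eq_or_lt with rfl | hql'
    · rw [right' hil, right' (hmono hil hip hpq le_rfl),
        self' (hmono hil (hip.trans hpq) le_rfl le_rfl)]
      exact coherent_right (arrow' (hmono hil le_rfl hip hpq)) (arrow' (hmono hil hip hpq le_rfl))
        (arrow' hil) (cell' hip hpq hil)
    rcases s.iff.1 hil with hil | ⟨rfl, rfl⟩
    · rw [hT hil, hT hil, hT (h.mono hil hip (hpq.trans hql) le_rfl),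
        hT (h.mono hil le_rfl (hip.trans hpq) hql), hE (h.mono hil le_rfl hip (hpq.trans hql)),
        hE (h.mono hil (hip.trans hpq) hql le_rfl)]
      exact h.coherent hip hpq hql hil
    -- only the nondegenerate tetrahedra `(k, p, q, N)` are left
    · have hiq := hip'.trans_le hpq
      have hpl := hpq.trans_lt hql'
      have r0q := s.edge_left hiq.le hql'
      have h1p := s.succ_le hip'
      have r1q := h.mono r1N le_rfl (h1p.trans hpq) hql
      rw [hT (rj hip'), hE (rj hiq), hT r0q, hE (s.edge_left hip hpl)]
      exact hi.coherent_of_coherent (h.arrow r01) (h.arrow (s.edge_left hip hpl)) (h.arrow r0q)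
        (h.arrow (h.mono r1N le_rfl h1p (hpq.trans hql))) (h.arrow r1q) (h.arrow r1N)
        (h.arrow (h.mono (rj hip') le_rfl hpq hql)) (h.arrow (rj hip')) (h.arrow (rj hiq))
        (cm hip' hpl) (cm hiq hql') cα (h.cell hip hpq r0q) (cM hip' hpl) (cM hiq hql')
        (h.cell h1p hpq r1q) (h.cell h1p hpl.le r1N) (h.cell (h1p.trans hpq) hql r1N)
        (h.cell hpq hql (rj hip')) (hM hip' hpl) (hM hiq hql')
        (h.coherent h1p hpq hql r1N) (h.coherent s.lt.le h1p hpq r0q)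

end IsLaxData

/-! ### The partial nerves as fibre products of sets -/

namespace LaxFunctor

variable {C₀ C₁ C₂ : Type u} {C : TwoCategory C₀ C₁ C₂} {n : ℕ} (u : LaxFunctor (ordinal n) C)

open Classical in
/-- The edges of `u : [n] ⇢ C`, with junk values at other indices. -/
noncomputable def edg (i j : Fin (n + 1)) : C₁ :=
  if h : i ≤ j then u.edge i j h else C.one (u.vertex i)

open Classical in
/-- The triangles of `u : [n] ⇢ C`, with junk values at other indices. -/
noncomputable def tri (i j k : Fin (n + 1)) : C₂ :=
  if h : i ≤ j ∧ j ≤ k then u.triangle i j k h.1 h.2 else C.one₂ (C.one (u.vertex i))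

theorem edg_eq {i j : Fin (n + 1)} (h : i ≤ j) : u.edg i j = u.edge i j h := dif_pos h

theorem tri_eq {i j k : Fin (n + 1)} (hij : i ≤ j) (hjk : j ≤ k) :
    u.tri i j k = u.triangle i j k hij hjk := dif_pos ⟨hij, hjk⟩

theorem isLaxData : IsLaxData C (· ≤ ·) u.vertex u.edg u.tri := by
  refine ⟨id, fun _ _ h _ => h, ?_, ?_, ?_, ?_, ?_, ?_⟩
  · intro i j h
    rw [u.edg_eq h]
    exact u.arrow_edge i j h
  · intro i h
    rw [u.edg_eq h]
    exact u.edge_self i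
  · intro i j k hij hjk h
    rw [u.edg_eq hij, u.edg_eq hjk, u.edg_eq h, u.tri_eq hij hjk]
    exact u.cell_triangle i j k hij hjk
  · intro i k h
    rw [u.edg_eq h, u.tri_eq le_rfl h]
    exact u.triangle_left i k h
  · intro i k h
    rw [u.edg_eq h, u.tri_eq h le_rfl]
    exact u.triangle_right i k h
  · intro i j k l hij hjk hkl h
    rw [u.edg_eq hij, u.edg_eq hkl, u.tri_eq hjk hkl, u.tri_eq hij hjk,
      u.tri_eq hij (hjk.trans hkl), u.tri_eq (hij.trans hjk) hkl]
    exact u.coherent i j k l hij hjk hkl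

end LaxFunctor

namespace PartialNerve

open TwoCategory

variable {C₀ C₁ C₂ : Type u} {C : TwoCategory C₀ C₁ C₂} {n : ℕ}

/-- Among the edges, `F_k Δ^{n+1}` differs from `F_{k+1} Δ^{n+1}` by `(k, n+1)` only. -/
theorem isStep (k : Fin n) : IsLaxData.IsStep (IsEdge k.succ) (IsEdge k.castSucc)
    k.castSucc.castSucc k.succ.castSucc (Fin.last (n + 1)) := by
  have hk : k.castSucc.castSucc < k.succ.castSucc := by simp [Fin.lt_def]
  have hk' : k.succ.castSucc < Fin.last (n + 1) := Fin.castSucc_lt_last _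
  refine ⟨hk, hk', Fin.le_last, ?_, ?_, ?_, ?_, ?_⟩
  · intro j hj
    simp only [Fin.lt_def, Fin.le_def, Fin.val_castSucc, Fin.val_succ] at hj ⊢
    omega
  · intro i j
    simp only [IsEdge, Fin.lt_def, Fin.le_def, Fin.ext_iff, Fin.val_castSucc, Fin.val_succ,
      Fin.val_last]
    omega
  · intro j hj hjN
    exact ⟨hj, Or.inl hjN⟩
  · exact ⟨hk'.le, Or.inr le_rfl⟩
  · rintro ⟨-, h | h⟩
    · exact lt_irrefl _ h
    · exact absurd hk (not_lt.2 h)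

theorem restrict_edg (k : Fin n) (u : PartialNerve C n k.castSucc) {i j : Fin (n + 2)}
    (h : IsEdge k.succ i j) : (restrict k u).edg i j = u.edg i j := by
  rw [edg_eq _ h, edg_eq u ((isStep k).iff.2 (Or.inl h))]
  rfl

theorem restrict_tri (k : Fin n) (u : PartialNerve C n k.castSucc) {i j l : Fin (n + 2)}
    (hij : i ≤ j) (hjl : j ≤ l) (h : IsEdge k.succ i l) :
    (restrict k u).tri i j l = u.tri i j l := by
  rw [tri_eq _ hij hjl h, tri_eq u hij hjl ((isStep k).iff.2 (Or.inl h))]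
  rfl

theorem newTriangle_eq (k : Fin n) (u : PartialNerve C n k.castSucc) :
    newTriangle k u = u.tri k.castSucc.castSucc k.succ.castSucc (Fin.last (n + 1)) :=
  (tri_eq u (isStep k).lt.le (isStep k).lt_max.le ((isStep k).iff.2 (Or.inr ⟨rfl, rfl⟩))).symm

theorem newComposite_eq (k : Fin n) (v : PartialNerve C n k.succ) :
    newComposite k v = C.cc (v.edg k.succ.castSucc (Fin.last (n + 1)))
      (v.edg k.castSucc.castSucc k.succ.castSucc) := by
  rw [newComposite, C.comp_eq_cc, edg_eq v (isStep k).edge_right,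
    edg_eq v ((isStep k).edge_left (isStep k).lt.le (isStep k).lt_max)]

/-- The triangles of `u : F_k Δ^{n+1} → NC` in terms of `u_{n+1,k+1,k}` and the restriction of `u`
to `F_{k+1} Δ^{n+1}`. -/
theorem tri_eq_fillTri {inv : C₂ → C₂} (hi : C.IsInverse inv) (k : Fin n)
    (u : PartialNerve C n k.castSucc) {i j l : Fin (n + 2)} (hij : i ≤ j) (hjl : j ≤ l)
    (hil : IsEdge k.castSucc i l) :
    u.tri i j l = IsLaxData.fillTri C inv (restrict k u).edg (restrict k u).tri (newTriangle k u)
      k.castSucc.castSucc k.succ.castSucc (Fin.last (n + 1)) i j l := by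
  have s := isStep k
  rw [u.isLaxData.triangle_eq_fillTri hi s hij hjl hil, newTriangle_eq, IsLaxData.fillTri,
    IsLaxData.fillTri]
  split_ifs with h1 h2
  · rfl
  · obtain ⟨rfl, rfl⟩ := h1
    have hj := lt_of_le_of_ne hij fun e => h2 (Or.inl e.symm)
    have hjN := lt_of_le_of_ne hjl fun e => h2 (Or.inr e)
    have hk'j := s.succ_le hj
    have h3 : IsEdge k.succ j (Fin.last (n + 1)) := s.edge_right.mono hk'j hjl le_rfl
    rw [restrict_edg k u h3, restrict_tri k u s.lt.le hk'j (s.edge_left hij hjN),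
      restrict_tri k u hk'j hjl s.edge_right, restrict_edg k u (s.edge_left s.lt.le s.lt_max)]
  · refine (restrict_tri k u hij hjl ?_).symm
    exact (s.iff.1 hil).resolve_right h1

theorem injective_restrict_newTriangle {inv : C₂ → C₂} (hi : C.IsInverse inv) (k : Fin n) :
    Function.Injective fun u : PartialNerve C n k.castSucc => (restrict k u, newTriangle k u) := by
  intro u u' h
  obtain ⟨h1, h2⟩ := Prod.ext_iff.1 h
  simp only at h1 h2
  refine ext_triangle fun i j l hij hjl hil => ?_
  have hil' : IsEdge k.castSucc i l := ⟨hij.trans hjl, hil⟩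
  rw [← tri_eq u hij hjl hil', ← tri_eq u' hij hjl hil', tri_eq_fillTri hi k u hij hjl hil',
    tri_eq_fillTri hi k u' hij hjl hil', h1, h2]

/-- The set `N^k_{n+1} C` is the fibre product of `N^{k+1}_{n+1} C` and `C₂` over `C₁`. -/
theorem range_restrict_newTriangle {inv : C₂ → C₂} (hi : C.IsInverse inv) (k : Fin n) :
    range (fun u : PartialNerve C n k.castSucc => (restrict k u, newTriangle k u)) =
      {z | newComposite k z.1 = C.tgt₂ z.2} := by
  have s := isStep k
  have hkN : IsEdge k.castSucc k.castSucc.castSucc (Fin.last (n + 1)) :=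
    s.iff.2 (Or.inr ⟨rfl, rfl⟩)
  apply Subset.antisymm
  · rintro _ ⟨u, rfl⟩
    simp only [mem_ofPred_eq]
    rw [newComposite_eq, newTriangle_eq, restrict_edg k u s.edge_right,
      restrict_edg k u (s.edge_left s.lt.le s.lt_max)]
    exact (u.isLaxData.cell s.lt.le s.lt_max.le hkN).tgt₂.symm
  · rintro ⟨v, α⟩ h
    have hα : C.tgt₂ α = C.cc (v.edg k.succ.castSucc (Fin.last (n + 1)))
      (v.edg k.castSucc.castSucc k.succ.castSucc) := (newComposite_eq k v) ▸ h.symm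
    have hd := v.isLaxData.fill hi s IsEdge.mono hα
    refine ⟨ofLaxData hd, Prod.ext ?_ ?_⟩
    · refine ext_triangle fun i j l hij hjl hil => ?_
      have hil' : IsEdge k.succ i l := ⟨hij.trans hjl, hil⟩
      change IsLaxData.fillTri C inv v.edg v.tri α _ _ _ i j l = _
      rw [IsLaxData.fillTri, if_neg, tri_eq v hij hjl hil']
      rintro ⟨rfl, rfl⟩
      exact s.not_edge hil'
    · exact v.isLaxData.fillTri_new hi s hα

theorem eval_tri {k : Fin (n + 1)} (u : PartialNerve C n k) {m : SimplexCategory}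
    (a : m ⟶ ⦋n + 1⦌) (ha : InFiltration k a) (i j l : Fin (m.len + 1)) (hij : i ≤ j)
    (hjl : j ≤ l) : (u.eval a ha).triangle i j l hij hjl =
      u.tri (a.toOrderHom i) (a.toOrderHom j) (a.toOrderHom l) := by
  have hil : IsEdge k (a.toOrderHom i) (a.toOrderHom l) :=
    ⟨a.toOrderHom.monotone (hij.trans hjl), ha.imp
      (fun h => (a.toOrderHom.monotone (Fin.le_last _)).trans_lt h)
      (fun h => h.trans (a.toOrderHom.monotone (Fin.zero_le _)))⟩
  rw [u.eval_triangle a ha i j l hij hjl hil.2, tri_eq u _ _ hil]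

theorem toFace_triangle {k : Fin (n + 1)} (u : PartialNerve C n k) (i j l : Fin (n + 1)) (hij hjl) :
    u.toFace.triangle i j l hij hjl = u.tri i.castSucc j.castSucc l.castSucc := by
  have e : ∀ i, (SimplexCategory.δ (Fin.last (n + 1))).toOrderHom i = i.castSucc := fun i =>
    Fin.succAbove_last_apply i
  refine (u.eval_tri (SimplexCategory.δ (Fin.last (n + 1))) _ i j l hij hjl).trans ?_
  rw [e, e, e]

theorem isEdge_castSucc {k : Fin (n + 1)} {i j : Fin (n + 1)} (h : i ≤ j) :
    IsEdge k i.castSucc j.castSucc :=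
  ⟨Fin.castSucc_le_castSucc_iff.2 h, Or.inl (Fin.castSucc_lt_last j)⟩

theorem isEdge_lastEdge :
    IsEdge (Fin.last n) (Fin.last n).castSucc (Fin.last (n + 1)) :=
  ⟨Fin.le_last _, Or.inr le_rfl⟩

theorem lastEdge_eq (u : PartialNerve C n (Fin.last n)) :
    u.lastEdge = u.edg (Fin.last n).castSucc (Fin.last (n + 1)) :=
  (edg_eq u isEdge_lastEdge).symm

theorem vertex_toFace {k : Fin (n + 1)} (u : PartialNerve C n k) (i : Fin (n + 1)) :
    u.toFace.vertex i = u.vtx i.castSucc := by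
  have h := u.isLaxData
  have h1 := toFace_triangle u i i i le_rfl le_rfl
  rw [h.triangle_left (isEdge_self _), h.edge_self (isEdge_self _)] at h1
  have h2 := congrArg (fun α => C.src (C.src₂ α))
    ((((LaxFunctor.triangle_left u.toFace i i le_rfl).trans
      (congrArg C.one₂ (LaxFunctor.edge_self u.toFace i))).symm).trans h1)
  simpa only [C.src₂_one₂, C.src_one] using h2

/-- An edge of `F_n Δ^{n+1}` that contains the last vertex. -/
theorem IsEdge.eq_of_last {i : Fin (n + 2)} (h : IsEdge (Fin.last n) i (Fin.last (n + 1))) :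
    i = (Fin.last n).castSucc ∨ i = Fin.last (n + 1) := by
  rcases h.2 with h | h
  · exact absurd h (lt_irrefl _)
  · simp only [Fin.le_def, Fin.ext_iff, Fin.val_castSucc, Fin.val_last] at h ⊢
    have := i.isLt
    omega

theorem IsEdge.eq_or_eq {i j : Fin (n + 2)} (h : IsEdge (Fin.last n) i (Fin.last (n + 1)))
    (hij : i ≤ j) : j = i ∨ j = Fin.last (n + 1) := by
  rcases h.eq_of_last with rfl | rfl
  · exact (h.mono hij (Fin.le_last _) le_rfl).eq_of_last
  · exact Or.inl (le_antisymm (Fin.le_last _) hij)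

theorem injective_toFace_lastEdge :
    Function.Injective fun u : PartialNerve C n (Fin.last n) => (u.toFace, u.lastEdge) := by
  intro u u' h
  obtain ⟨h1, h2⟩ := Prod.ext_iff.1 h
  simp only at h1 h2
  have hu := u.isLaxData
  have hu' := u'.isLaxData
  have he : ∀ i, IsEdge (Fin.last n) i (Fin.last (n + 1)) →
      u.edg i (Fin.last (n + 1)) = u'.edg i (Fin.last (n + 1)) := by
    intro i hi
    rw [lastEdge_eq, lastEdge_eq] at h2
    rcases hi.eq_of_last with rfl | rfl
    · exact h2
    · rw [hu.edge_self hi, hu'.edge_self hi, ← (hu.arrow isEdge_lastEdge).tgt, h2,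
        (hu'.arrow isEdge_lastEdge).tgt]
  refine ext_triangle fun i j l hij hjl hil => ?_
  have hil' : IsEdge (Fin.last n) i l := ⟨hij.trans hjl, hil⟩
  rw [← tri_eq u hij hjl hil', ← tri_eq u' hij hjl hil']
  rcases Fin.eq_castSucc_or_eq_last l with ⟨l, rfl⟩ | rfl
  · obtain ⟨j, rfl⟩ := Fin.exists_castSucc_eq.2 (hjl.trans_lt (Fin.castSucc_lt_last l)).ne
    obtain ⟨i, rfl⟩ := Fin.exists_castSucc_eq.2 (hij.trans_lt (Fin.castSucc_lt_last j)).ne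
    rw [← toFace_triangle u i j l (Fin.castSucc_le_castSucc_iff.1 hij)
      (Fin.castSucc_le_castSucc_iff.1 hjl), h1, toFace_triangle]
  · rcases hil'.eq_or_eq hij with rfl | rfl
    · rw [hu.triangle_left hil', hu'.triangle_left hil', he _ hil']
    · rw [hu.triangle_right hil', hu'.triangle_right hil', he _ hil']

/-- The set `N^n_{n+1} C` is the fibre product of `N_n C` and `C₁` over `C₀`. -/
theorem range_toFace_lastEdge :
    range (fun u : PartialNerve C n (Fin.last n) => (u.toFace, u.lastEdge)) =
      {z | LaxFunctor.vertex z.1 (Fin.last n) = C.src z.2} := by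
  apply Subset.antisymm
  · rintro _ ⟨u, rfl⟩
    simp only [mem_ofPred_eq]
    rw [lastEdge_eq, (u.isLaxData.arrow isEdge_lastEdge).src]
    exact vertex_toFace u _
  rintro ⟨w, f⟩ hwf
  replace hwf : w.vertex (Fin.last n) = C.src f := hwf
  have h := w.isLaxData
  -- Every vertex other than the last one is a vertex of the face. All edges and triangles that
  -- contain the last vertex are degenerate, except for the edge `f` from the preceding vertex.
  let x : Fin (n + 2) → C₀ := Fin.snoc (α := fun _ => C₀) w.vertex (C.tgt f)
  let e : Fin (n + 2) → Fin (n + 2) → C₁ := fun i =>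
    Fin.snoc (α := fun _ => C₁)
      (Fin.snoc (α := fun _ => Fin (n + 1) → C₁) w.edg (fun _ => f) i)
      (if i = Fin.last (n + 1) then C.one (C.tgt f) else f)
  let t : Fin (n + 2) → Fin (n + 2) → Fin (n + 2) → C₂ := fun i j =>
    Fin.snoc (α := fun _ => C₂)
      (Fin.snoc (α := fun _ => Fin (n + 1) → C₂)
        (Fin.snoc (α := fun _ => Fin (n + 1) → Fin (n + 1) → C₂) w.tri
          (fun _ _ => C.one₂ f) i) (fun _ => C.one₂ f) j)
      (C.one₂ (e i (Fin.last (n + 1))))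
  have hx : ∀ i : Fin (n + 1), x i.castSucc = w.vertex i := fun i => by
    simp only [x, Fin.snoc_castSucc]
  have hxN : x (Fin.last (n + 1)) = C.tgt f := by simp only [x, Fin.snoc_last]
  have he : ∀ i j : Fin (n + 1), e i.castSucc j.castSucc = w.edg i j := fun i j => by
    simp only [e, Fin.snoc_castSucc]
  have heN : ∀ i : Fin (n + 1), e i.castSucc (Fin.last (n + 1)) = f := fun i => by
    simp only [e, Fin.snoc_last]
    exact if_neg (Fin.castSucc_lt_last i).ne
  have heNN : e (Fin.last (n + 1)) (Fin.last (n + 1)) = C.one (C.tgt f) := by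
    simp only [e, Fin.snoc_last, if_true]
  have ht : ∀ i j l : Fin (n + 1), t i.castSucc j.castSucc l.castSucc = w.tri i j l :=
    fun i j l => by simp only [t, Fin.snoc_castSucc]
  have htN : ∀ i j, t i j (Fin.last (n + 1)) = C.one₂ (e i (Fin.last (n + 1))) :=
    fun i j => by simp only [t, Fin.snoc_last]
  have hlt : ∀ {i : Fin (n + 2)} {j : Fin (n + 1)}, i ≤ j.castSucc →
      ∃ i', i' ≤ j ∧ i'.castSucc = i := fun {i j} hij => by
    obtain ⟨i', rfl⟩ := Fin.exists_castSucc_eq.2 (hij.trans_lt (Fin.castSucc_lt_last j)).ne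
    exact ⟨i', Fin.castSucc_le_castSucc_iff.1 hij, rfl⟩
  have arrow' : ∀ {i j}, IsEdge (Fin.last n) i j → C.Arrow (e i j) (x i) (x j) := by
    intro i j hij
    rcases Fin.eq_castSucc_or_eq_last j with ⟨j, rfl⟩ | rfl
    · obtain ⟨i, hij', rfl⟩ := hlt hij.1
      rw [he, hx, hx]
      exact h.arrow hij'
    · rcases hij.eq_of_last with rfl | rfl
      · rw [heN, hx, hxN, hwf]
        exact ⟨rfl, rfl⟩
      · rw [heNN, hxN]
        exact Arrow.one _
  have self' : ∀ {i}, IsEdge (Fin.last n) i i → e i i = C.one (x i) := by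
    intro i _
    rcases Fin.eq_castSucc_or_eq_last i with ⟨i, rfl⟩ | rfl
    · rw [he, hx]
      exact h.edge_self le_rfl
    · rw [heNN, hxN]
  have left' : ∀ {i l}, IsEdge (Fin.last n) i l → t i i l = C.one₂ (e i l) := by
    intro i l hil
    rcases Fin.eq_castSucc_or_eq_last l with ⟨l, rfl⟩ | rfl
    · obtain ⟨i, hil', rfl⟩ := hlt hil.1
      rw [he, ht]
      exact h.triangle_left hil'
    · exact htN _ _
  have right' : ∀ {i l}, IsEdge (Fin.last n) i l → t i l l = C.one₂ (e i l) := by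
    intro i l hil
    rcases Fin.eq_castSucc_or_eq_last l with ⟨l, rfl⟩ | rfl
    · obtain ⟨i, hil', rfl⟩ := hlt hil.1
      rw [he, ht]
      exact h.triangle_right hil'
    · exact htN _ _
  have cell' : ∀ {i j l}, i ≤ j → j ≤ l → IsEdge (Fin.last n) i l →
      C.Cell (t i j l) (e i l) (C.cc (e j l) (e i j)) := by
    intro i j l hij hjl hil
    rcases Fin.eq_castSucc_or_eq_last l with ⟨l, rfl⟩ | rfl
    · obtain ⟨j, hjl', rfl⟩ := hlt hjl
      obtain ⟨i, hij', rfl⟩ := hlt hij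
      rw [ht, he, he, he]
      exact h.cell hij' hjl' (hij'.trans hjl')
    · rw [htN]
      rcases hil.eq_or_eq hij with rfl | rfl
      · rw [self' (isEdge_self _), cc_one (arrow' hil)]
        exact Cell.one _
      · rw [self' (isEdge_self _), one_cc (arrow' hil)]
        exact Cell.one _
  have hd : IsLaxData C (IsEdge (Fin.last n)) x e t := by
    refine ⟨fun h => h.1, IsEdge.mono, arrow', self', cell', left', right', ?_⟩
    intro i p q l hip hpq hql hil
    rcases Fin.eq_castSucc_or_eq_last l with ⟨l, rfl⟩ | rfl
    · obtain ⟨q, hql', rfl⟩ := hlt hql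
      obtain ⟨p, hpq', rfl⟩ := hlt hpq
      obtain ⟨i, hip', rfl⟩ := hlt hip
      rw [ht, ht, ht, ht, he, he]
      exact h.coherent hip' hpq' hql' (hip'.trans (hpq'.trans hql'))
    · rcases hil.eq_or_eq hip with rfl | rfl
      · rw [left' hil, left' (hil.mono le_rfl hpq hql), self' (isEdge_self _)]
        exact coherent_left (arrow' (hil.mono le_rfl hpq hql)) (arrow' (hil.mono hpq hql le_rfl))
          (arrow' hil) (cell' hpq hql hil)
      · obtain rfl := le_antisymm hql hpq
        rw [right' hil, right' (isEdge_self _)]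
  refine ⟨ofLaxData hd, Prod.ext ?_ (heN _)⟩
  refine LaxFunctor.ext_triangle fun i j l hij hjl => ?_
  refine (toFace_triangle _ i j l hij hjl).trans ?_
  rw [tri_eq _ (Fin.castSucc_le_castSucc_iff.2 hij) (Fin.castSucc_le_castSucc_iff.2 hjl)
    (isEdge_castSucc (hij.trans hjl)), ofLaxData_triangle, ht, w.tri_eq hij hjl]

theorem ofSimplex_triangle (k : Fin (n + 1)) (u : (nerve C).obj (op ⦋n + 1⦌))
    (i j l : Fin (n + 2)) (hij hjl hil) :
    (ofSimplex k u).triangle i j l hij hjl hil = LaxFunctor.triangle u i j l hij hjl := rfl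

theorem bijective_ofSimplex_zero :
    Function.Bijective (ofSimplex 0 : (nerve C).obj (op ⦋n + 1⦌) → PartialNerve C n 0) := by
  constructor
  · intro u u' h
    refine LaxFunctor.ext_triangle fun i j l hij hjl => ?_
    have hil : l < Fin.last (n + 1) ∨ (0 : Fin (n + 1)).castSucc ≤ i := Or.inr (Fin.zero_le _)
    rw [← ofSimplex_triangle 0 u i j l hij hjl hil, h, ofSimplex_triangle]
  · intro v
    refine ⟨v.isLaxData.toLaxFunctor OrderHom.id ⟨Fin.zero_le _, Or.inr le_rfl⟩, ?_⟩
    refine ext_triangle fun i j l hij hjl hil => ?_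
    exact tri_eq v hij hjl ⟨hij.trans hjl, hil⟩

end PartialNerve

/-! ### Closed embeddings -/

section Closed

variable {E H M E' H' M' E'' H'' M'' F G N : Type*}
  [NormedAddCommGroup E] [NormedSpace ℝ E] [TopologicalSpace H] [TopologicalSpace M]
  [ChartedSpace H M] {I : ModelWithCorners ℝ E H}
  [NormedAddCommGroup E'] [NormedSpace ℝ E'] [TopologicalSpace H'] [TopologicalSpace M']
  [ChartedSpace H' M'] {I' : ModelWithCorners ℝ E' H'}
  [NormedAddCommGroup E''] [NormedSpace ℝ E''] [TopologicalSpace H''] [TopologicalSpace M'']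
  [ChartedSpace H'' M''] {I'' : ModelWithCorners ℝ E'' H''}
  [NormedAddCommGroup F] [NormedSpace ℝ F] [TopologicalSpace G] [TopologicalSpace N]
  [ChartedSpace G N] {J : ModelWithCorners ℝ F G}

/-- A closed embedding with local smooth retractions. -/
structure IsClosedRetractEmbedding (I : ModelWithCorners ℝ E H) (J : ModelWithCorners ℝ F G)
    (f : M → N) : Prop extends IsRetractEmbedding I J f where
  isClosed_range : IsClosed (range f)

namespace IsClosedRetractEmbedding

theorem isClosedEmbedding {f : M → N} (hf : IsClosedRetractEmbedding I J f) :
    IsClosedEmbedding f :=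
  ⟨hf.isEmbedding, hf.isClosed_range⟩

protected theorem id : IsClosedRetractEmbedding I I (id : M → M) :=
  ⟨.id, by rw [range_id]; exact isClosed_univ⟩

theorem comp {g : M' → M''} {f : M → M'} (hg : IsClosedRetractEmbedding I' I'' g)
    (hf : IsClosedRetractEmbedding I I' f) : IsClosedRetractEmbedding I I'' (g ∘ f) :=
  ⟨hg.toIsRetractEmbedding.comp hf.toIsRetractEmbedding,
    (hg.isClosedEmbedding.comp hf.isClosedEmbedding).isClosed_range⟩

theorem of_comp [T2Space M'] {g : M' → M''} {f : M → M'} (hg : ContMDiff I' I'' ∞ g)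
    (hf : ContMDiff I I' ∞ f) (hgf : IsClosedRetractEmbedding I I'' (g ∘ f)) :
    IsClosedRetractEmbedding I I' f :=
  ⟨.of_comp hg hf hgf.toIsRetractEmbedding,
    (isProperMap_of_comp_of_t2 hf.continuous hg.continuous
      hgf.isClosedEmbedding.isProperMap).isClosedMap.isClosed_range⟩

theorem prodMap {f : M → N} {f' : M' → M''} (hf : IsClosedRetractEmbedding I J f)
    (hf' : IsClosedRetractEmbedding I' I'' f') :
    IsClosedRetractEmbedding (I.prod I') (J.prod I'') (Prod.map f f') :=
  ⟨hf.toIsRetractEmbedding.prodMap hf'.toIsRetractEmbedding, by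
    rw [range_prodMap]
    exact hf.isClosed_range.prod hf'.isClosed_range⟩

end IsClosedRetractEmbedding

end Closed

section Transfer

variable {E H N : Type*} [NormedAddCommGroup E] [NormedSpace ℝ E] [TopologicalSpace H]
  [TopologicalSpace N] [ChartedSpace H N] {J : ModelWithCorners ℝ E H}
  {E' H' M : Type*} [NormedAddCommGroup E'] [NormedSpace ℝ E'] [TopologicalSpace H']
  [TopologicalSpace M] [ChartedSpace H' M] {I : ModelWithCorners ℝ E' H'}

/-- A bijection onto a manifold transports the manifold structure. -/
theorem exists_smoothManifold_of_bijective {P Q : Type u} [SmoothManifold Q] {f : P → Q}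
    (hf : Function.Bijective f) :
    ∃ _ : SmoothManifold P, IsClosedRetractEmbedding (model P) (model Q) f := by
  obtain ⟨S, hS⟩ := exists_smoothManifold_of_hasSliceAt (J := model Q) (d := SmoothManifold.dim Q)
    hf.injective fun p => by
      let c := chartAt (EuclideanSpace ℝ (Fin (SmoothManifold.dim Q))) (f p)
      exact ⟨c.source, c, c.target, c.symm, c.open_source, mem_chart_source _ _,
        contMDiffOn_chart, c.open_target, contMDiffOn_chart_symm,
        fun w hw => ⟨c.map_target hw, hf.surjective _, c.right_inv hw⟩,
        fun q hq => ⟨c.map_source hq, c.left_inv hq⟩⟩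
  exact ⟨S, hS, by rw [hf.surjective.range_eq]; exact isClosed_univ⟩

/-- Two manifolds that are embedded with the same image are diffeomorphic, so that an embedding of
the one is an embedding of the other. In particular, a set has at most one manifold structure for
which a given map is an embedding. -/
theorem isRetractEmbedding_comp_of_comp_eq {P P' : Type u} [SmoothManifold P] [SmoothManifold P']
    {f : P → N} {f' : P' → N} (h : IsRetractEmbedding (model P) J f)
    (h' : IsRetractEmbedding (model P') J f') {e : P → P'} {e' : P' → P} (he : f' ∘ e = f)
    (he' : f ∘ e' = f') (hee' : Function.LeftInverse e' e) {g : P' → M}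
    (hg : IsRetractEmbedding (model P') I g) : IsRetractEmbedding (model P) I (g ∘ e) :=
  hg.comp (.of_leftInverse (h'.contMDiff_of_comp (he ▸ h.contMDiff))
    (h.contMDiff_of_comp (he' ▸ h'.contMDiff)) hee')

theorem isDiffeo_of_bijective {P Q : Type u} [SmoothManifold P] [SmoothManifold Q] {f : P → Q}
    (hf : Smooth f) (hb : Function.Bijective f)
    (hg : ∀ g : Q → P, Function.RightInverse g f → Smooth g) : IsDiffeo f :=
  ⟨{ toEquiv := Equiv.ofBijective f hb
     contMDiff_toFun := hf
     contMDiff_invFun := hg _ (Equiv.ofBijective f hb).right_inv }, rfl⟩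

end Transfer

/-! ### Smoothness of compositions -/

section Smooth

variable {E H M : Type*} [NormedAddCommGroup E] [NormedSpace ℝ E] [TopologicalSpace H]
  [TopologicalSpace M] [ChartedSpace H M] {I : ModelWithCorners ℝ E H}

theorem SmoothOnSubset.comp_contMDiff {X Y Z : Type u} [SmoothManifold X] [SmoothManifold Y]
    [SmoothManifold Z] {S : Set (X × Y)} {F : S → Z} (hF : SmoothOnSubset F) {f : M → X × Y}
    (hf : ContMDiff I ((model X).prod (model Y)) ∞ f) (hS : ∀ m, f m ∈ S) :
    ContMDiff I (model Z) ∞ fun m => F ⟨f m, hS m⟩ := by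
  intro m
  obtain ⟨U, hU, hmU, F', hF', h⟩ := hF ⟨f m, hS m⟩
  refine ((hF'.contMDiffAt (hU.mem_nhds hmU)).comp m (hf m)).congr_of_eventuallyEq ?_
  filter_upwards [hf.continuous.continuousAt.preimage_mem_nhds (hU.mem_nhds hmU)] with y hy
  exact (h ⟨f y, hS y⟩ hy).symm

variable {C₀ C₁ C₂ : Type u} [SmoothManifold C₀] [SmoothManifold C₁] [SmoothManifold C₂]
  {C : TwoCategory C₀ C₁ C₂}

namespace TwoCategory

theorem IsLie.contMDiff_src (hC : C.IsLie) : ContMDiff (model C₁) (model C₀) ∞ C.src :=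
  hC.src.2.contMDiff

theorem IsLie.contMDiff_tgt (hC : C.IsLie) : ContMDiff (model C₁) (model C₀) ∞ C.tgt :=
  hC.tgt.2.contMDiff

theorem IsLie.contMDiff_src₂ (hC : C.IsLie) : ContMDiff (model C₂) (model C₁) ∞ C.src₂ :=
  hC.src₂.2.contMDiff

theorem IsLie.contMDiff_tgt₂ (hC : C.IsLie) : ContMDiff (model C₂) (model C₁) ∞ C.tgt₂ :=
  hC.tgt₂.2.contMDiff

theorem IsLie.contMDiff_cc (hC : C.IsLie) {g f : M → C₁} (hg : ContMDiff I (model C₁) ∞ g)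
    (hf : ContMDiff I (model C₁) ∞ f) (h : ∀ m, C.src (g m) = C.tgt (f m)) :
    ContMDiff I (model C₁) ∞ fun m => C.cc (g m) (f m) := by
  simp only [← comp_eq_cc _ _ _ (h _)]
  exact hC.comp.comp_contMDiff (hg.prodMk hf) h

theorem IsLie.contMDiff_vc (hC : C.IsLie) {β α : M → C₂} (hβ : ContMDiff I (model C₂) ∞ β)
    (hα : ContMDiff I (model C₂) ∞ α) (h : ∀ m, C.src₂ (β m) = C.tgt₂ (α m)) :
    ContMDiff I (model C₂) ∞ fun m => C.vc (β m) (α m) := by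
  simp only [← vcomp_eq_vc _ _ _ (h _)]
  exact hC.vcomp.comp_contMDiff (hβ.prodMk hα) h

theorem IsLie.contMDiff_hc (hC : C.IsLie) {β α : M → C₂} (hβ : ContMDiff I (model C₂) ∞ β)
    (hα : ContMDiff I (model C₂) ∞ α) (h : ∀ m, C.src (C.src₂ (β m)) = C.tgt (C.src₂ (α m))) :
    ContMDiff I (model C₂) ∞ fun m => C.hc (β m) (α m) := by
  simp only [← hcomp_eq_hc _ _ _ (h _)]
  exact hC.hcomp.comp_contMDiff (hβ.prodMk hα) h

omit [SmoothManifold C₀] [SmoothManifold C₁] in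
theorem SmoothlyInvertible.exists_isInverse (h : C.SmoothlyInvertible) :
    ∃ inv : C₂ → C₂, Smooth inv ∧ C.IsInverse inv := by
  obtain ⟨inv, hs, h⟩ := h
  refine ⟨inv, hs, ?_⟩
  rintro α _ _ ⟨rfl, rfl⟩
  obtain ⟨h1, h2, h3, h4⟩ := h α
  refine ⟨⟨h1, h2.symm⟩, ?_, ?_⟩
  · rw [← vcomp_eq_vc _ _ _ h1, h3]
  · rw [← vcomp_eq_vc _ _ _ h2, h4]

end TwoCategory

end Smooth

/-! ### Manifold structures on the nerve and the partial nerves -/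

section Structures

variable {C₀ C₁ C₂ : Type u} [SmoothManifold C₀] [SmoothManifold C₁] [SmoothManifold C₂]
  {C : TwoCategory C₀ C₁ C₂} {n : ℕ}
  {E H M : Type*} [NormedAddCommGroup E] [NormedSpace ℝ E] [TopologicalSpace H]
  [TopologicalSpace M] [ChartedSpace H M] {I : ModelWithCorners ℝ E H}

variable (C n) in
/-- The set `N_n C` is embedded in `A_n C` as a closed submanifold. -/
def IsNerveStructure [SmoothManifold ((nerve C).obj (op ⦋n⦌))] : Prop :=
  IsClosedRetractEmbedding (model ((nerve C).obj (op ⦋n⦌)))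
    (ModelWithCorners.pi fun _ : (⦋2⦌ ⟶ ⦋n⦌) => model C₂) (inclusionApp C (op ⦋n⦌))

namespace IsNerveStructure

variable [SmoothManifold ((nerve C).obj (op ⦋n⦌))] (h : IsNerveStructure C n)

include h

omit [SmoothManifold C₀] [SmoothManifold C₁] in
theorem contMDiff_triangle (i j l : Fin (n + 1)) (hij : i ≤ j) (hjl : j ≤ l) :
    ContMDiff (model ((nerve C).obj (op ⦋n⦌))) (model C₂) ∞
      fun u : (nerve C).obj (op ⦋n⦌) => LaxFunctor.triangle u i j l hij hjl :=
  (contMDiff_pi_apply (I := fun _ : (⦋2⦌ ⟶ ⦋n⦌) => model C₂)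
    (SimplexCategory.mkOfLeComp i j l hij hjl)).comp h.contMDiff

theorem contMDiff_edge (hC : C.IsLie) (i j : Fin (n + 1)) (hij : i ≤ j) :
    ContMDiff (model ((nerve C).obj (op ⦋n⦌))) (model C₁) ∞
      fun u : (nerve C).obj (op ⦋n⦌) => LaxFunctor.edge u i j hij := by
  refine (hC.contMDiff_src₂.comp (h.contMDiff_triangle i i j le_rfl hij)).congr fun u => ?_
  exact (LaxFunctor.cell_triangle u i i j le_rfl hij).src₂.symm

theorem contMDiff_vertex (hC : C.IsLie) (i : Fin (n + 1)) :
    ContMDiff (model ((nerve C).obj (op ⦋n⦌))) (model C₀) ∞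
      fun u : (nerve C).obj (op ⦋n⦌) => LaxFunctor.vertex u i := by
  refine (hC.contMDiff_src.comp (h.contMDiff_edge hC i i le_rfl)).congr fun u => ?_
  exact (LaxFunctor.arrow_edge u i i le_rfl).src.symm

omit [SmoothManifold C₀] [SmoothManifold C₁] in
theorem contMDiff_of_triangle {f : M → (nerve C).obj (op ⦋n⦌)}
    (hf : ∀ i j l hij hjl,
      ContMDiff I (model C₂) ∞ fun m => LaxFunctor.triangle (f m) i j l hij hjl) :
    ContMDiff I (model ((nerve C).obj (op ⦋n⦌))) ∞ f :=
  h.contMDiff_of_comp (contMDiff_pi fun _ => hf _ _ _ _ _)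

end IsNerveStructure

namespace PartialNerve

instance (k : Fin (n + 1)) (i j : Fin (n + 2)) : Decidable (IsEdge k i j) := by
  unfold IsEdge; infer_instance

/-- The triples of vertices of the 2-simplices of `F_k Δ^{n+1}`. -/
abbrev TriangleIndex (k : Fin (n + 1)) : Type :=
  {p : Fin (n + 2) × Fin (n + 2) × Fin (n + 2) //
    p.1 ≤ p.2.1 ∧ p.2.1 ≤ p.2.2 ∧ IsEdge k p.1 p.2.2}

/-- The family of all triangles of `u : F_k Δ^{n+1} → NC`. -/
noncomputable def inclusion (k : Fin (n + 1)) (u : PartialNerve C n k) : TriangleIndex k → C₂ :=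
  fun p => u.tri p.1.1 p.1.2.1 p.1.2.2

variable (C) in
/-- The set `N^k_{n+1} C` is embedded as a closed submanifold by the family of all triangles. -/
def IsStructure (k : Fin (n + 1)) [SmoothManifold (PartialNerve C n k)] : Prop :=
  IsClosedRetractEmbedding (model (PartialNerve C n k))
    (ModelWithCorners.pi fun _ : TriangleIndex k => model C₂) (inclusion (C := C) k)

namespace IsStructure

variable {k : Fin (n + 1)} [SmoothManifold (PartialNerve C n k)] (h : IsStructure C k)

include h

omit [SmoothManifold C₀] [SmoothManifold C₁] in
theorem contMDiff_tri {i j l : Fin (n + 2)} (hij : i ≤ j) (hjl : j ≤ l) (hil : IsEdge k i l) :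
    ContMDiff (model (PartialNerve C n k)) (model C₂) ∞
      fun u : PartialNerve C n k => u.tri i j l :=
  (contMDiff_pi_apply (I := fun _ : TriangleIndex k => model C₂)
    ⟨(i, j, l), hij, hjl, hil⟩).comp h.contMDiff

theorem contMDiff_edg (hC : C.IsLie) {i j : Fin (n + 2)} (hij : IsEdge k i j) :
    ContMDiff (model (PartialNerve C n k)) (model C₁) ∞
      fun u : PartialNerve C n k => u.edg i j := by
  refine (hC.contMDiff_src₂.comp (h.contMDiff_tri le_rfl hij.1 hij)).congr fun u => ?_
  exact (u.isLaxData.cell le_rfl hij.1 hij).src₂.symm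

omit [SmoothManifold C₀] [SmoothManifold C₁] in
theorem contMDiff_of_tri {f : M → PartialNerve C n k}
    (hf : ∀ {i j l}, i ≤ j → j ≤ l → IsEdge k i l →
      ContMDiff I (model C₂) ∞ fun m => (f m).tri i j l) :
    ContMDiff I (model (PartialNerve C n k)) ∞ f :=
  h.contMDiff_of_comp (contMDiff_pi fun p => hf p.2.1 p.2.2.1 p.2.2.2)

end IsStructure

theorem contMDiff_newComposite (hC : C.IsLie) (k : Fin n)
    [SmoothManifold (PartialNerve C n k.succ)] (h : IsStructure C k.succ) :
    Smooth (newComposite (C := C) k) := by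
  have s := isStep k
  have h1 := h.contMDiff_edg hC s.edge_right
  have h2 := h.contMDiff_edg hC (s.edge_left s.lt.le s.lt_max)
  refine (hC.contMDiff_cc h1 h2 fun u => ?_).congr fun u => newComposite_eq k u
  rw [(u.isLaxData.arrow s.edge_right).src,
    (u.isLaxData.arrow (s.edge_left s.lt.le s.lt_max)).tgt]

/-- The manifold `N^k_{n+1} C`, constructed as a fibre product. Its triangles are smooth functions of
the triangles of the restriction and of the new triangle, by the formula `fillTri`. -/
theorem exists_isStructure_castSucc (hC : C.IsLie) {inv : C₂ → C₂} (hs : Smooth inv)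
    (hi : C.IsInverse inv) (k : Fin n) [SmoothManifold (PartialNerve C n k.succ)]
    (h : IsStructure C k.succ) :
    ∃ _ : SmoothManifold (PartialNerve C n k.castSucc), IsStructure C k.castSucc ∧
      IsRetractEmbedding (model (PartialNerve C n k.castSucc))
        ((model (PartialNerve C n k.succ)).prod (model C₂))
        fun u : PartialNerve C n k.castSucc => (restrict k u, newTriangle k u) := by
  have s := isStep k
  have hf := contMDiff_newComposite hC k h
  obtain ⟨T, hT⟩ := exists_smoothManifold_fibreProduct hf hC.tgt₂.2
    (injective_restrict_newTriangle hi k) (range_restrict_newTriangle hi k)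
  refine ⟨T, ?_, hT⟩
  have hcl : IsClosedRetractEmbedding (model (PartialNerve C n k.castSucc))
      ((model (PartialNerve C n k.succ)).prod (model C₂))
      fun u : PartialNerve C n k.castSucc => (restrict k u, newTriangle k u) :=
    ⟨hT, by
      rw [range_restrict_newTriangle hi k]
      exact isClosed_eq (hf.continuous.comp continuous_fst)
        (hC.contMDiff_tgt₂.continuous.comp continuous_snd)⟩
  have hr : ContMDiff (model (PartialNerve C n k.castSucc)) (model (PartialNerve C n k.succ)) ∞
      (restrict (C := C) k) := contMDiff_fst.comp hT.contMDiff
  have hα : ContMDiff (model (PartialNerve C n k.castSucc)) (model C₂) ∞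
      (newTriangle (C := C) k) := contMDiff_snd.comp hT.contMDiff
  have htri : ∀ {i j l}, i ≤ j → j ≤ l → IsEdge k.succ i l →
      ContMDiff (model (PartialNerve C n k.castSucc)) (model C₂) ∞
        fun u : PartialNerve C n k.castSucc => (restrict k u).tri i j l :=
    fun hij hjl hil => (h.contMDiff_tri hij hjl hil).comp hr
  have hedg : ∀ {i j}, IsEdge k.succ i j →
      ContMDiff (model (PartialNerve C n k.castSucc)) (model C₁) ∞
        fun u : PartialNerve C n k.castSucc => (restrict k u).edg i j :=
    fun hij => (h.contMDiff_edg hC hij).comp hr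
  have hΦ : ContMDiff (model (PartialNerve C n k.castSucc))
      (ModelWithCorners.pi fun _ : TriangleIndex k.castSucc => model C₂) ∞
      (inclusion (C := C) k.castSucc) := by
    refine contMDiff_pi ?_
    rintro ⟨⟨i, j, l⟩, hij, hjl, hil⟩
    refine ContMDiff.congr ?_ fun u => tri_eq_fillTri hi k u hij hjl hil
    simp only at hij hjl hil
    unfold IsLaxData.fillTri
    split_ifs with h1 h2
    · exact hC.one₂.comp (hC.contMDiff_src₂.comp hα)
    · obtain ⟨rfl, rfl⟩ := h1
      have hj := lt_of_le_of_ne hij fun e => h2 (Or.inl e.symm)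
      have hjN := lt_of_le_of_ne hjl fun e => h2 (Or.inr e)
      have hk'j := s.succ_le hj
      have r01 : IsEdge k.succ _ _ := s.edge_left s.lt.le s.lt_max
      have r1N := s.edge_right
      have r0j := s.edge_left hij hjN
      have r1j := r1N.mono le_rfl hk'j hjl
      have rjN := r1N.mono hk'j hjl le_rfl
      -- the types of the 2-cells in `fillTri`, needed for their composability
      have c1 : ∀ u : PartialNerve C n k.castSucc, _ := fun u =>
        hi _ _ _ ((restrict k u).isLaxData.cell s.lt.le hk'j r0j)
      have c2 : ∀ u : PartialNerve C n k.castSucc, C.Cell (C.hc _ _) _ _ := fun u =>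
        ((restrict k u).isLaxData.cell hk'j hjl r1N).hc (TwoCategory.Cell.one _)
          ((restrict k u).isLaxData.arrow r1N) ((restrict k u).isLaxData.arrow r01)
      have c3 : ∀ u : PartialNerve C n k.castSucc, C.Cell (newTriangle k u)
          (C.src₂ (newTriangle k u)) _ := fun u =>
        ⟨rfl, by
          have := (range_restrict_newTriangle hi k).le ⟨u, rfl⟩
          exact this.symm.trans (newComposite_eq k _)⟩
      have c4 : ∀ u : PartialNerve C n k.castSucc, C.Cell (C.hc _ _) _ _ := fun u =>
        (TwoCategory.Cell.one ((restrict k u).edg j (Fin.last (n + 1)))).hc (c1 u).1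
          ((restrict k u).isLaxData.arrow rjN)
          (((restrict k u).isLaxData.arrow r1j).cc ((restrict k u).isLaxData.arrow r01))
      refine hC.contMDiff_vc (hC.contMDiff_hc (hC.one₂.comp (hedg rjN))
        (hs.comp (htri s.lt.le hk'j r0j)) fun u => ?_) (hC.contMDiff_vc
        (hC.contMDiff_hc (htri hk'j hjl r1N) (hC.one₂.comp (hedg r01)) fun u => ?_) hα fun u => ?_)
        fun u => ?_
      · change C.src (C.src₂ (C.one₂ ((restrict k u).edg j (Fin.last (n + 1))))) =
          C.tgt (C.src₂ (inv ((restrict k u).tri _ _ j)))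
        rw [C.src₂_one₂, (c1 u).1.src₂,
          ((restrict k u).isLaxData.arrow rjN).src,
          (((restrict k u).isLaxData.arrow r1j).cc ((restrict k u).isLaxData.arrow r01)).tgt]
      · change C.src (C.src₂ ((restrict k u).tri _ j _)) =
          C.tgt (C.src₂ (C.one₂ ((restrict k u).edg _ _)))
        rw [C.src₂_one₂,
          ((restrict k u).isLaxData.cell hk'j hjl r1N).src₂,
          ((restrict k u).isLaxData.arrow r1N).src, ((restrict k u).isLaxData.arrow r01).tgt]
      · exact (c2 u).src₂.trans (c3 u).tgt₂.symm
      · refine (c4 u).src₂.trans (((c2 u).vc (c3 u)).tgt₂.trans ?_).symm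
        exact (TwoCategory.cc_assoc ((restrict k u).isLaxData.arrow rjN)
          ((restrict k u).isLaxData.arrow r1j) ((restrict k u).isLaxData.arrow r01)).symm
    · exact htri hij hjl ((s.iff.1 hil).resolve_right h1)
  -- the triangles of the restriction and the new triangle are among all triangles
  let G : (TriangleIndex k.castSucc → C₂) → (TriangleIndex k.succ → C₂) × C₂ := fun z =>
    (fun p => z ⟨p.1, p.2.1, p.2.2.1, s.iff.2 (Or.inl p.2.2.2)⟩,
      z ⟨(_, _, _), s.lt.le, s.lt_max.le, s.iff.2 (Or.inr ⟨rfl, rfl⟩)⟩)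
  have hG : ContMDiff (ModelWithCorners.pi fun _ : TriangleIndex k.castSucc => model C₂)
      ((ModelWithCorners.pi fun _ : TriangleIndex k.succ => model C₂).prod (model C₂)) ∞ G :=
    (contMDiff_pi fun p => contMDiff_pi_apply (I := fun _ => model C₂) _).prodMk
      (contMDiff_pi_apply (I := fun _ => model C₂) _)
  refine .of_comp hG hΦ ?_
  have hGΦ : G ∘ inclusion k.castSucc = Prod.map (inclusion k.succ) id ∘
      fun u : PartialNerve C n k.castSucc => (restrict k u, newTriangle k u) := by
    funext u
    exact Prod.ext (funext fun p => (restrict_tri k u p.2.1 p.2.2.1 p.2.2.2).symm)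
      (newTriangle_eq k u).symm
  rw [hGΦ]
  exact (IsClosedRetractEmbedding.prodMap h .id).comp hcl

/-- The manifold `N^n_{n+1} C`, constructed as a fibre product. -/
theorem exists_isStructure_last (hC : C.IsLie) [SmoothManifold ((nerve C).obj (op ⦋n⦌))]
    (h : IsNerveStructure C n) :
    ∃ _ : SmoothManifold (PartialNerve C n (Fin.last n)), IsStructure C (Fin.last n) ∧
      IsRetractEmbedding (model (PartialNerve C n (Fin.last n)))
        ((model ((nerve C).obj (op ⦋n⦌))).prod (model C₁))
        fun u : PartialNerve C n (Fin.last n) => (u.toFace, u.lastEdge) := by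
  have hf : Smooth fun u : (nerve C).obj (op ⦋n⦌) => LaxFunctor.vertex u (Fin.last n) :=
    h.contMDiff_vertex hC (Fin.last n)
  obtain ⟨T, hT⟩ := exists_smoothManifold_fibreProduct hf hC.src.2
    (injective_toFace_lastEdge (C := C)) range_toFace_lastEdge
  refine ⟨T, ?_, hT⟩
  have hcl : IsClosedRetractEmbedding (model (PartialNerve C n (Fin.last n)))
      ((model ((nerve C).obj (op ⦋n⦌))).prod (model C₁))
      fun u : PartialNerve C n (Fin.last n) => (u.toFace, u.lastEdge) :=
    ⟨hT, by
      rw [range_toFace_lastEdge]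
      exact isClosed_eq (hf.continuous.comp continuous_fst)
        (hC.contMDiff_src.continuous.comp continuous_snd)⟩
  have hr : ContMDiff (model (PartialNerve C n (Fin.last n))) (model ((nerve C).obj (op ⦋n⦌))) ∞
      (toFace (C := C) (k := Fin.last n)) := contMDiff_fst.comp hT.contMDiff
  have hl : ContMDiff (model (PartialNerve C n (Fin.last n))) (model C₁) ∞
      (lastEdge (C := C) (n := n)) := contMDiff_snd.comp hT.contMDiff
  have hedg : ∀ {i}, IsEdge (Fin.last n) i (Fin.last (n + 1)) →
      ContMDiff (model (PartialNerve C n (Fin.last n))) (model C₁) ∞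
        fun u : PartialNerve C n (Fin.last n) => u.edg i (Fin.last (n + 1)) := by
    intro i hi
    rcases hi.eq_of_last with rfl | rfl
    · exact hl.congr fun u => (lastEdge_eq u).symm
    · refine (hC.one.comp (hC.contMDiff_tgt.comp hl)).congr fun u => ?_
      rw [u.isLaxData.edge_self hi, Function.comp_apply, Function.comp_apply, lastEdge_eq,
        (u.isLaxData.arrow isEdge_lastEdge).tgt]
  have hΦ : ContMDiff (model (PartialNerve C n (Fin.last n)))
      (ModelWithCorners.pi fun _ : TriangleIndex (Fin.last n) => model C₂) ∞
      (inclusion (C := C) (Fin.last n)) := by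
    refine contMDiff_pi ?_
    rintro ⟨⟨i, j, l⟩, hij, hjl, hil⟩
    simp only at hij hjl hil
    unfold inclusion
    rcases Fin.eq_castSucc_or_eq_last l with ⟨l, rfl⟩ | rfl
    · obtain ⟨j, rfl⟩ := Fin.exists_castSucc_eq.2 (hjl.trans_lt (Fin.castSucc_lt_last l)).ne
      obtain ⟨i, rfl⟩ := Fin.exists_castSucc_eq.2 (hij.trans_lt (Fin.castSucc_lt_last j)).ne
      exact ((h.contMDiff_triangle i j l (Fin.castSucc_le_castSucc_iff.1 hij)
        (Fin.castSucc_le_castSucc_iff.1 hjl)).comp hr).congr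
        fun u => (toFace_triangle u i j l _ _).symm
    · refine (hC.one₂.comp (hedg hil)).congr fun u => ?_
      rcases hil.eq_or_eq hij with rfl | rfl
      · exact u.isLaxData.triangle_left hil
      · exact u.isLaxData.triangle_right hil
  -- the triangles of the face and the last edge are smooth functions of all triangles
  let G : (TriangleIndex (Fin.last n) → C₂) → ((⦋2⦌ ⟶ ⦋n⦌) → C₂) × C₁ := fun z =>
    (fun a => z ⟨((a.toOrderHom 0).castSucc, (a.toOrderHom 1).castSucc, (a.toOrderHom 2).castSucc),
      Fin.castSucc_le_castSucc_iff.2 (a.toOrderHom.monotone (by decide)),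
      Fin.castSucc_le_castSucc_iff.2 (a.toOrderHom.monotone (by decide)),
      isEdge_castSucc (a.toOrderHom.monotone (by decide))⟩,
      C.src₂ (z ⟨(_, _, _), le_rfl, isEdge_lastEdge.1, isEdge_lastEdge⟩))
  have hG : ContMDiff (ModelWithCorners.pi fun _ : TriangleIndex (Fin.last n) => model C₂)
      ((ModelWithCorners.pi fun _ : (⦋2⦌ ⟶ ⦋n⦌) => model C₂).prod (model C₁)) ∞ G :=
    (contMDiff_pi fun p => contMDiff_pi_apply (I := fun _ => model C₂) _).prodMk
      (hC.contMDiff_src₂.comp (contMDiff_pi_apply (I := fun _ => model C₂) _))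
  refine .of_comp hG hΦ ?_
  have hGΦ : G ∘ inclusion (Fin.last n) = Prod.map (inclusionApp C (op ⦋n⦌)) id ∘
      fun u : PartialNerve C n (Fin.last n) => (u.toFace, u.lastEdge) := by
    funext u
    refine Prod.ext (funext fun a => (toFace_triangle u _ _ _ _ _).symm) ?_
    exact (u.isLaxData.cell le_rfl isEdge_lastEdge.1 isEdge_lastEdge).src₂.trans
      (lastEdge_eq u).symm
  rw [hGΦ]
  exact (IsClosedRetractEmbedding.prodMap h .id).comp hcl

end PartialNerve

open PartialNerve

omit [SmoothManifold C₀] [SmoothManifold C₁] in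
/-- The manifold structure of `N_{n+1} C` is transported from `N^0_{n+1} C`. This is an embedding in
`A_{n+1} C` because the 2-simplices of `Δ^{n+1}` are all in `F_0 Δ^{n+1}`. -/
theorem exists_isNerveStructure_succ [SmoothManifold (PartialNerve C n 0)]
    (h : IsStructure (C := C) (n := n) 0) :
    ∃ _ : SmoothManifold ((nerve C).obj (op ⦋n + 1⦌)), IsNerveStructure C (n + 1) := by
  obtain ⟨S, hS⟩ := exists_smoothManifold_of_bijective (bijective_ofSimplex_zero (C := C) (n := n))
  have hE : ∀ {i l : Fin (n + 2)}, i ≤ l → IsEdge (0 : Fin (n + 1)) i l := fun hil =>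
    ⟨hil, Or.inr (Fin.zero_le _)⟩
  refine ⟨S, ?_⟩
  let G : ((⦋2⦌ ⟶ ⦋n + 1⦌) → C₂) → (TriangleIndex (0 : Fin (n + 1)) → C₂) := fun z p =>
    z (SimplexCategory.mkOfLeComp p.1.1 p.1.2.1 p.1.2.2 p.2.1 p.2.2.1)
  have hG : ContMDiff (ModelWithCorners.pi fun _ : (⦋2⦌ ⟶ ⦋n + 1⦌) => model C₂)
      (ModelWithCorners.pi fun _ : TriangleIndex (0 : Fin (n + 1)) => model C₂) ∞ G :=
    contMDiff_pi fun p => contMDiff_pi_apply (I := fun _ => model C₂) _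
  have htri : ∀ (u : (nerve C).obj (op ⦋n + 1⦌)) (i j l : Fin (n + 2)) (hij : i ≤ j) (hjl : j ≤ l),
      LaxFunctor.triangle u i j l hij hjl = (ofSimplex 0 u).tri i j l := fun u i j l hij hjl =>
    (tri_eq (ofSimplex 0 u) hij hjl (hE (hij.trans hjl))).symm
  refine .of_comp hG (contMDiff_pi fun a => ?_) (?_ : IsClosedRetractEmbedding _ _ (G ∘ _))
  · have h1 : (a.toOrderHom 0) ≤ (a.toOrderHom 1) := a.toOrderHom.monotone (by decide)
    have h2 : (a.toOrderHom 1) ≤ (a.toOrderHom 2) := a.toOrderHom.monotone (by decide)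
    exact ((h.contMDiff_tri h1 h2 (hE (h1.trans h2))).comp hS.contMDiff).congr
      fun u => htri u _ _ _ _ _
  · have hGφ : G ∘ inclusionApp C (op ⦋n + 1⦌) = inclusion 0 ∘ ofSimplex 0 :=
      funext fun u => funext fun p => htri u _ _ _ p.2.1 p.2.2.1
    rw [hGφ]
    exact IsClosedRetractEmbedding.comp h hS

end Structures

section Existence

variable {C₀ C₁ C₂ : Type u} {C : TwoCategory C₀ C₁ C₂} {n : ℕ}

/-! ### Low degrees -/

theorem isLaxData_const (C : TwoCategory C₀ C₁ C₂) (ι : Type*) [LinearOrder ι] (x : C₀) :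
    IsLaxData C (· ≤ · : ι → ι → Prop) (fun _ => x) (fun _ _ => C.one x)
      (fun _ _ _ => C.one₂ (C.one x)) where
  le h := h
  mono _ _ h _ := h
  arrow _ := TwoCategory.Arrow.one x
  edge_self _ := rfl
  cell _ _ _ := by
    rw [TwoCategory.one_cc (TwoCategory.Arrow.one x)]
    exact TwoCategory.Cell.one _
  triangle_left _ := rfl
  triangle_right _ := rfl
  coherent _ _ _ _ := rfl

theorem LaxFunctor.triangle_zero (u : LaxFunctor (ordinal 0) C) (i j k hij hjk) :
    u.triangle i j k hij hjk = C.one₂ (C.one (u.vertex 0)) := by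
  obtain rfl : i = 0 := Fin.fin_one_eq_zero i
  obtain rfl : j = 0 := Fin.fin_one_eq_zero j
  obtain rfl : k = 0 := Fin.fin_one_eq_zero k
  rw [u.triangle_left 0 0 le_rfl, u.edge_self]

theorem bijective_vertex_zero :
    Function.Bijective fun u : (nerve C).obj (op ⦋0⦌) => LaxFunctor.vertex u 0 := by
  constructor
  · intro u u' h
    refine LaxFunctor.ext_triangle fun i j l hij hjl => ?_
    rw [LaxFunctor.triangle_zero u, LaxFunctor.triangle_zero u']
    exact congrArg (fun x => C.one₂ (C.one x)) h
  · exact fun x => ⟨(isLaxData_const C (Fin 1) x).toLaxFunctor OrderHom.id (Fin.zero_le _), rfl⟩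

/-- Every triangle of a 1-simplex is degenerate. -/
theorem LaxFunctor.triangle_one (u : LaxFunctor (ordinal 1) C) (i j k hij hjk) :
    u.triangle i j k hij hjk = C.one₂ (u.edge i k (hij.trans hjk)) := by
  obtain rfl | rfl : j = i ∨ j = k := by omega
  · exact u.triangle_left _ _ _
  · exact u.triangle_right _ _ _

theorem bijective_edge_one :
    Function.Bijective fun u : (nerve C).obj (op ⦋1⦌) => LaxFunctor.edge u 0 1 (by decide) := by
  constructor
  · intro u u' h
    have h : LaxFunctor.edge u 0 1 (by decide) = LaxFunctor.edge u' 0 1 (by decide) := h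
    refine LaxFunctor.ext_triangle fun i j l hij hjl => ?_
    rw [LaxFunctor.triangle_one u, LaxFunctor.triangle_one u']
    have hs := congrArg C.src h
    have ht := congrArg C.tgt h
    rw [(LaxFunctor.arrow_edge u _ _ _).src, (LaxFunctor.arrow_edge u' _ _ _).src] at hs
    rw [(LaxFunctor.arrow_edge u _ _ _).tgt, (LaxFunctor.arrow_edge u' _ _ _).tgt] at ht
    generalize hij.trans hjl = hil
    clear hij hjl
    fin_cases i <;> fin_cases l
    · exact congrArg C.one₂ ((LaxFunctor.edge_self u 0).trans
        ((congrArg C.one hs).trans (LaxFunctor.edge_self u' 0).symm))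
    · exact congrArg C.one₂ h
    · exact absurd hil (by decide)
    · exact congrArg C.one₂ ((LaxFunctor.edge_self u 1).trans
        ((congrArg C.one ht).trans (LaxFunctor.edge_self u' 1).symm))
  · intro f
    obtain ⟨x, hx⟩ := (bijective_vertex_zero (C := C)).2 (C.src f)
    obtain ⟨v, hv⟩ := (PartialNerve.range_toFace_lastEdge (C := C) (n := 0)).ge
      (show (x, f) ∈ {z | _} from hx)
    obtain ⟨u, rfl⟩ := (PartialNerve.bijective_ofSimplex_zero (C := C) (n := 0)).2 v
    exact ⟨u, congrArg Prod.snd hv⟩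

variable [SmoothManifold C₀] [SmoothManifold C₁] [SmoothManifold C₂]

theorem exists_isNerveStructure_zero (hC : C.IsLie) :
    ∃ _ : SmoothManifold ((nerve C).obj (op ⦋0⦌)), IsNerveStructure C 0 := by
  obtain ⟨S, hS⟩ := exists_smoothManifold_of_bijective (bijective_vertex_zero (C := C))
  refine ⟨S, ?_⟩
  let G : ((⦋2⦌ ⟶ ⦋0⦌) → C₂) → C₀ := fun z =>
    C.src (C.src₂ (z (SimplexCategory.mkOfLeComp 0 0 0 le_rfl le_rfl)))
  have hG : ContMDiff (ModelWithCorners.pi fun _ : (⦋2⦌ ⟶ ⦋0⦌) => model C₂) (model C₀) ∞ G :=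
    hC.contMDiff_src.comp (hC.contMDiff_src₂.comp (contMDiff_pi_apply (I := fun _ => model C₂) _))
  refine .of_comp hG (contMDiff_pi fun a => ?_) (?_ : IsClosedRetractEmbedding _ _ (G ∘ _))
  · exact (hC.one₂.comp (hC.one.comp hS.contMDiff)).congr
      fun u => LaxFunctor.triangle_zero u _ _ _ _ _
  · convert hS using 1
    funext u
    change C.src (C.src₂ (LaxFunctor.triangle u 0 0 0 le_rfl le_rfl)) = _
    rw [LaxFunctor.triangle_zero u, C.src₂_one₂, C.src_one]

/-! ### Construction of the manifold structures -/

theorem exists_isStructure (hC : C.IsLie) (hinv : C.SmoothlyInvertible)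
    [SmoothManifold ((nerve C).obj (op ⦋n⦌))] (h : IsNerveStructure C n) (k : Fin (n + 1)) :
    ∃ _ : SmoothManifold (PartialNerve C n k), PartialNerve.IsStructure C k := by
  obtain ⟨inv, hs, hi⟩ := hinv.exists_isInverse
  induction k using Fin.reverseInduction with
  | last =>
    obtain ⟨T, hT, -⟩ := PartialNerve.exists_isStructure_last hC h
    exact ⟨T, hT⟩
  | cast k ih =>
    obtain ⟨T', hT'⟩ := ih
    obtain ⟨T, hT, -⟩ := PartialNerve.exists_isStructure_castSucc hC hs hi k hT'
    exact ⟨T, hT⟩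

theorem exists_isNerveStructure (hC : C.IsLie) (hinv : C.SmoothlyInvertible) (n : ℕ) :
    ∃ _ : SmoothManifold ((nerve C).obj (op ⦋n⦌)), IsNerveStructure C n := by
  induction n with
  | zero => exact exists_isNerveStructure_zero hC
  | succ n ih =>
    obtain ⟨S, hS⟩ := ih
    obtain ⟨T, hT⟩ := exists_isStructure hC hinv hS 0
    exact exists_isNerveStructure_succ hT

/-! ### The fibre products, for given manifold structures -/

theorem IsRetractEmbedding.isFibreProduct {P X Y Z : Type u} [SmoothManifold P] [SmoothManifold X]
    [SmoothManifold Y] [SmoothManifold Z] {p : P → X} {q : P → Y} {f : X → Z} {g : Y → Z}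
    (h : IsRetractEmbedding (model P) ((model X).prod (model Y)) fun w => (p w, q w))
    (hf : Smooth f) (hg : Smooth g)
    (hr : range (fun w => (p w, q w)) = {z | f z.1 = g z.2}) : IsFibreProduct p q f g :=
  ⟨hf, hg, h.isSmoothEmbedding, hr⟩

omit [SmoothManifold C₀] [SmoothManifold C₁] in
/-- The manifold structure of `N^k_{n+1} C` is unique, so that an embedding for one such structure
is an embedding for any other. -/
theorem PartialNerve.IsStructure.isRetractEmbedding_of_exists {k : Fin (n + 1)}
    {E H M : Type*} [NormedAddCommGroup E] [NormedSpace ℝ E]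
    [TopologicalSpace H] [TopologicalSpace M] [ChartedSpace H M] {I : ModelWithCorners ℝ E H}
    {f : PartialNerve C n k → M}
    (T : SmoothManifold (PartialNerve C n k)) (hT : IsStructure C k)
    (h : ∃ _ : SmoothManifold (PartialNerve C n k), IsStructure C k ∧
      IsRetractEmbedding (model (PartialNerve C n k)) I f) :
    IsRetractEmbedding (model (PartialNerve C n k)) I f := by
  have hT := IsClosedRetractEmbedding.toIsRetractEmbedding hT
  obtain ⟨T', hT', hf⟩ := h
  exact @isRetractEmbedding_comp_of_comp_eq _ _ _ _ _ _ _ _ _ _ _ _ _ _ _ _ _ _ _ _ T T' _ _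
    hT hT'.toIsRetractEmbedding id id rfl rfl (fun _ => rfl) f hf

/-- A smooth embedding determines the manifold structure of its domain. -/
theorem isDiffeo_of_isSmoothEmbedding {P P' : Type u} [SmoothManifold P] [SmoothManifold P']
    {E H N : Type*} [NormedAddCommGroup E] [NormedSpace ℝ E] [TopologicalSpace H]
    [TopologicalSpace N] {J : ModelWithCorners ℝ E H} [ChartedSpace H N] [IsManifold J ∞ N]
    {f : P → N} {f' : P' → N} (h' : Manifold.IsSmoothEmbedding (model P') J ∞ f')
    (h : IsRetractEmbedding (model P) J f) {e : P' → P} {e' : P → P'} (he : f ∘ e = f')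
    (hl : Function.LeftInverse e' e) (hr : Function.RightInverse e' e) : IsDiffeo e := by
  have he' : f' ∘ e' = f := by rw [← he, Function.comp_assoc, hr.comp_eq_id, Function.comp_id]
  refine ⟨⟨⟨e, e', hl, hr⟩, h.contMDiff_of_comp (he ▸ h'.contMDiff),
    (ContMDiff.iff_comp_isImmersion h'.isImmersion).2 ⟨?_, he' ▸ h.contMDiff⟩⟩, rfl⟩
  exact h'.isEmbedding.continuous_iff.2 (he' ▸ h.contMDiff.continuous)

end Existence

end LieTwo

open LieTwo LieTwo.PartialNerve in
theorem theorem6 {C₀ C₁ C₂ : Type u}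
    [LieTwo.SmoothManifold C₀] [LieTwo.SmoothManifold C₁] [LieTwo.SmoothManifold C₂]
    (C : LieTwo.TwoCategory C₀ C₁ C₂) (hC : C.IsLie) (hinv : C.SmoothlyInvertible) :
    ∃ S : ∀ n : SimplexCategoryᵒᵖ, LieTwo.SmoothManifold ((LieTwo.nerve C).obj n),
      -- the simplicial operators are smooth
      LieTwo.IsSimplicialManifold (LieTwo.nerve C) ∧
      -- the canonical inclusion in the ambient simplicial manifold is a closed embedding
      (∀ n : SimplexCategoryᵒᵖ, LieTwo.IsClosedEmbeddingInAmbient C n) ∧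
      -- this determines the smooth structure
      (∀ (n : SimplexCategoryᵒᵖ) (S' : LieTwo.SmoothManifold ((LieTwo.nerve C).obj n)),
        @LieTwo.IsClosedEmbeddingInAmbient _ _ _ _ C n S' →
          @LieTwo.IsDiffeo _ _ S' (S n) id) ∧
      -- the obvious identifications `N_0 C = C₀` and `N_1 C = C₁` are diffeomorphisms
      LieTwo.IsDiffeo (X := (LieTwo.nerve C).obj (op ⦋0⦌))
        (fun u => LieTwo.LaxFunctor.vertex u 0) ∧
      LieTwo.IsDiffeo (X := (LieTwo.nerve C).obj (op ⦋1⦌))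
        (fun u => LieTwo.LaxFunctor.edge u 0 1 (by decide)) ∧
      -- `N_{n+1} C` is built from `N_n C` by iterated fibre products, through the partial nerves
      (∀ n : ℕ, ∃ T : ∀ k : Fin (n + 1), LieTwo.SmoothManifold (LieTwo.PartialNerve C n k),
        LieTwo.IsFibreProduct (P := LieTwo.PartialNerve C n (Fin.last n))
          (X := (LieTwo.nerve C).obj (op ⦋n⦌)) (Y := C₁) (Z := C₀)
          LieTwo.PartialNerve.toFace LieTwo.PartialNerve.lastEdge
          (fun u => LieTwo.LaxFunctor.vertex u (Fin.last n)) C.src ∧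
        (∀ k : Fin n,
          LieTwo.IsFibreProduct (P := LieTwo.PartialNerve C n k.castSucc)
            (X := LieTwo.PartialNerve C n k.succ) (Y := C₂) (Z := C₁)
            (LieTwo.PartialNerve.restrict k) (LieTwo.PartialNerve.newTriangle k)
            (LieTwo.PartialNerve.newComposite k) C.tgt₂) ∧
        LieTwo.IsDiffeo (X := (LieTwo.nerve C).obj (op ⦋n + 1⦌))
          (Y := LieTwo.PartialNerve C n 0) (LieTwo.PartialNerve.ofSimplex 0)) := by
  choose S₀ hS₀ using exists_isNerveStructure hC hinv
  let S : ∀ n : SimplexCategoryᵒᵖ, SmoothManifold ((nerve C).obj n) := fun n => S₀ n.unop.len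
  have hS : ∀ n : ℕ, IsNerveStructure C n := hS₀
  have hR := fun n => (hS n).toIsRetractEmbedding
  obtain ⟨inv, hs, hi⟩ := hinv.exists_isInverse
  refine ⟨S, fun {m n} b => ?_, fun n => ⟨(hS n.unop.len).isSmoothEmbedding,
    (hS n.unop.len).isClosed_range⟩, fun n S' hS' => ?_, ?_, ?_, fun n => ?_⟩
  · exact (hS n.unop.len).contMDiff_of_triangle fun i j l hij hjl =>
      (hS m.unop.len).contMDiff_triangle _ _ _ (b.unop.toOrderHom.monotone hij)
        (b.unop.toOrderHom.monotone hjl)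
  · exact @isDiffeo_of_isSmoothEmbedding _ _ (S n) S' _ _ _ _ _ _ _ _ _ _ _ _ hS'.1 (hR n.unop.len) id id rfl
      (fun _ => rfl) fun _ => rfl
  · refine isDiffeo_of_bijective ((hS 0).contMDiff_vertex hC 0) bijective_vertex_zero
      fun g hg => (hS 0).contMDiff_of_triangle fun i j l hij hjl => ?_
    refine (hC.one₂.comp hC.one).congr fun x => ?_
    exact (LaxFunctor.triangle_zero (g x) i j l hij hjl).trans
      (congrArg (fun x => C.one₂ (C.one x)) (hg x))
  · have h01 : (0 : Fin 2) ≤ 1 := by decide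
    refine isDiffeo_of_bijective ((hS 1).contMDiff_edge hC 0 1 h01) bijective_edge_one
      fun g hg => (hS 1).contMDiff_of_triangle fun i j l hij hjl => ?_
    have hg : ∀ f, LaxFunctor.edge (g f) 0 1 h01 = f := hg
    refine ContMDiff.congr ?_ fun f => LaxFunctor.triangle_one (g f) i j l hij hjl
    refine hC.one₂.comp ?_
    generalize hij.trans hjl = hil
    clear hij hjl
    -- the edges of a 1-simplex are `f` and the units of its source and target
    fin_cases i <;> fin_cases l
    · refine (hC.one.comp hC.contMDiff_src).congr fun f => ?_
      exact (LaxFunctor.edge_self (g f) 0).trans (congrArg C.one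
        ((LaxFunctor.arrow_edge (g f) 0 1 h01).src.symm.trans (congrArg C.src (hg f))))
    · exact contMDiff_id.congr hg
    · exact absurd hil (by decide)
    · refine (hC.one.comp hC.contMDiff_tgt).congr fun f => ?_
      exact (LaxFunctor.edge_self (g f) 1).trans (congrArg C.one
        ((LaxFunctor.arrow_edge (g f) 0 1 h01).tgt.symm.trans (congrArg C.tgt (hg f))))
  · choose T hT using exists_isStructure hC hinv (hS n)
    refine ⟨T, ?_, fun k => ?_, ?_⟩
    · exact (IsStructure.isRetractEmbedding_of_exists (T _) (hT _)
        (exists_isStructure_last hC (hS n))).isFibreProduct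
        ((hS n).contMDiff_vertex hC (Fin.last n)) hC.contMDiff_src range_toFace_lastEdge
    · exact (IsStructure.isRetractEmbedding_of_exists (T _) (hT _)
        (exists_isStructure_castSucc hC hs hi k (hT _))).isFibreProduct
        (contMDiff_newComposite hC k (hT _)) hC.contMDiff_tgt₂ (range_restrict_newTriangle hi k)
    · have hE : ∀ {i l : Fin (n + 2)}, i ≤ l → IsEdge (0 : Fin (n + 1)) i l := fun hil =>
        ⟨hil, Or.inr (Fin.zero_le _)⟩
      refine isDiffeo_of_bijective ?_ bijective_ofSimplex_zero fun g hg => ?_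
      · refine (hT 0).contMDiff_of_tri fun hij hjl hil => ?_
        exact ((hS (n + 1)).contMDiff_triangle _ _ _ hij hjl).congr fun u =>
          tri_eq (ofSimplex 0 u) hij hjl hil
      · refine (hS (n + 1)).contMDiff_of_triangle fun i j l hij hjl => ?_
        refine ((hT 0).contMDiff_tri hij hjl (hE (hij.trans hjl))).congr fun v => ?_
        refine (tri_eq (ofSimplex 0 (g v)) hij hjl (hE (hij.trans hjl))).symm.trans ?_
        rw [hg v]
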